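/- Let $n\ge 1$, let $\theta_1,\dots,\theta_n>0$, and let $\mathbb V_{2n}^\theta$ be Moyal $2n$-space, i.e. the complex unital algebra generated by $x^1,\dots,x^{2n}$ with $[x^i,x^j]={\rm i}\,\theta^{ij}\,1$, where $\theta=\bigoplus_{j=1}^n\begin{pmatrix}0&\theta_j\\-\theta_j&0\end{pmatrix}$. It acts on the Fock module $\mathcal F=\ell^2(\mathbb N_0^n)$, with number basis $e_\nu$, through $a_je_\nu=\sqrt{\nu_j}\,e_{\nu-\delta_j}$ and $a_j^\dagger e_\nu=\sqrt{\nu_j+1}\,e_{\nu+\delta_j}$, where $a_j=(x^{2j-1}+{\rm i}x^{2j})/\sqrt{2\theta_j}$ and $a_j^\dagger=(x^{2j-1}-{\rm i}x^{2j})/\sqrt{2\theta_j}$; fields on $\mathbb V_{2n}^\theta$ are the elements of the algebra of bounded operators on $\mathcal F$ that this action generates (as a von Neumann algebra). Let $V\neq 0$ be a real polynomial with $V(0)=V'(0)=0$. A static soliton is a Hermitian field $\phi$ with $V'(\phi)=0$ (the static equation of motion) such that $V(\phi)$ is trace class, so that the static action $S(\phi)=|{\rm Pf}(2\pi\theta)|^{-1}\,{\rm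 Tr}\,V(\phi)$ is well defined and finite. Let $\lambda\ne0$ be a real critical point of $V$ and let $k\ge 1$. A static $k$-soliton (at $\lambda$) is a static soliton $\phi$ whose eigenspace at $\lambda$ has dimension $k$ and whose eigenspaces at all other nonzero real critical points of $V$ are zero. Let $\mathcal M_k^0(\mathbb V_{2n}^\theta)$ be the moduli space (the set of all) static $k$-solitons at $\lambda$, with the operator norm topology. Let ${\rm Gr}(k,\mathcal F)={\rm U}(\mathcal F)/\big({\rm U}(k)\times{\rm U}(\mathcal F)\big)$ with the quotient of the norm topology, where ${\rm U}(k)\times{\rm U}(\mathcal F)$ is embedded block-diagonally by means of any unitary splitting $\mathbb C^k\oplus\mathcal F\cong\mathcal F$ (such splittings exist). Let $E_k$ be the tautological bundle, whose fibre at $[u]$ is the subspace $u(\mathbb C^k\oplus 0)$ of $\mathcal F$. Then, for every such splitting: 1. The points of ${\rm Gr}(k,\mathcal F)$ correspond bijectively, through the fibres of $E_k$, to the $k$-dimensional subspaces of $\mathcal F$. 2. ${\rm Gr}(k,\mathcal F)$ is a complex manifold modelled on the infinite-dimensional Banach space of bounded linear maps $\mathbb C^k\to\mathcal F$, with the standard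 graph coordinates as charts: $T\mapsto{\rm graph}(T)\subset\mathbb C^k\oplus\mathcal F\cong\mathcal F$, for all unitary splittings $\mathbb C^k\oplus\mathcal F\cong\mathcal F$. 3. Let $\det(E_k)=\bigwedge^kE_k$ carry the metric induced by the inner product of $\mathcal F$, and let $\Theta$ be the curvature of this Hermitian holomorphic line bundle, i.e. $\Theta={\rm d}(\partial\log\|s\|^2)$ for nowhere vanishing local holomorphic sections $s$. Then $\Theta={\rm i}\,\omega$, where $\omega$ is a Kähler form on ${\rm Gr}(k,\mathcal F)$: a smooth closed real two-form, invariant under the complex structure, such that $\omega(u,{\rm i}u)$ is positive definite and defines the topology of each tangent space. 4. $\mathcal M_k^0(\mathbb V_{2n}^\theta)$ is an infinite-dimensional Kähler manifold isomorphic to ${\rm Gr}(k,\mathcal F)$: it has the structure of a complex manifold (compatible with its topology) and a Kähler form for which there is a biholomorphic map $\Psi:\mathcal M_k^0(\mathbb V_{2n}^\theta)\to{\rm Gr}(k,\mathcal F)$ that identifies the Kähler forms and sends each $\phi$ to the point corresponding to the subspace ${\rm im}(\phi)\subset\mathcal F$. -/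

import Mathlib

open scoped Manifold ContDiff InnerProductSpace Topology
open Polynomial

/-! ### Moyal space and its Fock module -/

namespace Moyal

/-- The normal form `⨁ j, (0, θ j; -θ j, 0)` of a non-degenerate skew-symmetric `2n × 2n` matrix.
The index `(0, j)` is the coordinate `x^{2j-1}`, the index `(1, j)` is `x^{2j}`. -/
def thetaMatrix {n : ℕ} (θ : Fin n → ℝ) : Matrix (Fin 2 × Fin n) (Fin 2 × Fin n) ℝ :=
  Matrix.blockDiagonal fun j => !![0, θ j; -θ j, 0]

/-- The relations `x^i x^j = x^j x^i + i θ^{ij} 1` of Moyal `2n`-space. -/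
inductive Rel {n : ℕ} (θ : Fin n → ℝ) :
    FreeAlgebra ℂ (Fin 2 × Fin n) → FreeAlgebra ℂ (Fin 2 × Fin n) → Prop
  | comm (i j : Fin 2 × Fin n) : Rel θ
      (FreeAlgebra.ι ℂ i * FreeAlgebra.ι ℂ j)
      (FreeAlgebra.ι ℂ j * FreeAlgebra.ι ℂ i +
        algebraMap ℂ _ (Complex.I * (thetaMatrix θ i j : ℂ)))

/-- Moyal `2n`-space: the polynomial algebra on `x^1, …, x^{2n}` with
`[x^i, x^j] = i θ^{ij} 1`. -/
abbrev Space {n : ℕ} (θ : Fin n → ℝ) : Type := RingQuot (Rel θ)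

/-- The generators `x^i` of Moyal space. -/
noncomputable def coord {n : ℕ} (θ : Fin n → ℝ) (i : Fin 2 × Fin n) : Space θ :=
  RingQuot.mkAlgHom ℂ (Rel θ) (FreeAlgebra.ι ℂ i)

/-- The Fock space `ℓ²(ℕ₀ⁿ)`. -/
abbrev Fock (n : ℕ) : Type := lp (fun _ : Fin n → ℕ => ℂ) 2

/-- Finite linear combinations of the number basis: the common invariant domain on which the
(unbounded) operators of the Fock module act. -/
abbrev FinFock (n : ℕ) : Type := (Fin n → ℕ) →₀ ℂ

/-- The number basis `e_ν` of Fock space. -/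
noncomputable def numberBasis {n : ℕ} (ν : Fin n → ℕ) : Fock n := lp.single 2 ν (1 : ℂ)

/-- The inclusion of the finite linear combinations of the number basis in Fock space. -/
noncomputable def incl (n : ℕ) : FinFock n →ₗ[ℂ] Fock n :=
  Finsupp.linearCombination ℂ numberBasis

/-- Annihilation operators: `a_j e_ν = √ν_j e_{ν - δ_j}` (which is `0` if `ν_j = 0`). -/
noncomputable def annih {n : ℕ} (j : Fin n) : FinFock n →ₗ[ℂ] FinFock n :=
  Finsupp.linearCombination ℂ fun ν =>
    Finsupp.single (ν - Pi.single j 1) ((Real.sqrt (ν j) : ℝ) : ℂ)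

/-- Creation operators: `a_j† e_ν = √(ν_j + 1) e_{ν + δ_j}`. -/
noncomputable def creat {n : ℕ} (j : Fin n) : FinFock n →ₗ[ℂ] FinFock n :=
  Finsupp.linearCombination ℂ fun ν =>
    Finsupp.single (ν + Pi.single j 1) ((Real.sqrt (ν j + 1) : ℝ) : ℂ)

/-- The coordinate operators determined by
`a_j = (x^{2j-1} + i x^{2j}) / √(2 θ_j)` and `a_j† = (x^{2j-1} - i x^{2j}) / √(2 θ_j)`. -/
noncomputable def coordOp {n : ℕ} (θ : Fin n → ℝ) (i : Fin 2 × Fin n) :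
    FinFock n →ₗ[ℂ] FinFock n :=
  if i.1 = 0 then ((Real.sqrt (θ i.2 / 2) : ℝ) : ℂ) • (annih i.2 + creat i.2)
  else (-Complex.I * ((Real.sqrt (θ i.2 / 2) : ℝ) : ℂ)) • (annih i.2 - creat i.2)

theorem annih_creat {n : ℕ} (i j : Fin n) :
    annih i ∘ₗ creat j = creat j ∘ₗ annih i + if i = j then LinearMap.id else 0 := by
  ext1 ν
  ext1
  by_cases h : i = j
  · subst h
    have e1 : ν + Pi.single i 1 - Pi.single i 1 = ν := by simp
    have h1 : (Real.sqrt ((ν i : ℝ) + 1) : ℂ) * (Real.sqrt ((ν i : ℝ) + 1) : ℂ) = (ν i : ℂ) + 1 := by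
      rw [← Complex.ofReal_mul, Real.mul_self_sqrt (by positivity)]; push_cast; rfl
    rcases Nat.eq_zero_or_pos (ν i) with h0 | h0
    · simp [annih, creat, h0, e1, add_comm]
    · have e2 : ν - Pi.single i 1 + Pi.single i 1 = ν := by
        ext l
        by_cases hl : l = i
        · subst hl; simp; omega
        · simp [hl]
      have h3 : ((ν i - 1 : ℕ) : ℝ) + 1 = ν i := by
        rw [Nat.cast_sub h0]; simp
      have h2 : (Real.sqrt (ν i : ℝ) : ℂ) * (Real.sqrt (ν i : ℝ) : ℂ) = (ν i : ℂ) := by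
        rw [← Complex.ofReal_mul, Real.mul_self_sqrt (by positivity)]; push_cast; rfl
      simp [annih, creat, e1, e2, h3, h1, h2, ← Finsupp.single_add]
  · have h' : ¬ j = i := fun h' => h h'.symm
    have e1 : ν + Pi.single j 1 - Pi.single i 1 = ν - Pi.single i 1 + Pi.single j 1 := by
      ext l
      by_cases hl : l = i
      · subst hl; simp [h]
      · simp [hl]
    simp [annih, creat, h, h', e1, mul_comm]

theorem annih_annih {n : ℕ} (i j : Fin n) :
    annih i ∘ₗ annih j = annih j ∘ₗ annih i := by
  by_cases h : i = j
  · rw [h]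
  have h' : ¬ j = i := fun h' => h h'.symm
  ext1 ν
  ext1
  have e1 : ν - Pi.single j 1 - Pi.single i 1 = ν - Pi.single i 1 - Pi.single j 1 := by
    ext l; simp; omega
  simp [annih, h, h', e1, mul_comm]

theorem creat_creat {n : ℕ} (i j : Fin n) :
    creat i ∘ₗ creat j = creat j ∘ₗ creat i := by
  by_cases h : i = j
  · rw [h]
  have h' : ¬ j = i := fun h' => h h'.symm
  ext1 ν
  ext1
  have e1 : ν + Pi.single j 1 + Pi.single i 1 = ν + Pi.single i 1 + Pi.single j 1 := by
    ext l; simp; omega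
  simp [creat, h, h', e1, mul_comm]

theorem coordOp_comm {n : ℕ} (θ : Fin n → ℝ) (hθ : ∀ j, 0 < θ j) (i j : Fin 2 × Fin n) :
    coordOp θ i ∘ₗ coordOp θ j = coordOp θ j ∘ₗ coordOp θ i +
      (Complex.I * (thetaMatrix θ i j : ℂ)) • LinearMap.id := by
  have key : ∀ l : Fin n, (Real.sqrt (θ l / 2) : ℂ) * (Real.sqrt (θ l / 2) : ℂ) = (θ l : ℂ) / 2 := by
    intro l
    rw [← Complex.ofReal_mul, Real.mul_self_sqrt (by have := hθ l; positivity)]; push_cast; rfl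
  obtain ⟨a, l⟩ := i
  obtain ⟨b, m⟩ := j
  have hAA := fun u => LinearMap.congr_fun (annih_annih l m) u
  have hCC := fun u => LinearMap.congr_fun (creat_creat l m) u
  have hAC := fun u => LinearMap.congr_fun (annih_creat l m) u
  have hCA := fun u => LinearMap.congr_fun (annih_creat m l) u
  simp only [LinearMap.comp_apply, LinearMap.add_apply] at hAA hCC hAC hCA
  have key2 : 2 * ((Real.sqrt (θ l / 2) : ℂ) * (Real.sqrt (θ l / 2) : ℂ)) = (θ l : ℂ) := by
    rw [key l]; ring
  rw [Real.sqrt_div (hθ l).le, Complex.ofReal_div] at key2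
  refine LinearMap.ext fun u => ?_
  by_cases hlm : l = m
  · subst hlm
    simp only [if_true, LinearMap.id_apply] at hAC
    fin_cases a <;> fin_cases b <;>
    · simp [coordOp, thetaMatrix, Matrix.blockDiagonal_apply, hAC]
      try module
      try (match_scalars <;> first | (ring_nf; done) |
        (linear_combination (Complex.I) * key2) |
        (linear_combination (-Complex.I) * key2))
  · have hml : ¬ m = l := fun h => hlm h.symm
    simp only [hlm, hml, if_false, LinearMap.zero_apply, add_zero] at hAC hCA
    fin_cases a <;> fin_cases b <;>
    · simp [coordOp, thetaMatrix, Matrix.blockDiagonal_apply, hAC, hCA, hAA, hCC, hlm]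
      try module

/-- The Fock module: the representation of Moyal space on (the finite vectors of) Fock space. -/
noncomputable def fockRep {n : ℕ} (θ : Fin n → ℝ) (hθ : ∀ j, 0 < θ j) :
    Space θ →ₐ[ℂ] Module.End ℂ (FinFock n) :=
  RingQuot.liftAlgHom ℂ ⟨FreeAlgebra.lift ℂ (coordOp θ), by
    rintro _ _ ⟨i, j⟩
    rw [map_mul, map_add, map_mul, AlgHom.commutes, Algebra.algebraMap_eq_smul_one,
      FreeAlgebra.lift_ι_apply, FreeAlgebra.lift_ι_apply]
    exact coordOp_comm θ hθ i j⟩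

/-- The action of a generator of Moyal space on a finite vector of the Fock module. -/
noncomputable def act {n : ℕ} (θ : Fin n → ℝ) (hθ : ∀ j, 0 < θ j) (i : Fin 2 × Fin n)
    (u : FinFock n) : FinFock n :=
  fockRep θ hθ (coord θ i) u

/-- Bounded operators on Fock space commuting with the Fock module action of Moyal space. Since the
coordinates act by unbounded symmetric operators, commutation is tested between finite vectors. -/
def commutant {n : ℕ} (θ : Fin n → ℝ) (hθ : ∀ j, 0 < θ j) : Set (Fock n →L[ℂ] Fock n) :=
  {B | ∀ (i : Fin 2 × Fin n) (u v : FinFock n),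
    ⟪incl n (act θ hθ i u), B (incl n v)⟫_ℂ = ⟪incl n u, B (incl n (act θ hθ i v))⟫_ℂ}

/-- The completion of Moyal space in its Fock representation: the algebra of bounded operators on
Fock space generated, as a von Neumann algebra (bicommutant), by the action of Moyal space. -/
def fieldAlgebra {n : ℕ} (θ : Fin n → ℝ) (hθ : ∀ j, 0 < θ j) : Set (Fock n →L[ℂ] Fock n) :=
  Set.centralizer (commutant θ hθ)

/-! ### Static solitons -/

/-- A bounded operator `T` on a Hilbert space with orthonormal basis `b` is trace class:
`Tr |T| = ∑ i, ⟨b i, |T| b i⟩ < ∞`. -/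
def IsTraceClass {ι H : Type} [NormedAddCommGroup H] [InnerProductSpace ℂ H] [CompleteSpace H]
    (b : ι → H) (T : H →L[ℂ] H) : Prop :=
  Summable fun i : ι => Complex.re ⟪b i, CFC.abs T (b i)⟫_ℂ

/-- The trace of a (trace class) operator on a Hilbert space with orthonormal basis `b`. -/
noncomputable def trace {ι H : Type} [NormedAddCommGroup H] [InnerProductSpace ℂ H]
    (b : ι → H) (T : H →L[ℂ] H) : ℂ :=
  ∑' i : ι, ⟪b i, T (b i)⟫_ℂ

/-- `V(φ)` for a real polynomial `V` and a bounded operator `φ`. -/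
noncomputable def polyOp {n : ℕ} (V : ℝ[X]) (φ : Fock n →L[ℂ] Fock n) : Fock n →L[ℂ] Fock n :=
  aeval φ (V.map (algebraMap ℝ ℂ))

/-- `S` is the value at `φ` of the action functional `|Pf(2πθ)|⁻¹ Tr V(φ)` of static fields; this
includes the claim that the action is well defined and finite. Here `|Pf A| = √(det A)`. -/
def HasStaticAction {n : ℕ} (θ : Fin n → ℝ) (V : ℝ[X]) (φ : Fock n →L[ℂ] Fock n) (S : ℝ) : Prop :=
  IsTraceClass numberBasis (polyOp V φ) ∧
    (S : ℂ) = ((Real.sqrt ((2 * Real.pi) • thetaMatrix θ).det)⁻¹ : ℝ) *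
      trace numberBasis (polyOp V φ)

/-- A static soliton: a Hermitian field satisfying the static equation of motion `V'(φ) = 0`,
of finite action. -/
structure IsStaticSoliton {n : ℕ} (θ : Fin n → ℝ) (hθ : ∀ j, 0 < θ j) (V : ℝ[X])
    (φ : Fock n →L[ℂ] Fock n) : Prop where
  field : φ ∈ fieldAlgebra θ hθ
  hermitian : IsSelfAdjoint φ
  eom : polyOp V.derivative φ = 0
  finite_action : ∃ S : ℝ, HasStaticAction θ V φ S

/-- A static `k`-soliton at the nonzero critical point `lam` of `V`: among the eigenprojectors
of the static soliton `φ` at the nonzero critical points of `V`, the one at `lam` has rank `k`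
and all the others vanish. -/
structure IsStaticKSoliton {n : ℕ} (θ : Fin n → ℝ) (hθ : ∀ j, 0 < θ j) (V : ℝ[X]) (lam : ℝ)
    (k : ℕ) (φ : Fock n →L[ℂ] Fock n) : Prop extends IsStaticSoliton θ hθ V φ where
  finiteDimensional : FiniteDimensional ℂ (Module.End.eigenspace φ.toLinearMap (lam : ℂ))
  rank : Module.finrank ℂ (Module.End.eigenspace φ.toLinearMap (lam : ℂ)) = k
  others : ∀ μ : ℝ, V.derivative.IsRoot μ → μ ≠ 0 → μ ≠ lam →
    Module.End.eigenspace φ.toLinearMap (μ : ℂ) = ⊥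

/-- The moduli space of static `k`-solitons at the critical point `lam`, with the topology of the
operator norm. -/
abbrev StaticModuli {n : ℕ} (θ : Fin n → ℝ) (hθ : ∀ j, 0 < θ j) (V : ℝ[X]) (lam : ℝ)
    (k : ℕ) : Type :=
  {φ : Fock n →L[ℂ] Fock n // IsStaticKSoliton θ hθ V lam k φ}

end Moyal

/-! ### The Grassmannian -/

namespace Grass

/-- The `k`-dimensional subspaces of `F`. -/
abbrev FinSubspaces (k : ℕ) (F : Type) [AddCommGroup F] [Module ℂ F] : Type :=
  {W : Submodule ℂ F // FiniteDimensional ℂ W ∧ Module.finrank ℂ W = k}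

section

variable (k : ℕ) (F : Type) [NormedAddCommGroup F] [InnerProductSpace ℂ F]

/-- Splittings `ℂᵏ ⊕ F ≅ F` of the Hilbert space `F`. -/
abbrev Splitting : Type :=
  WithLp 2 (EuclideanSpace ℂ (Fin k) × F) ≃ₗᵢ[ℂ] F

/-- The model space of the Grassmannian: bounded operators `ℂᵏ → F`. -/
abbrev Model : Type := EuclideanSpace ℂ (Fin k) →L[ℂ] F

end

section

variable {k : ℕ} {F : Type} [NormedAddCommGroup F] [InnerProductSpace ℂ F]

/-- The map `x ↦ Φ (x, T x)`, whose image is the graph of `T : ℂᵏ → F` in `F ≅ ℂᵏ ⊕ F`. -/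
noncomputable def graphMap (Φ : Splitting k F) (T : Model k F) : EuclideanSpace ℂ (Fin k) →ₗ[ℂ] F where
  toFun x := Φ (WithLp.toLp 2 (x, T x))
  map_add' x y := by rw [← map_add, map_add]; rfl
  map_smul' c x := by rw [map_smul, ← Prod.smul_mk, WithLp.toLp_smul, map_smul]; rfl

theorem graphMap_injective (Φ : Splitting k F) (T : Model k F) :
    Function.Injective (graphMap Φ T) := by
  intro x y h
  have h' := Φ.injective h
  exact congrArg (fun z => z.fst) h'

/-- The graph of `T : ℂᵏ → F` as a `k`-dimensional subspace of `F ≅ ℂᵏ ⊕ F`. -/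
noncomputable def graph (Φ : Splitting k F) (T : Model k F) : FinSubspaces k F :=
  ⟨LinearMap.range (graphMap Φ T), inferInstance, by
    rw [LinearMap.finrank_range_of_inj (graphMap_injective Φ T)]; simp⟩

variable [CompleteSpace F]

/-- The image of a `k`-dimensional subspace under a unitary. -/
noncomputable def unitaryMap (u : unitary (F →L[ℂ] F)) (W : FinSubspaces k F) : FinSubspaces k F :=
  ⟨W.1.map (u : F →L[ℂ] F).toLinearMap, by
    have := W.2.1
    refine ⟨inferInstance, ?_⟩
    have hinj : Function.Injective (u : F →L[ℂ] F).toLinearMap := by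
      intro x y h
      have h1 := congrArg (fun z => (star (u : F →L[ℂ] F)) z) h
      simpa [← mul_apply_eq_comp] using h1
    exact (Submodule.equivMapOfInjective _ hinj W.1).finrank_eq.symm.trans W.2.2⟩

/-- The subgroup `U(k) × U(F)` of `U(F)`: the unitaries that are block diagonal with respect to
the splitting `F ≅ ℂᵏ ⊕ F`. -/
noncomputable def blockUnitary (Φ : Splitting k F) : Subgroup (unitary (F →L[ℂ] F)) where
  carrier := {u | ∃ (A : Matrix.unitaryGroup (Fin k) ℂ) (B : unitary (F →L[ℂ] F)),
    ∀ x y, (u : F →L[ℂ] F) (Φ (WithLp.toLp 2 (x, y))) =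
      Φ (WithLp.toLp 2 (Matrix.toEuclideanCLM (𝕜 := ℂ) (A : Matrix (Fin k) (Fin k) ℂ) x,
        (B : F →L[ℂ] F) y))}
  one_mem' := ⟨1, 1, fun x y => by simp⟩
  mul_mem' := by
    rintro u v ⟨A, B, h⟩ ⟨A', B', h'⟩
    exact ⟨A * A', B * B', fun x y => by simp [h, h']⟩
  inv_mem' := by
    rintro u ⟨A, B, h⟩
    refine ⟨A⁻¹, B⁻¹, fun x y => ?_⟩
    have h1 := h (Matrix.toEuclideanCLM (𝕜 := ℂ) ((A⁻¹ : Matrix.unitaryGroup (Fin k) ℂ) :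
      Matrix (Fin k) (Fin k) ℂ) x) (((B⁻¹ : unitary (F →L[ℂ] F)) : F →L[ℂ] F) y)
    rw [← mul_apply_eq_comp, ← mul_apply_eq_comp, ← map_mul,
      ← Submonoid.coe_mul, ← Submonoid.coe_mul, mul_inv_cancel, mul_inv_cancel] at h1
    simp only [OneMemClass.coe_one, map_one, one_apply_eq_self] at h1
    rw [← h1, ← mul_apply_eq_comp, ← Submonoid.coe_mul, inv_mul_cancel]
    simp

/-- The Grassmannian `Gr(k, F) = U(F) / U(k) × U(F)`, with the quotient topology of the norm
topology of `U(F)`. -/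
abbrev Gr (Φ : Splitting k F) : Type := unitary (F →L[ℂ] F) ⧸ blockUnitary Φ

theorem unitaryMap_mul (u v : unitary (F →L[ℂ] F)) (W : FinSubspaces k F) :
    unitaryMap (u * v) W = unitaryMap u (unitaryMap v W) := by
  apply Subtype.ext
  exact Submodule.map_comp (v : F →L[ℂ] F).toLinearMap (u : F →L[ℂ] F).toLinearMap W.1

theorem unitaryMap_block (Φ : Splitting k F) {w : unitary (F →L[ℂ] F)}
    (hw : w ∈ blockUnitary Φ) : unitaryMap w (graph Φ 0) = graph Φ 0 := by
  have key : ∀ w ∈ blockUnitary Φ,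
      (graph Φ 0).1.map (w : F →L[ℂ] F).toLinearMap ≤ (graph Φ 0).1 := by
    rintro w ⟨A, B, h⟩ _ ⟨_, ⟨x, rfl⟩, rfl⟩
    refine ⟨Matrix.toEuclideanCLM (𝕜 := ℂ) (A : Matrix (Fin k) (Fin k) ℂ) x, ?_⟩
    have := h x 0
    simp only [map_zero] at this
    exact this.symm
  apply Subtype.ext
  refine le_antisymm (key w hw) ?_
  have h1 := Submodule.map_mono (f := (w : F →L[ℂ] F).toLinearMap)
    (key w⁻¹ (inv_mem hw))
  have h2 : (unitaryMap (w * w⁻¹) (graph Φ 0)).1 = (graph Φ 0).1 := by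
    rw [mul_inv_cancel]
    exact Submodule.map_id _
  rw [unitaryMap_mul] at h2
  exact h2.symm.le.trans h1

/-- The `k`-dimensional subspace of `F` corresponding to a point `[u]` of the Grassmannian: the
image under `u` of the summand `ℂᵏ` of `F ≅ ℂᵏ ⊕ F`. It is the fibre at `[u]` of the
tautological bundle `E_k`. -/
noncomputable def taut (Φ : Splitting k F) : Gr Φ → FinSubspaces k F :=
  Quotient.lift (fun u => unitaryMap u (graph Φ 0)) fun u v huv => by
    have h : u⁻¹ * v ∈ blockUnitary Φ := QuotientGroup.leftRel_apply.mp huv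
    have h2 := unitaryMap_block Φ h
    calc unitaryMap u (graph Φ 0) = unitaryMap u (unitaryMap (u⁻¹ * v) (graph Φ 0)) := by rw [h2]
      _ = unitaryMap v (graph Φ 0) := by rw [← unitaryMap_mul, mul_inv_cancel_left]

/-- The atlas of the charted space `Gr(k, F)` consists of the standard graph coordinates: charts
whose inverse is `T ↦ graph of T`, for all `T : ℂᵏ → F` and all splittings `F ≅ ℂᵏ ⊕ F`. -/
def IsGraphAtlas (Φ : Splitting k F) (c : ChartedSpace (Model k F) (Gr Φ)) : Prop :=
  ∀ e : OpenPartialHomeomorph (Gr Φ) (Model k F), e ∈ c.atlas ↔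
    ∃ Ψ : Splitting k F, e.target = Set.univ ∧ ∀ T, taut Φ (e.symm T) = graph Ψ T

end

end Grass

/-! ### Kähler forms on complex Banach manifolds, and the Chern curvature of `det E` -/

namespace Kahler

section

variable {E : Type} [NormedAddCommGroup E] [NormedSpace ℂ E]
  {X : Type} [TopologicalSpace X] [ChartedSpace E X]

/-- The real tangent space `T_pX` of a complex manifold `X` modelled on `E`, with its complex
structure. -/
abbrev Tangent (E : Type) [NormedAddCommGroup E] [NormedSpace ℂ E]
    {X : Type} [TopologicalSpace X] [ChartedSpace E X] (p : X) : Type :=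
  TangentSpace 𝓘(ℂ, E) p

/-- Real two-forms on `X` with values in `G`. -/
abbrev TwoForm (E X : Type) [NormedAddCommGroup E] [NormedSpace ℂ E]
    [TopologicalSpace X] [ChartedSpace E X]
    (G : Type) [NormedAddCommGroup G] [NormedSpace ℝ G] : Type :=
  ∀ p : X, Tangent E p [⋀^Fin 2]→L[ℝ] G

/-- The expression of a two-form in the chart `e`: its pullback along `e.symm`. -/
noncomputable def inChart {G : Type} [NormedAddCommGroup G] [NormedSpace ℝ G]
    (Ω : TwoForm E X G) (e : OpenPartialHomeomorph X E) (y : E) : E [⋀^Fin 2]→L[ℝ] G :=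
  (Ω (e.symm y)).compContinuousLinearMap
    ((mfderiv 𝓘(ℂ, E) 𝓘(ℂ, E) e.symm y).restrictScalars ℝ)

/-- A Kähler form on the complex manifold `X`: a smooth closed real two-form `κ`, invariant under
the complex structure, such that the associated metric `g(u, v) = κ(u, i v)` is a (strong)
Riemannian metric: it is positive definite and defines the topology of the tangent spaces. -/
structure IsKahlerForm (κ : TwoForm E X ℝ) : Prop where
  smooth : ∀ e ∈ atlas E X, ContDiffOn ℝ ∞ (inChart κ e) e.target
  closed : ∀ e ∈ atlas E X, ∀ y ∈ e.target, extDeriv (inChart κ e) y = 0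
  invariant : ∀ (p : X) (u v : Tangent E p),
    κ p ![Complex.I • u, Complex.I • v] = κ p ![u, v]
  positive : ∀ p : X, ∃ c : ℝ, 0 < c ∧ ∀ u : E,
    c * ‖u‖ ^ 2 ≤ κ p ![(u : Tangent E p), (Complex.I • u : Tangent E p)]

/-- The `(1,0)`-form `∂f : v ↦ (df(v) - i df(i v)) / 2` of a real function `f` on `E`. -/
noncomputable def del (f : E → ℝ) (y : E) : E [⋀^Fin 1]→L[ℝ] ℂ :=
  ContinuousAlternatingMap.ofSubsingleton ℝ E ℂ (0 : Fin 1)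
    ((1 / 2 : ℂ) • (Complex.ofRealCLM ∘L fderiv ℝ f y -
      Complex.I • (Complex.ofRealCLM ∘L fderiv ℝ f y ∘L
        ((Complex.I • ContinuousLinearMap.id ℂ E).restrictScalars ℝ))))

end

section

variable {k : ℕ} {F : Type} [NormedAddCommGroup F] [InnerProductSpace ℂ F]

/-- The determinant line `⋀ᵏ W` of a `k`-dimensional subspace `W`. -/
abbrev DetLine (W : Grass.FinSubspaces k F) : Type := ⋀[ℂ]^k W.1

/-- An orthonormal basis of a `k`-dimensional subspace. -/
noncomputable def onb (W : Grass.FinSubspaces k F) : OrthonormalBasis (Fin k) ℂ W.1 :=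
  haveI := W.2.1
  (stdOrthonormalBasis ℂ W.1).reindex (finCongr W.2.2)

/-- The metric on `⋀ᵏ W` induced by the inner product of `W`: if `b` is an orthonormal basis of
`W`, then `‖c • b₁ ∧ ⋯ ∧ b_k‖² = |c|²`. -/
noncomputable def detNormSq (W : Grass.FinSubspaces k F) (ξ : DetLine W) : ℝ :=
  ‖exteriorPower.alternatingMapLinearEquiv (onb W).toBasis.det ξ‖ ^ 2

/-- `‖w₁ ∧ ⋯ ∧ w_k‖²` is the Gram determinant `det ⟨wᵢ, wⱼ⟩`; in particular the metric does not
depend on the choice of the orthonormal basis. -/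
theorem detNormSq_ιMulti (W : Grass.FinSubspaces k F) (w : Fin k → W.1) :
    (detNormSq W (exteriorPower.ιMulti ℂ k w) : ℂ) = (Matrix.gram ℂ w).det := by
  have h : Matrix.gram ℂ w =
      ((onb W).toBasis.toMatrix w).conjTranspose * (onb W).toBasis.toMatrix w := by
    ext i j
    simp [Matrix.gram_apply, Matrix.mul_apply, Module.Basis.toMatrix_apply,
      OrthonormalBasis.repr_apply_apply, ← (onb W).sum_inner_mul_inner (w i) (w j)]
  rw [h, Matrix.det_mul, Matrix.det_conjTranspose, detNormSq,
    exteriorPower.alternatingMapLinearEquiv_apply_ιMulti, Module.Basis.det_apply]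
  push_cast
  exact (Complex.conj_mul' _).symm

variable {E : Type} [NormedAddCommGroup E] [NormedSpace ℂ E]
  {X : Type} [TopologicalSpace X] [ChartedSpace E X]

/-- `s` is a holomorphic section over `U` of the determinant line bundle `det E` of the bundle
`E ⊆ X × F` with fibres `τ p`: locally `s = f • w₁ ∧ ⋯ ∧ w_k` with a holomorphic function `f` and
a holomorphic frame `w₁, …, w_k` of `E`. -/
def IsHolomorphicDetSection (E : Type) [NormedAddCommGroup E] [NormedSpace ℂ E]
    [ChartedSpace E X] (τ : X → Grass.FinSubspaces k F) (U : Set X)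
    (s : ∀ p, DetLine (τ p)) : Prop :=
  ∀ p ∈ U, ∃ U' : Set X, IsOpen U' ∧ p ∈ U' ∧ U' ⊆ U ∧
    ∃ (w : ∀ q, Fin k → (τ q).1) (f : X → ℂ),
      (∀ i, MDifferentiableOn 𝓘(ℂ, E) 𝓘(ℂ, F) (fun q => (w q i : F)) U') ∧
      (∀ q ∈ U', LinearIndependent ℂ (w q)) ∧
      MDifferentiableOn 𝓘(ℂ, E) 𝓘(ℂ, ℂ) f U' ∧
      ∀ q ∈ U', s q = f q • exteriorPower.ιMulti ℂ k (w q)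

/-- `Θ` is the curvature two-form of the holomorphic line bundle `det E` with its induced metric,
that is, of the Chern connection: locally `det E` has nowhere vanishing holomorphic sections, and
for each such section `s`, `Θ = d (∂ log ‖s‖²)`. -/
structure IsDetCurvature (τ : X → Grass.FinSubspaces k F) (Θ : TwoForm E X ℂ) : Prop where
  exists_section : ∀ p : X, ∃ (U : Set X) (s : ∀ p, DetLine (τ p)), IsOpen U ∧ p ∈ U ∧
    IsHolomorphicDetSection E τ U s ∧ ∀ q ∈ U, s q ≠ 0
  eq_curvature : ∀ (U : Set X) (s : ∀ p, DetLine (τ p)), IsOpen U →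
    IsHolomorphicDetSection E τ U s → (∀ q ∈ U, s q ≠ 0) →
    ∀ e ∈ atlas E X, ∀ y ∈ e.target, e.symm y ∈ U →
      inChart Θ e y = extDeriv (del fun z => Real.log (detNormSq _ (s (e.symm z)))) y

end

end Kahler

/-! Everything is reduced to orthogonal projections of rank `k`. The Fock module is irreducible: an
operator that commutes with all ladder operators is diagonal in the number basis with constant
diagonal (`Moyal.eq_smul_one`), so every bounded operator is a field. For a `k`-soliton φ, the
factors of V'(φ) = 0 belonging to roots other than 0 and λ are injective and can be cancelled. This
leaves (φ(φ - λ))^N = 0, hence φ(φ - λ) = 0 by self-adjointness, and φ = λP with P the projection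
onto the eigenspace (`Moyal.eq_smul_proj`). Conversely, V(λP) = V(λ)P has finite rank because V(0) =
0. Thus the moduli space is the set of rank `k` projections scaled by λ, with the norm topology.

On the side of the Grassmannian, the unitary group acts transitively on `k`-dimensional subspaces
with stabilizer U(k) × U(F). Nearby projections are conjugate by unitaries near 1, the unitary
factor of the polar decomposition of an explicit intertwiner, so the quotient topology is the norm
topology of projections (`Grass.isInducing_proj_taut`). The graph charts are then homeomorphisms
onto the model space, and they change by T ↦ (a + bT)(c + dT)⁻¹, which is analytic.

For the curvature, a holomorphic section of the determinant line satisfies log ‖s‖² = K + 2 log |h|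
in graph coordinates, with h holomorphic without zeros and K(T) = log det (1 + T*T). The second term
is pluriharmonic, and d∂ commutes with holomorphic maps (`Kahler.extDeriv_del_comp_add_re`), so d∂
log ‖s‖² does not depend on the section or on the chart (`Kahler.curvature_eq`). In the chart
centred at a point it is d∂K at the origin, which equals 2i ∑ Im ⟨u eᵢ, v eᵢ⟩; invariance and
positivity are read off there, while smoothness and closedness come from the formula d∂K valid on a
whole chart. Sections are only assumed complex differentiable, and killing the pluriharmonic term
requires a second derivative; this is supplied by `Holomorphic.differentiableAt_fderiv`.

The moduli space finally receives its complex structure and its Kähler form by transport along the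
homeomorphism φ ↦ im φ. -/

/-! ### Cauchy estimates and second complex derivatives in normed spaces -/

namespace Holomorphic

open Metric Filter

variable {E G : Type*} [NormedAddCommGroup E] [NormedSpace ℂ E] [NormedAddCommGroup G]
  [NormedSpace ℂ G]

/-- Cauchy's estimate for the Fréchet derivative. -/
theorem norm_fderiv_le {g : E → G} {y : E} {r M : ℝ} (hr : 0 < r)
    (hd : ∀ z ∈ closedBall y r, DifferentiableAt ℂ g z)
    (hM : ∀ z ∈ closedBall y r, ‖g z‖ ≤ M) : ‖fderiv ℂ g y‖ ≤ M / r := by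
  have hM0 : 0 ≤ M := (norm_nonneg _).trans (hM y (mem_closedBall_self hr.le))
  refine ContinuousLinearMap.opNorm_le_bound _ (by positivity) fun v => ?_
  rcases eq_or_ne v 0 with rfl | hv
  · simp
  have hv' : 0 < ‖v‖ := norm_pos_iff.2 hv
  have hmem : ∀ t ∈ closedBall (0 : ℂ) (r / ‖v‖), y + t • v ∈ closedBall y r := by
    intro t ht
    rw [mem_closedBall, dist_zero_right, le_div_iff₀ hv'] at ht
    simpa [mem_closedBall, dist_eq_norm, norm_smul] using ht
  have hline : ∀ t : ℂ, HasDerivAt (fun t : ℂ => y + t • v) v t := fun t => by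
    simpa using ((hasDerivAt_id t).smul_const v).const_add y
  have hdiff : DifferentiableOn ℂ (fun t : ℂ => g (y + t • v)) (closedBall 0 (r / ‖v‖)) :=
    fun t ht => ((hd _ (hmem t ht)).comp t (hline t).differentiableAt).differentiableWithinAt
  have h1 := Complex.norm_deriv_le_of_forall_mem_sphere_norm_le (div_pos hr hv')
    (hdiff.diffContOnCl_ball subset_rfl) (C := M)
    fun t ht => hM _ (hmem t (sphere_subset_closedBall ht))
  have h2 : HasDerivAt (fun t : ℂ => g (y + t • v)) (fderiv ℂ g y v) 0 := by
    have h3 : HasFDerivAt g (fderiv ℂ g y) (y + (0 : ℂ) • v) := by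
      simpa using (hd y (mem_closedBall_self hr.le)).hasFDerivAt
    exact h3.comp_hasDerivAt 0 (hline 0)
  rw [h2.deriv] at h1
  calc _ ≤ _ := h1
    _ = _ := by field_simp

theorem add_mem_ball_of {E : Type*} [SeminormedAddCommGroup E] {y₀ y w : E} {a b c : ℝ}
    (hy : y ∈ ball y₀ a) (hw : ‖w‖ ≤ b)
    (hab : a + b ≤ c) : y + w ∈ ball y₀ c := by
  rw [mem_ball, dist_eq_norm] at *
  calc ‖y + w - y₀‖ = ‖(y - y₀) + w‖ := by congr 1; abel
    _ ≤ ‖y - y₀‖ + ‖w‖ := norm_add_le _ _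
    _ < c := by linarith

variable {h : E → G} {y₀ : E} {r M : ℝ}

/-- Each use of Cauchy's estimate and each translation by a vector of norm at most `r` costs one
radius; a bound on the ball of radius `5 * r` leaves room for the whole chain of estimates below. -/
theorem norm_fderiv_le_of_mem (hr : 0 < r) (hd : ∀ z ∈ ball y₀ (5 * r), DifferentiableAt ℂ h z)
    (hM : ∀ z ∈ ball y₀ (5 * r), ‖h z‖ ≤ M) {y : E} (hy : y ∈ ball y₀ (4 * r)) :
    ‖fderiv ℂ h y‖ ≤ M / r := by
  have hsub : closedBall y r ⊆ ball y₀ (5 * r) :=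
    closedBall_subset_ball' (by rw [mem_ball] at hy; linarith)
  exact norm_fderiv_le hr (fun z hz => hd z (hsub hz)) fun z hz => hM z (hsub hz)

theorem norm_sub_le_of_mem (hr : 0 < r) (hd : ∀ z ∈ ball y₀ (5 * r), DifferentiableAt ℂ h z)
    (hM : ∀ z ∈ ball y₀ (5 * r), ‖h z‖ ≤ M) {x y : E} (hx : x ∈ ball y₀ (4 * r))
    (hy : y ∈ ball y₀ (4 * r)) : ‖h y - h x‖ ≤ M / r * ‖y - x‖ :=
  Convex.norm_image_sub_le_of_norm_fderiv_le (𝕜 := ℂ)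
    (fun z hz => hd z (ball_subset_ball (by linarith) hz))
    (fun _ hz => norm_fderiv_le_of_mem hr hd hM hz) (convex_ball _ _) hx hy

/-- Cauchy's estimate is applied to the difference of translates z ↦ h(z + w) - h(z), which is
itself O(‖w‖) by the mean value inequality. -/
theorem norm_fderiv_add_sub_le (hr : 0 < r) (hd : ∀ z ∈ ball y₀ (5 * r), DifferentiableAt ℂ h z)
    (hM : ∀ z ∈ ball y₀ (5 * r), ‖h z‖ ≤ M) {y w : E} (hy : y ∈ ball y₀ (2 * r)) (hw : ‖w‖ ≤ r) :
    ‖fderiv ℂ h (y + w) - fderiv ℂ h y‖ ≤ M / r * ‖w‖ / r := by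
  have hmem : ∀ z ∈ closedBall y r, z ∈ ball y₀ (3 * r) := fun z hz =>
    closedBall_subset_ball' (by rw [mem_ball] at hy; linarith) hz
  have hd' : ∀ z ∈ closedBall y r, DifferentiableAt ℂ (fun z => h (z + w)) z := fun z hz =>
    (differentiableAt_comp_add_right w).2 (hd _ (add_mem_ball_of (hmem z hz) hw (by linarith)))
  have hd'' : ∀ z ∈ closedBall y r, DifferentiableAt ℂ h z := fun z hz =>
    hd _ (ball_subset_ball (by linarith) (hmem z hz))
  have key := norm_fderiv_le (g := fun z => h (z + w) - h z) hr (M := M / r * ‖w‖)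
    (fun z hz => (hd' z hz).sub (hd'' z hz)) fun z hz => by
      simpa using norm_sub_le_of_mem hr hd hM (ball_subset_ball (by linarith) (hmem z hz))
        (add_mem_ball_of (hmem z hz) hw (by linarith))
  have hy' : y ∈ closedBall y r := mem_closedBall_self hr.le
  rwa [fderiv_fun_sub (hd' y hy') (hd'' y hy'), fderiv_comp_add_right] at key

/-- The derivative moves by O(‖w‖) on the ball of radius ‖w‖ around y, and the mean value inequality
integrates this to a quadratic remainder, uniformly in y. -/
theorem norm_taylor_le (hr : 0 < r) (hd : ∀ z ∈ ball y₀ (5 * r), DifferentiableAt ℂ h z)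
    (hM : ∀ z ∈ ball y₀ (5 * r), ‖h z‖ ≤ M) {y w : E} (hy : y ∈ ball y₀ (2 * r)) (hw : ‖w‖ ≤ r) :
    ‖h (y + w) - h y - fderiv ℂ h y w‖ ≤ M / r / r * ‖w‖ ^ 2 := by
  have hM0 : 0 ≤ M := (norm_nonneg _).trans (hM y₀ (mem_ball_self (by linarith)))
  have hsub : ∀ z ∈ closedBall y ‖w‖, ‖z - y‖ ≤ ‖w‖ := fun z hz => by
    simpa [dist_eq_norm] using hz
  have := Convex.norm_image_sub_le_of_norm_fderiv_le' (𝕜 := ℂ) (f := h) (φ := fderiv ℂ h y)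
    (s := closedBall y ‖w‖) (x := y) (y := y + w) (C := M / r * ‖w‖ / r)
    (fun z hz => by
      have := add_mem_ball_of hy ((hsub z hz).trans hw) (c := 5 * r) (by linarith)
      exact hd z (by simpa using this))
    (fun z hz => by
      have := norm_fderiv_add_sub_le hr hd hM hy ((hsub z hz).trans hw)
      rw [add_sub_cancel] at this
      refine this.trans ?_
      have := hsub z hz
      gcongr)
    (convex_closedBall _ _) (mem_closedBall_self (norm_nonneg _)) (by simp)
  rw [add_sub_cancel_left] at this
  calc _ ≤ _ := this
    _ = _ := by ring

/-- The difference quotients of `h` in direction `w` converge uniformly to the directional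
derivative, by the Taylor bound. Cauchy's estimate makes their derivatives uniformly Cauchy, so the
limit is differentiable. -/
theorem differentiableAt_fderiv_apply [CompleteSpace G] (hr : 0 < r)
    (hd : ∀ z ∈ ball y₀ (5 * r), DifferentiableAt ℂ h z)
    (hM : ∀ z ∈ ball y₀ (5 * r), ‖h z‖ ≤ M) {y : E} (hy : y ∈ ball y₀ r) (w : E) :
    DifferentiableAt ℂ (fun z => fderiv ℂ h z w) y := by
  have hM0 : 0 ≤ M := (norm_nonneg _).trans (hM y₀ (mem_ball_self (by linarith)))
  -- The directional derivative is linear in `w`, so a long vector may be rescaled to norm `r`.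
  wlog hw : ‖w‖ ≤ r generalizing w
  · have hw0 : 0 < ‖w‖ := hr.trans (not_le.1 hw)
    have := this ((r / ‖w‖ : ℂ) • w) (by
      rw [norm_smul]
      simp [abs_of_pos hr]
      field_simp
      exact le_rfl)
    have h2 := this.const_smul ((‖w‖ / r : ℂ))
    convert h2 using 1
    ext z
    have hw1 : (‖w‖ : ℂ) ≠ 0 := by exact_mod_cast hw0.ne'
    have hr1 : (r : ℂ) ≠ 0 := by exact_mod_cast hr.ne'
    simp only [Pi.smul_apply, map_smul, smul_smul]
    field_simp
    simp
  let t : ℕ → ℝ := fun n => 1 / ((n : ℝ) + 1)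
  have ht0 : ∀ n, 0 < t n := fun n => by positivity
  have ht1 : ∀ n, t n ≤ 1 := fun n => by
    rw [div_le_one (by positivity)]; linarith [(Nat.cast_nonneg n : (0 : ℝ) ≤ n)]
  have htt : Tendsto t atTop (𝓝 0) := tendsto_one_div_add_atTop_nhds_zero_nat (𝕜 := ℝ)
  have htw : ∀ n, ‖((t n : ℂ)) • w‖ = t n * ‖w‖ := fun n => by
    rw [norm_smul, Complex.norm_real, Real.norm_of_nonneg (ht0 n).le]
  have htr : ∀ n, ‖((t n : ℂ)) • w‖ ≤ r := fun n => by
    rw [htw]; nlinarith [ht1 n, ht0 n, norm_nonneg w]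
  have htc : ∀ n, (t n : ℂ) ≠ 0 := fun n => by exact_mod_cast (ht0 n).ne'
  let q : ℕ → E → G := fun n z => (t n : ℂ)⁻¹ • (h (z + (t n : ℂ) • w) - h z)
  have hqd : ∀ n, ∀ z ∈ ball y₀ (2 * r), DifferentiableAt ℂ (q n) z := fun n z hz =>
    (((differentiableAt_comp_add_right _).2 (hd _ (add_mem_ball_of hz (htr n) (by linarith)))).sub
      (hd z (ball_subset_ball (by linarith) hz))).const_smul _
  set L := M / r / r * ‖w‖ ^ 2 with hL
  have hq : ∀ n, ∀ z ∈ ball y₀ (2 * r), ‖q n z - fderiv ℂ h z w‖ ≤ L * t n := by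
    intro n z hz
    have h1 := norm_taylor_le hr hd hM hz (htr n)
    have h2 : q n z - fderiv ℂ h z w = (t n : ℂ)⁻¹ •
        (h (z + (t n : ℂ) • w) - h z - fderiv ℂ h z ((t n : ℂ) • w)) := by
      rw [map_smul, smul_sub (_ : ℂ) (_ - _), smul_smul, inv_mul_cancel₀ (htc n), one_smul]
    rw [h2, norm_smul, norm_inv, Complex.norm_real, Real.norm_of_nonneg (ht0 n).le,
      inv_mul_le_iff₀ (ht0 n)]
    rw [htw] at h1
    calc _ ≤ _ := h1
      _ = _ := by rw [hL]; ring
  have hcauchy : ∀ m n, ∀ z ∈ ball y₀ r,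
      ‖fderiv ℂ (q m) z - fderiv ℂ (q n) z‖ ≤ (L * t m + L * t n) / r := by
    intro m n z hz
    have hsub : ∀ x ∈ closedBall z r, x ∈ ball y₀ (2 * r) := fun x hx =>
      closedBall_subset_ball' (by rw [mem_ball] at hz; linarith) hx
    have hz' := hsub z (mem_closedBall_self hr.le)
    rw [← fderiv_sub (hqd m z hz') (hqd n z hz')]
    refine norm_fderiv_le hr (fun x hx => (hqd m x (hsub x hx)).sub (hqd n x (hsub x hx)))
      fun x hx => ?_
    calc ‖q m x - q n x‖ = ‖(q m x - fderiv ℂ h x w) - (q n x - fderiv ℂ h x w)‖ := by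
          congr 1; abel
      _ ≤ _ := norm_sub_le _ _
      _ ≤ _ := add_le_add (hq m x (hsub x hx)) (hq n x (hsub x hx))
  have hlim : Tendsto (fun p : ℕ × ℕ => (L * t p.1 + L * t p.2) / r) (atTop ×ˢ atTop) (𝓝 0) := by
    have h1 := ((htt.comp tendsto_fst).const_mul L).add ((htt.comp tendsto_snd).const_mul L)
      (x := atTop ×ˢ atTop)
    simpa using h1.div_const r
  have hU : UniformCauchySeqOn (fun n => fderiv ℂ (q n)) atTop (ball y₀ r) := by
    rw [uniformCauchySeqOn_iff]
    intro ε hε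
    rw [prod_atTop_atTop_eq] at hlim
    have := hlim.eventually (gt_mem_nhds hε)
    obtain ⟨⟨N₁, N₂⟩, hN⟩ := eventually_atTop.1 this
    refine ⟨max N₁ N₂, fun m hm n hn z hz => ?_⟩
    rw [dist_eq_norm]
    exact (hcauchy m n z hz).trans_lt
      (hN (m, n) ⟨(le_max_left _ _).trans hm, (le_max_right _ _).trans hn⟩)
  have hex : ∀ z, ∃ l : E →L[ℂ] G, z ∈ ball y₀ r →
      Tendsto (fun n => fderiv ℂ (q n) z) atTop (𝓝 l) := fun z => by
    by_cases hz : z ∈ ball y₀ r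
    · obtain ⟨l, hl⟩ := cauchySeq_tendsto_of_complete (hU.cauchySeq hz)
      exact ⟨l, fun _ => hl⟩
    · exact ⟨0, fun h => absurd h hz⟩
  choose g' hg' using hex
  have hT := hU.tendstoUniformlyOn_of_tendsto hg'
  refine (hasFDerivAt_of_tendstoUniformlyOn isOpen_ball hT
    (fun n z hz => (hqd n z (ball_subset_ball (by linarith) hz)).hasFDerivAt)
    (fun z hz => ?_) hy).differentiableAt
  rw [tendsto_iff_norm_sub_tendsto_zero]
  refine squeeze_zero (fun _ => norm_nonneg _)
    (fun n => hq n z (ball_subset_ball (by linarith) hz)) ?_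
  simpa using htt.const_mul L

/-- A function on an open subset of a complex normed space that is complex differentiable is
twice complex differentiable. -/
theorem differentiableAt_fderiv [CompleteSpace G] {h : E → G} {y : E}
    (hh : ∀ᶠ z in 𝓝 y, DifferentiableAt ℂ h z) : DifferentiableAt ℂ (fderiv ℂ h) y := by
  obtain ⟨M, hM⟩ : ∃ M, ∀ᶠ z in 𝓝 y, ‖h z‖ ≤ M :=
    ⟨‖h y‖ + 1, (hh.self_of_nhds.continuousAt.norm.eventually
      (gt_mem_nhds (lt_add_one _))).mono fun _ => le_of_lt⟩
  obtain ⟨ε, hε, hball⟩ := Metric.mem_nhds_iff.1 (hh.and hM)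
  obtain ⟨r, hr, rfl⟩ : ∃ r, 0 < r ∧ ε = 5 * r := ⟨ε / 5, by positivity, by ring⟩
  have hd : ∀ z ∈ ball y (5 * r), DifferentiableAt ℂ h z := fun z hz => (hball hz).1
  replace hM : ∀ z ∈ ball y (5 * r), ‖h z‖ ≤ M := fun z hz => (hball hz).2
  -- Directional derivatives are known to be differentiable on the open ball of radius `r` only; the
  -- closed ball of radius `r / 2` is where Cauchy's estimate can be applied to them.
  have hp : ∀ w, ∀ z ∈ closedBall y (r / 2), DifferentiableAt ℂ (fun z => fderiv ℂ h z w) z :=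
    fun w z hz => differentiableAt_fderiv_apply hr hd hM
      (closedBall_subset_ball (by linarith) hz) w
  have hy : y ∈ closedBall y (r / 2) := mem_closedBall_self (by positivity)
  let B : E →L[ℂ] E →L[ℂ] G := LinearMap.mkContinuous
    { toFun := fun w => fderiv ℂ (fun z => fderiv ℂ h z w) y
      map_add' := fun w w' => by
        simp only [map_add]
        exact fderiv_fun_add (hp w y hy) (hp w' y hy)
      map_smul' := fun c w => by
        simp only [map_smul, RingHom.id_apply]
        exact fderiv_fun_const_smul (hp w y hy) c }
    (M / r / (r / 2)) fun w => by
      have := norm_fderiv_le (half_pos hr) (hp w) (M := M / r * ‖w‖) fun z hz =>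
        (ContinuousLinearMap.le_opNorm _ _).trans (mul_le_mul_of_nonneg_right
          (norm_fderiv_le_of_mem hr hd hM (closedBall_subset_ball (by linarith) hz))
          (norm_nonneg w))
      calc _ ≤ _ := this
        _ = _ := by ring
  have hB : HasFDerivAt (fderiv ℂ h) B y := by
    rw [hasFDerivAt_iff_isLittleO_nhds_zero]
    refine Asymptotics.IsBigO.trans_isLittleO (g := fun w : E => ‖w‖ ^ 2) ?_
      (Asymptotics.isLittleO_norm_pow_id one_lt_two)
    refine Asymptotics.IsBigO.of_bound (M / r / r / (r / 2)) ?_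
    filter_upwards [closedBall_mem_nhds (0 : E) hr] with w hw
    rw [mem_closedBall, dist_zero_right] at hw
    have hmem : ∀ z ∈ closedBall y (r / 2), z ∈ ball y (2 * r) :=
      fun z hz => closedBall_subset_ball (by linarith) hz
    have h1 : ∀ z ∈ closedBall y (r / 2), DifferentiableAt ℂ (fun z => h (z + w)) z :=
      fun z hz => (differentiableAt_comp_add_right w).2 (hd _ (add_mem_ball_of (hmem z hz) hw (by linarith)))
    have h2 : ∀ z ∈ closedBall y (r / 2), DifferentiableAt ℂ h z :=
      fun z hz => hd z (ball_subset_ball (by linarith) (hmem z hz))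
    -- Cauchy's estimate for the Taylor remainder as a function of the base point: a bound O(‖w‖²)
    -- on the remainder becomes the same order of bound on dh(y + w) - dh(y) - B w.
    have key := norm_fderiv_le (g := fun z => h (z + w) - h z - fderiv ℂ h z w) (half_pos hr)
      (fun z hz => ((h1 z hz).sub (h2 z hz)).sub (hp w z hz))
      fun z hz => norm_taylor_le hr hd hM (hmem z hz) hw
    rw [fderiv_fun_sub ((h1 y hy).fun_sub (h2 y hy)) (hp w y hy), fderiv_fun_sub (h1 y hy) (h2 y hy),
      fderiv_comp_add_right] at key
    rw [Real.norm_of_nonneg (by positivity)]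
    calc _ ≤ _ := key
      _ = _ := by ring
  exact hB.differentiableAt

end Holomorphic

/-! ### The Levi form d∂f and pluriharmonic functions -/

namespace Kahler

open Filter

section

variable {E : Type} [NormedAddCommGroup E] [NormedSpace ℂ E]

/-- The `(1,0)`-part of a real covector, as a continuous linear operation. -/
noncomputable def delCLM (E : Type) [NormedAddCommGroup E] [NormedSpace ℂ E] :
    (E →L[ℝ] ℝ) →L[ℝ] (E [⋀^Fin 1]→L[ℝ] ℂ) :=
  (ContinuousAlternatingMap.ofSubsingletonLIE (𝕜 := ℝ) (E := E) (F := ℂ)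
      (0 : Fin 1)).toContinuousLinearEquiv.toContinuousLinearMap ∘L
    ((1 / 2 : ℂ) • (ContinuousLinearMap.compL ℝ E ℝ ℂ Complex.ofRealCLM -
      Complex.I • (ContinuousLinearMap.compL ℝ E ℝ ℂ Complex.ofRealCLM ∘L
        (ContinuousLinearMap.compL ℝ E E ℝ).flip
          ((Complex.I • ContinuousLinearMap.id ℂ E).restrictScalars ℝ))))

theorem del_eq_delCLM (f : E → ℝ) (y : E) : del f y = delCLM E (fderiv ℝ f y) := rfl

theorem delCLM_apply (l : E →L[ℝ] ℝ) (v : Fin 1 → E) :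
    delCLM E l v = 1 / 2 * ((l (v 0) : ℂ) - Complex.I * (l (Complex.I • v 0) : ℂ)) := rfl

theorem differentiableAt_del {f : E → ℝ} {y : E} (hf : DifferentiableAt ℝ (fderiv ℝ f) y) :
    DifferentiableAt ℝ (del f) y :=
  (delCLM E).differentiableAt.comp y hf

theorem contDiff_extDeriv_del {f : E → ℝ} (hf : ContDiff ℝ ∞ f) :
    ContDiff ℝ ∞ (extDeriv (del f)) := by
  have h1 : ContDiff ℝ ∞ (del f) := (delCLM E).contDiff.comp (hf.fderiv_right le_rfl)
  exact (ContinuousAlternatingMap.alternatizeUncurryFinCLM ℝ E ℂ).contDiff.comp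
    (h1.fderiv_right (m := ∞) le_rfl)

/-- The exterior derivative of `∂f` in terms of the second derivative of `f`. -/
theorem extDeriv_del_apply {f : E → ℝ} {y : E} (hf : DifferentiableAt ℝ (fderiv ℝ f) y) (u v : E) :
    extDeriv (del f) y ![u, v] =
      delCLM E (fderiv ℝ (fderiv ℝ f) y u) ![v] - delCLM E (fderiv ℝ (fderiv ℝ f) y v) ![u] := by
  have h1 : fderiv ℝ (del f) y = (delCLM E) ∘L fderiv ℝ (fderiv ℝ f) y :=
    ((delCLM E).hasFDerivAt.comp y hf.hasFDerivAt).fderiv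
  rw [extDeriv, ContinuousAlternatingMap.alternatizeUncurryFin_apply, h1, Fin.sum_univ_two]
  have e0 : (0 : Fin 2).removeNth ![u, v] = ![v] := by ext i; fin_cases i; rfl
  have e1 : (1 : Fin 2).removeNth ![u, v] = ![u] := by ext i; fin_cases i; rfl
  rw [e0, e1]
  simp [sub_eq_add_neg]

/-- The derivative of `g` commutes with multiplication by i, so pulling back preserves the splitting
of covectors by type. -/
theorem del_comp {E' : Type} [NormedAddCommGroup E'] [NormedSpace ℂ E'] {K : E' → ℝ} {g : E → E'}
    {z : E} (hK : DifferentiableAt ℝ K (g z)) (hg : DifferentiableAt ℂ g z) :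
    del (fun z => K (g z)) z = (del K (g z)).compContinuousLinearMap (fderiv ℝ g z) := by
  have h1 : fderiv ℝ (fun z => K (g z)) z = (fderiv ℝ K (g z)) ∘L fderiv ℝ g z :=
    fderiv_comp z hK (hg.restrictScalars ℝ)
  have h2 : ∀ v, fderiv ℝ g z (Complex.I • v) = Complex.I • fderiv ℝ g z v := fun v => by
    rw [hg.fderiv_restrictScalars ℝ]; simp
  ext v
  rw [ContinuousAlternatingMap.compContinuousLinearMap_apply, del_eq_delCLM, del_eq_delCLM,
    delCLM_apply, delCLM_apply, h1]
  simp [h2]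

/-- `∂ (Re H) = dH / 2` for holomorphic `H`. -/
theorem del_re {H : E → ℂ} {z : E} (hH : DifferentiableAt ℂ H z) :
    del (fun z => (H z).re) z = ContinuousAlternatingMap.ofSubsingletonLIE (0 : Fin 1)
      ((1 / 2 : ℂ) • (fderiv ℂ H z).restrictScalars ℝ) := by
  have h1 : fderiv ℝ (fun z => (H z).re) z =
      Complex.reCLM ∘L (fderiv ℂ H z).restrictScalars ℝ :=
    (Complex.reCLM.hasFDerivAt.comp z (hH.hasFDerivAt.restrictScalars ℝ)).fderiv
  ext v
  rw [del_eq_delCLM, delCLM_apply, h1]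
  change _ = (1 / 2 : ℂ) • fderiv ℂ H z (v 0)
  generalize hw : fderiv ℂ H z (v 0) = w
  have h2 : fderiv ℂ H z (Complex.I • v 0) = Complex.I * w := by simp [hw]
  apply Complex.ext <;> simp [hw]

/-- Since ∂ Re H = dH / 2, its exterior derivative is the antisymmetrized second derivative of `H`,
which vanishes by symmetry. Differentiability of dH is the point where
`Holomorphic.differentiableAt_fderiv` is needed. -/
theorem extDeriv_del_re {H : E → ℂ} {y : E} (hH : ∀ᶠ z in 𝓝 y, DifferentiableAt ℂ H z) :
    DifferentiableAt ℝ (del fun z => (H z).re) y ∧ extDeriv (del fun z => (H z).re) y = 0 := by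
  have h2 := Holomorphic.differentiableAt_fderiv hH
  let R : (E →L[ℂ] ℂ) →L[ℝ] (E →L[ℝ] ℂ) := ContinuousLinearMap.restrictScalarsL ℂ E ℂ ℝ ℝ
  let D : (E →L[ℂ] ℂ) →L[ℝ] (E [⋀^Fin 1]→L[ℝ] ℂ) :=
    (ContinuousAlternatingMap.ofSubsingletonLIE (𝕜 := ℝ) (E := E) (F := ℂ)
      (0 : Fin 1)).toContinuousLinearEquiv.toContinuousLinearMap ∘L ((1 / 2 : ℂ) • R)
  have hev : (del fun z => (H z).re) =ᶠ[𝓝 y] fun z => D (fderiv ℂ H z) :=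
    hH.mono fun z hz => del_re hz
  have hD : HasFDerivAt (fun z => D (fderiv ℂ H z))
      (D ∘L (fderiv ℂ (fderiv ℂ H) y).restrictScalars ℝ) y :=
    D.hasFDerivAt.comp y (h2.hasFDerivAt.restrictScalars ℝ)
  refine ⟨hD.differentiableAt.congr_of_eventuallyEq hev, ?_⟩
  rw [hev.extDeriv_eq]
  have hsymm := second_derivative_symmetric_of_eventually
    (hH.mono fun z hz => hz.hasFDerivAt) h2.hasFDerivAt
  ext v
  rw [extDeriv, ContinuousAlternatingMap.alternatizeUncurryFin_apply, hD.fderiv, Fin.sum_univ_two]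
  change (-1 : ℤ) ^ 0 • ((1 / 2 : ℂ) • fderiv ℂ (fderiv ℂ H) y (v 0) (v 1)) +
    (-1 : ℤ) ^ 1 • ((1 / 2 : ℂ) • fderiv ℂ (fderiv ℂ H) y (v 1) (v 0)) = 0
  rw [hsymm (v 1) (v 0)]
  simp

/-- The Levi form is invariant under holomorphic maps, and unchanged by pluriharmonic functions. -/
theorem extDeriv_del_comp_add_re {E' : Type} [NormedAddCommGroup E'] [NormedSpace ℂ E'] {K : E' → ℝ}
    {g : E → E'} {f : E → ℝ} {H : E → ℂ} {c : ℝ} {y : E} (hK : ContDiff ℝ 2 K)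
    (hg : ContDiffAt ℂ 2 g y) (hH : ∀ᶠ z in 𝓝 y, DifferentiableAt ℂ H z)
    (hf : f =ᶠ[𝓝 y] fun z => K (g z) + (H z).re + c) :
    extDeriv (del f) y =
      (extDeriv (del K) (g y)).compContinuousLinearMap ((fderiv ℂ g y).restrictScalars ℝ) := by
  have hgd : ∀ᶠ z in 𝓝 y, DifferentiableAt ℂ g z :=
    (hg.eventually (by simp)).mono fun z hz => hz.differentiableAt (by simp)
  have hKd : ∀ z, DifferentiableAt ℝ K z := fun z => hK.contDiffAt.differentiableAt (by simp)
  have hdK : ∀ z, DifferentiableAt ℝ (del K) z := fun z => differentiableAt_del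
    ((hK.fderiv_right (m := 1) le_rfl).contDiffAt.differentiableAt (by simp))
  have hpull : (del fun z => K (g z)) =ᶠ[𝓝 y]
      fun z => (del K (g z)).compContinuousLinearMap (fderiv ℝ g z) :=
    hgd.mono fun z hz => del_comp (hKd _) hz
  have hgR : ContDiffAt ℝ 2 g y := hg.restrict_scalars ℝ
  have hKg : ContDiffAt ℝ 2 (fun z => K (g z)) y := hK.contDiffAt.comp y hgR
  have hdKg : DifferentiableAt ℝ (del fun z => K (g z)) y := differentiableAt_del
    ((hKg.fderiv_right (m := 1) le_rfl).differentiableAt (by simp))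
  have hev : del f =ᶠ[𝓝 y] (del fun z => K (g z)) + del fun z => (H z).re := by
    filter_upwards [hf.eventually_nhds, hgd, hH] with z hz hgz hHz
    have h1 : DifferentiableAt ℝ (fun z => K (g z)) z :=
      (hKd _).comp z (hgz.restrictScalars ℝ)
    have h2 : DifferentiableAt ℝ (fun z => (H z).re) z :=
      Complex.reCLM.differentiableAt.comp z (hHz.restrictScalars ℝ)
    rw [Pi.add_apply, del_eq_delCLM, del_eq_delCLM, del_eq_delCLM, ← map_add,
      EventuallyEq.fderiv_eq hz, fderiv_add_const, fderiv_fun_add h1 h2]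
  obtain ⟨hd, h0⟩ := extDeriv_del_re hH
  rw [hev.extDeriv_eq, extDeriv_add hdKg hd, h0, add_zero, hpull.extDeriv_eq,
    extDeriv_pullback (hdK _) hgR (by simp), hgd.self_of_nhds.fderiv_restrictScalars ℝ]

end

end Kahler

/-! ### The potential log det (1 + Gram matrix) and its Levi form at the origin -/

namespace Kahler

open Filter

open scoped ComplexOrder in
theorem det_one_add_gram_re_pos {k : ℕ} {F : Type} [NormedAddCommGroup F] [InnerProductSpace ℂ F]
    (v : Fin k → F) : 0 < (1 + Matrix.gram ℂ v).det.re := by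
  have h : (1 + Matrix.gram ℂ v).PosDef :=
    Matrix.PosDef.one.add_posSemidef (Matrix.posSemidef_gram ℂ v)
  exact (Complex.pos_iff.1 h.det_pos).1

/-- Presents det (1 + tS) as a polynomial in t, whose derivative at 0 is known to be the trace of S.
-/
theorem eval_det_one_add_X_smul {k : ℕ} (S : Matrix (Fin k) (Fin k) ℂ) (t : ℂ) :
    (1 + (X : ℂ[X]) • S.map C).det.eval t = (1 + t • S).det := by
  rw [← Polynomial.coe_evalRingHom, RingHom.map_det]
  congr 1
  ext i j
  by_cases h : i = j <;> simp [h] <;> ring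

/-- `log det (1 + M)`. -/
noncomputable def logDet {k : ℕ} (M : Fin k → Fin k → ℂ) : ℝ :=
  Real.log (1 + Matrix.of M : Matrix (Fin k) (Fin k) ℂ).det.re

section

variable {k : ℕ} {E F : Type} [NormedAddCommGroup E] [NormedSpace ℂ E]
  [NormedAddCommGroup F] [InnerProductSpace ℂ F]

theorem contDiffAt_logDet {M : Fin k → Fin k → ℂ}
    (hM : 0 < (1 + Matrix.of M : Matrix (Fin k) (Fin k) ℂ).det.re) {n : WithTop ℕ∞} :
    ContDiffAt ℝ n logDet M := by
  have h1 : ContDiff ℝ n fun M : Fin k → Fin k → ℂ =>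
      (1 + Matrix.of M : Matrix (Fin k) (Fin k) ℂ).det := by
    simp only [Matrix.det_apply, Matrix.add_apply, Matrix.of_apply]
    refine ContDiff.sum fun σ _ => ContDiff.const_smul _ (contDiff_prod fun i _ => ?_)
    exact contDiff_const.add (contDiff_apply_apply _ _ _ _)
  exact ((Complex.reCLM.contDiff.comp h1).contDiffAt).log hM.ne'

theorem fderiv_logDet_zero (S : Fin k → Fin k → ℂ) :
    fderiv ℝ logDet (0 : Fin k → Fin k → ℂ) S = (Matrix.trace (Matrix.of S)).re := by
  have h0 : 0 < (1 + Matrix.of (0 : Fin k → Fin k → ℂ) : Matrix (Fin k) (Fin k) ℂ).det.re := by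
    have : Matrix.of (0 : Fin k → Fin k → ℂ) = 0 := rfl
    simp [this]
  have h1 : HasDerivAt (fun t : ℝ => logDet (t • S)) (fderiv ℝ logDet 0 S) 0 := by
    have h2 : HasDerivAt (fun t : ℝ => t • S) S 0 := by
      simpa using (hasDerivAt_id (0 : ℝ)).smul_const S
    have h3 : HasFDerivAt logDet (fderiv ℝ logDet 0) ((0 : ℝ) • S) := by
      rw [zero_smul]
      exact ((contDiffAt_logDet h0 (n := 1)).differentiableAt (by simp)).hasFDerivAt
    exact h3.comp_hasDerivAt 0 h2
  refine h1.unique ?_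
  let p : ℂ[X] := (1 + (X : ℂ[X]) • (Matrix.of S).map C).det
  have hp : ∀ t : ℝ, logDet (t • S) = Real.log (p.eval (t : ℂ)).re := fun t => by
    have : t • Matrix.of S = (t : ℂ) • Matrix.of S := by ext i j; simp
    simp only [p, eval_det_one_add_X_smul, ← this]
    rfl
  have hd : HasDerivAt (fun t : ℝ => p.eval (t : ℂ)) (Matrix.trace (Matrix.of S)) 0 := by
    have := (p.hasDerivAt ((0 : ℝ) : ℂ)).comp_ofReal
    rwa [Complex.ofReal_zero, Matrix.derivative_det_one_add_X_smul] at this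
  have hp0 : p.eval ((0 : ℝ) : ℂ) = 1 := by
    simp [p, eval_det_one_add_X_smul]
  have hre : HasDerivAt (fun t : ℝ => (p.eval (t : ℂ)).re) (Matrix.trace (Matrix.of S)).re 0 :=
    Complex.reCLM.hasFDerivAt.comp_hasDerivAt 0 hd
  have := hre.log (by rw [hp0]; simp)
  rw [hp0] at this
  simpa [hp] using this

/-- The potential `log det (1 + ⟨Lᵢ z, Lⱼ z⟩)`. -/
noncomputable def potential (L : Fin k → E →L[ℂ] F) (z : E) : ℝ :=
  logDet fun i j => ⟪L i z, L j z⟫_ℂ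

variable (L : Fin k → E →L[ℂ] F)

theorem contDiff_gram {n : WithTop ℕ∞} :
    ContDiff ℝ n fun z : E => fun i j => ⟪L i z, L j z⟫_ℂ := by
  refine contDiff_pi.2 fun i => contDiff_pi.2 fun j => ?_
  exact ContDiff.inner ℂ ((L i).contDiff.restrict_scalars ℝ) ((L j).contDiff.restrict_scalars ℝ)

theorem contDiff_potential {n : WithTop ℕ∞} : ContDiff ℝ n (potential L) :=
  contDiff_iff_contDiffAt.2 fun z =>
    ContDiffAt.comp z (contDiffAt_logDet (det_one_add_gram_re_pos fun i => L i z))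
      (contDiff_gram L).contDiffAt

theorem hasDerivAt_add_smul {E : Type*} [NormedAddCommGroup E] [NormedSpace ℝ E] (z v : E) :
    HasDerivAt (fun t : ℝ => z + t • v) v 0 := by
  simpa using ((hasDerivAt_id (0 : ℝ)).smul_const v).const_add z

/-- The Gram matrix is quadratic, so its derivative at `s • u` is `s` times the polarization at `u`.
Isolating the factor `s` is what makes the second derivative at the origin easy. -/
theorem hasDerivAt_gram (u w : E) (s : ℝ) :
    HasDerivAt (fun t : ℝ => fun i j => ⟪L i (s • u + t • w), L j (s • u + t • w)⟫_ℂ)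
      (s • fun i j => ⟪L i u, L j w⟫_ℂ + ⟪L i w, L j u⟫_ℂ) 0 := by
  refine hasDerivAt_pi.2 fun i => hasDerivAt_pi.2 fun j => ?_
  have hl : ∀ i, HasDerivAt (fun t : ℝ => L i (s • u + t • w)) (L i w) 0 := fun i =>
    ((L i).restrictScalars ℝ).hasFDerivAt.comp_hasDerivAt 0 (hasDerivAt_add_smul (s • u) w)
  have hs : ∀ i, L i (s • u) = (s : ℂ) • L i u := fun i => (L i).map_smul_of_tower s u
  have := (hl i).inner ℂ (hl j)
  simp only [zero_smul, add_zero, hs, inner_smul_left, inner_smul_right, Complex.conj_ofReal] at this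
  refine this.congr_deriv ?_
  simp

theorem fderiv_potential_smul (u w : E) (s : ℝ) :
    fderiv ℝ (potential L) (s • u) w =
      s * fderiv ℝ logDet (fun i j => ⟪L i (s • u), L j (s • u)⟫_ℂ)
        (fun i j => ⟪L i u, L j w⟫_ℂ + ⟪L i w, L j u⟫_ℂ) := by
  have h1 : HasFDerivAt (potential L) (fderiv ℝ (potential L) (s • u))
      (s • u + (0 : ℝ) • w) := by
    rw [zero_smul, add_zero]
    exact ((contDiff_potential L (n := 1)).contDiffAt.differentiableAt (by simp)).hasFDerivAt
  have h2 : HasFDerivAt logDet (fderiv ℝ logDet (fun i j => ⟪L i (s • u), L j (s • u)⟫_ℂ))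
      (fun i j => ⟪L i (s • u + (0 : ℝ) • w), L j (s • u + (0 : ℝ) • w)⟫_ℂ) := by
    rw [zero_smul, add_zero]
    exact ((contDiffAt_logDet (det_one_add_gram_re_pos fun i => L i (s • u))
      (n := 1)).differentiableAt (by simp)).hasFDerivAt
  have h3 : HasDerivAt (fun t : ℝ => potential L (s • u + t • w))
      (fderiv ℝ (potential L) (s • u) w) 0 :=
    HasFDerivAt.comp_hasDerivAt (f := fun t : ℝ => s • u + t • w) 0 h1
      (hasDerivAt_add_smul (s • u) w)
  have h4 := h2.comp_hasDerivAt 0 (hasDerivAt_gram L u w s)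
  rw [h3.unique h4, map_smul, smul_eq_mul]

/-- Along the ray `s • u` the first derivative in direction `w` has the form s · φ(s) with φ
differentiable, so its derivative at s = 0 is φ(0), the real part of the trace of the polarized Gram
matrix. The value of the second derivative of `logDet` does not enter. -/
theorem fderiv_fderiv_potential_zero (u w : E) :
    fderiv ℝ (fderiv ℝ (potential L)) 0 u w = 2 * ∑ i, (⟪L i u, L i w⟫_ℂ).re := by
  set S : Fin k → Fin k → ℂ := fun i j => ⟪L i u, L j w⟫_ℂ + ⟪L i w, L j u⟫_ℂ with hS
  have hK2 : HasFDerivAt (fderiv ℝ (potential L)) (fderiv ℝ (fderiv ℝ (potential L)) 0)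
      (0 + (0 : ℝ) • u) := by
    rw [zero_smul, add_zero]
    exact (((contDiff_potential L (n := 2)).fderiv_right (m := 1) le_rfl).contDiffAt.differentiableAt
      (by simp)).hasFDerivAt
  have h1 : HasDerivAt (fun s : ℝ => fderiv ℝ (potential L) (s • u) w)
      (fderiv ℝ (fderiv ℝ (potential L)) 0 u w) 0 := by
    have h2 : HasDerivAt (fun s : ℝ => fderiv ℝ (potential L) (0 + s • u))
        (fderiv ℝ (fderiv ℝ (potential L)) 0 u) 0 :=
      hK2.comp_hasDerivAt 0 (hasDerivAt_add_smul 0 u)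
    simp only [zero_add] at h2
    exact (ContinuousLinearMap.apply ℝ ℝ w).hasFDerivAt.comp_hasDerivAt 0 h2
  have hφ : DifferentiableAt ℝ (fun s : ℝ =>
      fderiv ℝ logDet (fun i j => ⟪L i (s • u), L j (s • u)⟫_ℂ) S) 0 := by
    have hd : DifferentiableAt ℝ (fderiv ℝ logDet)
        (fun i j => ⟪L i ((0 : ℝ) • u), L j ((0 : ℝ) • u)⟫_ℂ) :=
      ((contDiffAt_logDet (det_one_add_gram_re_pos fun i => L i ((0 : ℝ) • u))
        (n := 2)).fderiv_right (m := 1) le_rfl).differentiableAt (by simp)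
    have hNu : DifferentiableAt ℝ (fun s : ℝ => fun i j => ⟪L i (s • u), L j (s • u)⟫_ℂ) 0 :=
      DifferentiableAt.comp (0 : ℝ)
        ((contDiff_gram L (n := 1)).contDiffAt.differentiableAt (by simp))
        (differentiableAt_id.smul_const u)
    have hc : DifferentiableAt ℝ (fun s : ℝ =>
        fderiv ℝ logDet (fun i j => ⟪L i (s • u), L j (s • u)⟫_ℂ)) 0 := hd.comp (0 : ℝ) hNu
    exact (ContinuousLinearMap.apply ℝ ℝ S).differentiableAt.comp (0 : ℝ) hc
  have h2 := (hasDerivAt_id (0 : ℝ)).mul hφ.hasDerivAt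
  have h3 := h1.unique (h2.congr_of_eventuallyEq
    (Eventually.of_forall (fderiv_potential_smul L u w)))
  have hN0 : (fun i j => ⟪L i ((0 : ℝ) • u), L j ((0 : ℝ) • u)⟫_ℂ) = 0 := by
    ext i j; simp
  rw [h3, hN0, fderiv_logDet_zero]
  simp only [Matrix.trace, Matrix.diag, Matrix.of_apply, S, Complex.re_sum, Complex.add_re,
    Finset.mul_sum, one_mul, id, zero_mul, add_zero]
  refine Finset.sum_congr rfl fun i _ => ?_
  rw [← inner_conj_symm (L i w) (L i u), Complex.conj_re]
  ring

/-- The Levi form of the potential at the origin is the form `2i ∑ Im ⟨Lᵢ u, Lᵢ v⟩`. -/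
theorem extDeriv_del_potential_zero (u v : E) :
    extDeriv (del (potential L)) 0 ![u, v] =
      Complex.I * ((2 * ∑ i, (⟪L i u, L i v⟫_ℂ).im : ℝ) : ℂ) := by
  have hd : DifferentiableAt ℝ (fderiv ℝ (potential L)) 0 :=
    ((contDiff_potential L (n := 2)).fderiv_right (m := 1) le_rfl).contDiffAt.differentiableAt
      (by simp)
  rw [extDeriv_del_apply hd, delCLM_apply, delCLM_apply]
  simp only [fderiv_fderiv_potential_zero, Matrix.cons_val_zero]
  have h1 : ∀ i, (⟪L i v, L i u⟫_ℂ).re = (⟪L i u, L i v⟫_ℂ).re := fun i => by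
    rw [← inner_conj_symm, Complex.conj_re]
  have h2 : ∀ i, (⟪L i u, L i (Complex.I • v)⟫_ℂ).re = -(⟪L i u, L i v⟫_ℂ).im := fun i => by
    rw [map_smul, inner_smul_right]; simp
  have h3 : ∀ i, (⟪L i v, L i (Complex.I • u)⟫_ℂ).re = (⟪L i u, L i v⟫_ℂ).im := fun i => by
    rw [map_smul, inner_smul_right, ← inner_conj_symm (L i v) (L i u), Complex.I_mul_re,
      Complex.conj_im, neg_neg]
  simp only [h1, h2, h3, Finset.sum_neg_distrib]
  push_cast
  ring

end

end Kahler

/-! ### Finite-dimensional subspaces, projections and the unitary action -/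

namespace Grass

section

variable {k : ℕ} {F : Type} [NormedAddCommGroup F] [InnerProductSpace ℂ F]

/-- The orthogonal projection onto a `k`-dimensional subspace. -/
noncomputable def proj (W : FinSubspaces k F) : F →L[ℂ] F :=
  haveI := W.2.1
  W.1.starProjection

theorem proj_apply_mem (W : FinSubspaces k F) (x : F) : proj W x ∈ W.1 :=
  haveI := W.2.1
  Submodule.starProjection_apply_mem W.1 x

theorem proj_eq_self_iff (W : FinSubspaces k F) (x : F) : proj W x = x ↔ x ∈ W.1 :=
  haveI := W.2.1
  Submodule.starProjection_eq_self_iff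

theorem range_proj (W : FinSubspaces k F) : LinearMap.range (proj W).toLinearMap = W.1 := by
  ext x
  constructor
  · rintro ⟨y, rfl⟩
    exact proj_apply_mem W y
  · intro hx
    exact ⟨x, (proj_eq_self_iff W x).2 hx⟩

theorem proj_injective : Function.Injective (proj : FinSubspaces k F → F →L[ℂ] F) := fun W W' h =>
  Subtype.ext (by rw [← range_proj W, h, range_proj])

/-- Two `k`-dimensional subspaces agree if one is contained in the other. -/
theorem FinSubspaces.eq_of_le {W W' : FinSubspaces k F} (h : W.1 ≤ W'.1) : W = W' :=
  haveI := W'.2.1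
  Subtype.ext (Submodule.eq_of_le_of_finrank_eq h (W.2.2.trans W'.2.2.symm))

/-- The inclusion of the summand `ℂᵏ` of `F ≅ ℂᵏ ⊕ F`. -/
noncomputable def inl (Φ : Splitting k F) : EuclideanSpace ℂ (Fin k) →L[ℂ] F :=
  Φ.toContinuousLinearEquiv.toContinuousLinearMap ∘L
    (WithLp.prodContinuousLinearEquiv 2 ℂ (EuclideanSpace ℂ (Fin k))
      F).symm.toContinuousLinearMap ∘L ContinuousLinearMap.inl ℂ _ _

/-- The inclusion of the summand `F` of `F ≅ ℂᵏ ⊕ F`. -/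
noncomputable def inr (Φ : Splitting k F) : F →L[ℂ] F :=
  Φ.toContinuousLinearEquiv.toContinuousLinearMap ∘L
    (WithLp.prodContinuousLinearEquiv 2 ℂ (EuclideanSpace ℂ (Fin k))
      F).symm.toContinuousLinearMap ∘L ContinuousLinearMap.inr ℂ _ _

/-- The projection of `F ≅ ℂᵏ ⊕ F` to `ℂᵏ`. -/
noncomputable def fst (Φ : Splitting k F) : F →L[ℂ] EuclideanSpace ℂ (Fin k) :=
  WithLp.fstL 2 ℂ _ _ ∘L Φ.symm.toContinuousLinearEquiv.toContinuousLinearMap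

/-- The projection of `F ≅ ℂᵏ ⊕ F` to `F`. -/
noncomputable def snd (Φ : Splitting k F) : F →L[ℂ] F :=
  WithLp.sndL 2 ℂ _ _ ∘L Φ.symm.toContinuousLinearEquiv.toContinuousLinearMap

variable (Φ : Splitting k F)

theorem inl_apply (x : EuclideanSpace ℂ (Fin k)) : inl Φ x = Φ (WithLp.toLp 2 (x, 0)) := rfl

theorem inr_apply (y : F) : inr Φ y = Φ (WithLp.toLp 2 (0, y)) := rfl

theorem inl_add_inr (x : EuclideanSpace ℂ (Fin k)) (y : F) :
    inl Φ x + inr Φ y = Φ (WithLp.toLp 2 (x, y)) := by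
  rw [inl_apply, inr_apply, ← map_add, ← WithLp.toLp_add, Prod.mk_add_mk, add_zero, zero_add]

theorem fst_apply (x : EuclideanSpace ℂ (Fin k)) (y : F) :
    fst Φ (Φ (WithLp.toLp 2 (x, y))) = x :=
  congrArg WithLp.fst (Φ.symm_apply_apply (WithLp.toLp 2 (x, y)))

theorem snd_apply (x : EuclideanSpace ℂ (Fin k)) (y : F) :
    snd Φ (Φ (WithLp.toLp 2 (x, y))) = y :=
  congrArg WithLp.snd (Φ.symm_apply_apply (WithLp.toLp 2 (x, y)))

theorem inl_fst_add_inr_snd (z : F) : inl Φ (fst Φ z) + inr Φ (snd Φ z) = z := by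
  rw [inl_add_inr]
  exact Φ.apply_symm_apply z

theorem inner_inl (x : EuclideanSpace ℂ (Fin k)) (z : F) :
    ⟪inl Φ x, z⟫_ℂ = ⟪x, fst Φ z⟫_ℂ := by
  conv_lhs => rw [← inl_fst_add_inr_snd Φ z, inl_add_inr, inl_apply, Φ.inner_map_map,
    WithLp.prod_inner_apply]
  simp

theorem inner_inr (y : F) (z : F) :
    ⟪inr Φ y, z⟫_ℂ = ⟪y, snd Φ z⟫_ℂ := by
  conv_lhs => rw [← inl_fst_add_inr_snd Φ z, inl_add_inr, inr_apply, Φ.inner_map_map,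
    WithLp.prod_inner_apply]
  simp

/-- The parametrization of the graph of `T` as a bounded operator depending continuously on `T`. -/
noncomputable def graphCLM (T : Model k F) : EuclideanSpace ℂ (Fin k) →L[ℂ] F :=
  inl Φ + inr Φ ∘L T

theorem graphCLM_apply (T : Model k F) (x : EuclideanSpace ℂ (Fin k)) :
    graphCLM Φ T x = graphMap Φ T x := by
  change inl Φ x + inr Φ (T x) = _
  rw [inl_add_inr]; rfl

theorem fst_graphMap (T : Model k F) (x : EuclideanSpace ℂ (Fin k)) :
    fst Φ (graphMap Φ T x) = x := fst_apply Φ _ _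

theorem snd_graphMap (T : Model k F) (x : EuclideanSpace ℂ (Fin k)) :
    snd Φ (graphMap Φ T x) = T x := snd_apply Φ _ _

theorem mem_graph_iff (T : Model k F) (z : F) : z ∈ (graph Φ T).1 ↔ snd Φ z = T (fst Φ z) := by
  constructor
  · rintro ⟨x, rfl⟩
    rw [fst_graphMap, snd_graphMap]
  · intro h
    refine ⟨fst Φ z, ?_⟩
    conv_rhs => rw [← inl_fst_add_inr_snd Φ z, inl_add_inr, h]
    rfl

theorem inner_graphMap (T : Model k F) (x y : EuclideanSpace ℂ (Fin k)) :
    ⟪graphMap Φ T x, graphMap Φ T y⟫_ℂ = ⟪x, y⟫_ℂ + ⟪T x, T y⟫_ℂ :=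
  (Φ.inner_map_map _ _).trans (WithLp.prod_inner_apply _ _)

theorem graph_injective : Function.Injective (graph Φ) := by
  intro T T' h
  ext1 x
  have : graphMap Φ T x ∈ (graph Φ T').1 := h ▸ ⟨x, rfl⟩
  rw [mem_graph_iff, fst_graphMap, snd_graphMap] at this
  exact this

variable [CompleteSpace F]

theorem isStarProjection_proj (W : FinSubspaces k F) : IsStarProjection (proj W) :=
  haveI := W.2.1
  isStarProjection_starProjection

theorem eq_proj_of_isStarProjection {P : F →L[ℂ] F} (hP : IsStarProjection P)
    (W : FinSubspaces k F) (h : LinearMap.range P.toLinearMap = W.1) : P = proj W :=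
  ContinuousLinearMap.IsStarProjection.ext hP (isStarProjection_proj W) (h.trans (range_proj W).symm)

theorem unitary_apply_star (u : unitary (F →L[ℂ] F)) (x : F) :
    (u : F →L[ℂ] F) (star (u : F →L[ℂ] F) x) = x :=
  congrArg (fun A : F →L[ℂ] F => A x) (Unitary.mul_star_self_of_mem u.2)

theorem star_unitary_apply (u : unitary (F →L[ℂ] F)) (x : F) :
    star (u : F →L[ℂ] F) ((u : F →L[ℂ] F) x) = x :=
  congrArg (fun A : F →L[ℂ] F => A x) (Unitary.star_mul_self_of_mem u.2)

theorem proj_unitaryMap (u : unitary (F →L[ℂ] F)) (W : FinSubspaces k F) :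
    proj (unitaryMap u W) = (u : F →L[ℂ] F) * proj W * star (u : F →L[ℂ] F) := by
  have hW := isStarProjection_proj W
  refine (eq_proj_of_isStarProjection ⟨?_, ?_⟩ _ ?_).symm
  · change _ * _ = _
    calc (u : F →L[ℂ] F) * proj W * star (u : F →L[ℂ] F) *
          ((u : F →L[ℂ] F) * proj W * star (u : F →L[ℂ] F))
        = (u : F →L[ℂ] F) * (proj W * (star (u : F →L[ℂ] F) * (u : F →L[ℂ] F)) * proj W) *
          star (u : F →L[ℂ] F) := by simp only [mul_assoc]
      _ = _ := by rw [Unitary.star_mul_self_of_mem u.2, mul_one, hW.isIdempotentElem.eq]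
  · exact hW.isSelfAdjoint.conjugate _
  · ext z
    constructor
    · rintro ⟨y, rfl⟩
      exact ⟨proj W (star (u : F →L[ℂ] F) y), proj_apply_mem W _, rfl⟩
    · rintro ⟨y, hy, rfl⟩
      refine ⟨(u : F →L[ℂ] F) y, ?_⟩
      change (u : F →L[ℂ] F) (proj W (star (u : F →L[ℂ] F) ((u : F →L[ℂ] F) y))) = _
      rw [star_unitary_apply, (proj_eq_self_iff W y).2 hy]
      rfl

/-- A unitary is block diagonal if and only if it preserves the summand `ℂᵏ`. -/
theorem mem_blockUnitary_of_unitaryMap_eq {w : unitary (F →L[ℂ] F)}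
    (hw : unitaryMap w (graph Φ 0) = graph Φ 0) : w ∈ blockUnitary Φ := by
  have h1 : ∀ w : unitary (F →L[ℂ] F), unitaryMap w (graph Φ 0) = graph Φ 0 →
      ∀ x, snd Φ ((w : F →L[ℂ] F) (inl Φ x)) = 0 := by
    intro w hw x
    have : (w : F →L[ℂ] F) (inl Φ x) ∈ (graph Φ 0).1 := hw ▸ ⟨inl Φ x, ⟨x, rfl⟩, rfl⟩
    simpa [mem_graph_iff] using this
  have hw' : unitaryMap w⁻¹ (graph Φ 0) = graph Φ 0 := by
    conv_lhs => rw [← hw, ← unitaryMap_mul, inv_mul_cancel]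
    exact Subtype.ext (Submodule.map_id _)
  -- The adjoint of `w` is `w⁻¹`; since it preserves the summand ℂᵏ, `w` preserves the orthogonal
  -- complement.
  have h2 : ∀ w : unitary (F →L[ℂ] F), unitaryMap w⁻¹ (graph Φ 0) = graph Φ 0 →
      ∀ y, fst Φ ((w : F →L[ℂ] F) (inr Φ y)) = 0 := by
    intro w hw y
    refine ext_inner_left ℂ fun x => ?_
    rw [← inner_inl, inner_zero_right]
    have h3 := h1 _ hw x
    rw [← ContinuousLinearMap.adjoint_inner_left, ← inner_conj_symm, inner_inr]
    change starRingEnd ℂ ⟪y, snd Φ (((w⁻¹ : unitary (F →L[ℂ] F)) : F →L[ℂ] F) (inl Φ x))⟫_ℂ = 0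
    rw [h3, inner_zero_right, map_zero]
  let A : EuclideanSpace ℂ (Fin k) →L[ℂ] EuclideanSpace ℂ (Fin k) :=
    fst Φ ∘L (w : F →L[ℂ] F) ∘L inl Φ
  let B : F →L[ℂ] F := snd Φ ∘L (w : F →L[ℂ] F) ∘L inr Φ
  have hA : ∀ x, inl Φ (A x) = (w : F →L[ℂ] F) (inl Φ x) := fun x => by
    conv_rhs => rw [← inl_fst_add_inr_snd Φ ((w : F →L[ℂ] F) (inl Φ x)), h1 w hw x, map_zero,
      add_zero]
    rfl
  have hB : ∀ y, inr Φ (B y) = (w : F →L[ℂ] F) (inr Φ y) := fun y => by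
    conv_rhs => rw [← inl_fst_add_inr_snd Φ ((w : F →L[ℂ] F) (inr Φ y)), h2 w hw' y, map_zero,
      zero_add]
    rfl
  have hinl : ∀ x, ‖inl Φ x‖ = ‖x‖ := fun x => by
    rw [inl_apply, Φ.norm_map, WithLp.prod_norm_eq_of_L2]; simp
  have hinr : ∀ x, ‖inr Φ x‖ = ‖x‖ := fun x => by
    rw [inr_apply, Φ.norm_map, WithLp.prod_norm_eq_of_L2]; simp
  have hAu : A ∈ unitary (EuclideanSpace ℂ (Fin k) →L[ℂ] EuclideanSpace ℂ (Fin k)) := by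
    let e : EuclideanSpace ℂ (Fin k) →ₗᵢ[ℂ] EuclideanSpace ℂ (Fin k) :=
      ⟨A.toLinearMap, fun x => by
        change ‖A x‖ = _
        rw [← hinl, hA, Unitary.norm_map, hinl]⟩
    exact (Unitary.linearIsometryEquiv.symm (e.toLinearIsometryEquiv rfl)).2
  have hBu : B ∈ unitary (F →L[ℂ] F) := by
    let e : F →ₗᵢ[ℂ] F := ⟨B.toLinearMap, fun x => by
        change ‖B x‖ = _
        rw [← hinr, hB, Unitary.norm_map, hinr]⟩
    -- An isometry of ℂᵏ is onto for reasons of dimension, but on the infinite-dimensional block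
    -- surjectivity needs an argument: `w⁻¹` also preserves the complement and provides preimages.
    have hsurj : Function.Surjective e := by
      intro y
      refine ⟨snd Φ (star (w : F →L[ℂ] F) (inr Φ y)), ?_⟩
      have h3 : fst Φ (star (w : F →L[ℂ] F) (inr Φ y)) = 0 := h2 w⁻¹ (by rwa [inv_inv]) y
      have h4 := inl_fst_add_inr_snd Φ (star (w : F →L[ℂ] F) (inr Φ y))
      rw [h3, map_zero, zero_add] at h4
      change snd Φ ((w : F →L[ℂ] F) (inr Φ _)) = y
      rw [h4, unitary_apply_star]
      exact snd_apply Φ 0 y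
    exact (Unitary.linearIsometryEquiv.symm (LinearIsometryEquiv.ofSurjective e hsurj)).2
  refine ⟨⟨(Matrix.toEuclideanCLM (𝕜 := ℂ) (n := Fin k)).symm A, ?_⟩, ⟨B, hBu⟩, fun x y => ?_⟩
  · refine Matrix.mem_unitaryGroup_iff'.2
      (EquivLike.injective (Matrix.toEuclideanCLM (𝕜 := ℂ) (n := Fin k)) ?_)
    rw [map_mul, map_star, StarAlgEquiv.apply_symm_apply, map_one]
    exact Unitary.star_mul_self_of_mem hAu
  · simp only [StarAlgEquiv.apply_symm_apply]
    rw [← inl_add_inr, ← inl_add_inr, map_add, hA, hB]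

theorem taut_mk (u : unitary (F →L[ℂ] F)) :
    taut Φ (QuotientGroup.mk u) = unitaryMap u (graph Φ 0) := rfl

theorem taut_injective : Function.Injective (taut Φ) := by
  intro p q h
  induction p using QuotientGroup.induction_on with | H u => ?_
  induction q using QuotientGroup.induction_on with | H v => ?_
  rw [taut_mk, taut_mk] at h
  rw [QuotientGroup.eq]
  refine mem_blockUnitary_of_unitaryMap_eq Φ ?_
  rw [unitaryMap_mul, ← h, ← unitaryMap_mul, inv_mul_cancel]
  exact Subtype.ext (Submodule.map_id _)

/-- The unitary group acts transitively on the `k`-dimensional subspaces. -/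
theorem exists_unitaryMap_eq (W W' : FinSubspaces k F) :
    ∃ u : unitary (F →L[ℂ] F), unitaryMap u W = W' := by
  have := W.2.1
  have := W'.2.1
  -- The sum of the two subspaces is finite-dimensional, so the isometry from `W` to `W'` extends to
  -- a unitary of it; the identity on the orthogonal complement completes this to a unitary of `F`.
  let U : Submodule ℂ F := W.1 ⊔ W'.1
  let e : W.1 ≃ₗᵢ[ℂ] W'.1 := (Kahler.onb W).repr.trans (Kahler.onb W').repr.symm
  let S : Submodule ℂ U := W.1.comap U.subtype
  let L : S →ₗᵢ[ℂ] U :=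
    { toFun := fun x => ⟨e ⟨x.1.1, x.2⟩, Submodule.mem_sup_right (e ⟨x.1.1, x.2⟩).2⟩
      map_add' := fun x y => Subtype.ext (by
        change ((e (⟨x.1.1, x.2⟩ + ⟨y.1.1, y.2⟩) : W'.1) : F) = _
        rw [map_add]; rfl)
      map_smul' := fun c x => Subtype.ext (by
        change ((e (c • ⟨x.1.1, x.2⟩) : W'.1) : F) = _
        rw [map_smul]; rfl)
      norm_map' := fun x => e.norm_map ⟨x.1.1, x.2⟩ }
  let M : U ≃ₗᵢ[ℂ] U := L.extend.toLinearIsometryEquiv rfl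
  let u : F ≃ₗᵢ[ℂ] F := (U.orthogonalDecomposition.trans
    (LinearIsometryEquiv.withLpProdCongr 2 M (LinearIsometryEquiv.refl ℂ _))).trans
      U.orthogonalDecomposition.symm
  have hu : ∀ (x : F) (hx : x ∈ W.1), u x = e ⟨x, hx⟩ := by
    intro x hx
    have hxU : x ∈ U := Submodule.mem_sup_left hx
    have h0 : ∀ z : U, U.orthogonalDecomposition.symm (WithLp.toLp 2 (z, 0)) = z := fun z =>
      add_zero (z : F)
    have h1 : U.orthogonalDecomposition x = WithLp.toLp 2 (⟨x, hxU⟩, 0) := by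
      rw [← LinearIsometryEquiv.eq_symm_apply, h0]
    have h2 : M ⟨x, hxU⟩ = L ⟨⟨x, hxU⟩, hx⟩ := L.extend_apply ⟨⟨x, hxU⟩, hx⟩
    change U.orthogonalDecomposition.symm
      (LinearIsometryEquiv.withLpProdCongr 2 M (LinearIsometryEquiv.refl ℂ _)
        (U.orthogonalDecomposition x)) = _
    rw [h1]
    change U.orthogonalDecomposition.symm (WithLp.toLp 2 (M ⟨x, hxU⟩, 0)) = _
    rw [h0, h2]
    rfl
  refine ⟨Unitary.linearIsometryEquiv.symm u, FinSubspaces.eq_of_le ?_⟩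
  rintro _ ⟨x, hx, rfl⟩
  change u x ∈ _
  rw [hu x hx]
  exact (e _).2

theorem taut_bijective : Function.Bijective (taut Φ) :=
  ⟨taut_injective Φ, fun W => by
    obtain ⟨u, hu⟩ := exists_unitaryMap_eq (graph Φ 0) W
    exact ⟨QuotientGroup.mk u, hu⟩⟩

end

end Grass

/-! ### The quotient topology as the norm topology of projections -/

namespace Grass

open Filter

section

variable {F : Type} [NormedAddCommGroup F] [InnerProductSpace ℂ F] [CompleteSpace F]

/-- The unitary part of an invertible operator intertwining two projections intertwines them. -/
theorem unitary_part {P Q g : F →L[ℂ] F} (hP : IsSelfAdjoint P) (hQ : IsSelfAdjoint Q)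
    (hgP : g * P = Q * g) (hg : IsUnit g) (hb : IsUnit (CFC.abs g)) :
    g * Ring.inverse (CFC.abs g) ∈ unitary (F →L[ℂ] F) ∧
      g * Ring.inverse (CFC.abs g) * P = Q * (g * Ring.inverse (CFC.abs g)) := by
  have hbb : CFC.abs g * CFC.abs g = star g * g := CFC.abs_mul_abs g
  have hbs : star (CFC.abs g) = CFC.abs g := (CFC.abs_nonneg g).isSelfAdjoint.star_eq
  have hgP' : star g * Q = P * star g := by
    have := congrArg star hgP
    rw [star_mul, star_mul, hP.star_eq, hQ.star_eq] at this
    exact this.symm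
  have hcomm : Commute (star g * g) P := by
    change star g * g * P = P * (star g * g)
    rw [mul_assoc, hgP, ← mul_assoc, hgP', mul_assoc]
  -- The absolute value is a continuous function of g*g, hence commutes with everything that g*g
  -- commutes with; dividing `g` by it therefore keeps the intertwining relation.
  have hbP : Commute (CFC.abs g) P := Commute.cfcₙ_nnreal hcomm _
  obtain ⟨b, hb'⟩ := hb
  rw [← hb'] at hbb hbs hbP ⊢
  rw [Ring.inverse_unit]
  have hrs : star (↑b⁻¹ : F →L[ℂ] F) = ↑b⁻¹ := by
    refine left_inv_eq_right_inv (a := (b : F →L[ℂ] F)) ?_ b.mul_inv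
    conv_lhs => rw [← hbs]
    rw [← star_mul, b.mul_inv, star_one]
  have hrP : Commute (↑b⁻¹ : F →L[ℂ] F) P := hbP.units_inv_left
  refine ⟨IsUnit.mem_unitary_of_star_mul_self (hg.mul b⁻¹.isUnit) ?_, ?_⟩
  · rw [star_mul, hrs, mul_assoc, ← mul_assoc (star g), ← hbb, mul_assoc, b.mul_inv, mul_one,
      b.inv_mul]
  · rw [mul_assoc, hrP.eq, ← mul_assoc, hgP, mul_assoc]

/-- Projections close to `P` are conjugate to `P` by unitaries close to `1`. -/
theorem eventually_exists_unitary {P : F →L[ℂ] F} (hP : IsStarProjection P)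
    {N : Set (unitary (F →L[ℂ] F))} (hN : N ∈ 𝓝 1) :
    ∀ᶠ Q in 𝓝 P, IsStarProjection Q → ∃ w ∈ N, (w : F →L[ℂ] F) * P = Q * (w : F →L[ℂ] F) := by
  -- For every projection Q this satisfies gP = QP = Qg, and it equals 1 at Q = P. Near P both `g`
  -- and its absolute value are therefore invertible, and the unitary part is close to 1.
  let g : (F →L[ℂ] F) → (F →L[ℂ] F) := fun Q => Q * P + (1 - Q) * (1 - P)
  have hg : Continuous g := by fun_prop
  have hgP : g P = 1 := by
    have : P * P = P := hP.isIdempotentElem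
    simp only [g, mul_sub, sub_mul, this]
    simp
  have ha : Continuous fun Q => CFC.abs (g Q) := CFC.continuous_abs.comp hg
  have haP : CFC.abs (g P) = 1 := by rw [hgP]; exact CFC.abs_one
  have hunit : {x : F →L[ℂ] F | IsUnit x} ∈ 𝓝 1 := Units.isOpen.mem_nhds isUnit_one
  have hU : ContinuousAt (fun Q => g Q * Ring.inverse (CFC.abs (g Q))) P := by
    refine hg.continuousAt.mul (ContinuousAt.comp (g := Ring.inverse) ?_ ha.continuousAt)
    rw [haP]
    exact NormedRing.inverse_continuousAt 1
  rw [nhds_subtype_eq_comap] at hN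
  obtain ⟨N', hN', hsub⟩ := hN
  have hU1 : g P * Ring.inverse (CFC.abs (g P)) = ((1 : unitary (F →L[ℂ] F)) : F →L[ℂ] F) := by
    rw [haP, hgP, Ring.inverse_one, mul_one]; rfl
  have e1 : ∀ᶠ Q in 𝓝 P, IsUnit (g Q) := hg.continuousAt.eventually (by rw [hgP]; exact hunit)
  have e2 : ∀ᶠ Q in 𝓝 P, IsUnit (CFC.abs (g Q)) :=
    ha.continuousAt.eventually (by beta_reduce; rw [haP]; exact hunit)
  have e3 : ∀ᶠ Q in 𝓝 P, g Q * Ring.inverse (CFC.abs (g Q)) ∈ N' :=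
    hU.eventually (by beta_reduce; rw [hU1]; exact hN')
  filter_upwards [e1, e2, e3] with Q h1 h2 h3 hQ
  have hint : g Q * P = Q * g Q := by
    have h4 : P * P = P := hP.isIdempotentElem
    have h5 : Q * Q = Q := hQ.isIdempotentElem
    have h6 : g Q * P = Q * P := by
      simp only [g, add_mul, mul_assoc, sub_mul (1 : F →L[ℂ] F) P, h4]
      simp
    have h7 : Q * g Q = Q * P := by
      simp only [g, mul_add, ← mul_assoc, mul_sub Q 1 Q, h5]
      simp
    rw [h6, h7]
  obtain ⟨h4, h5⟩ := unitary_part hP.isSelfAdjoint hQ.isSelfAdjoint hint h1 h2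
  exact ⟨⟨_, h4⟩, hsub h3, h5⟩

end

theorem isUnit_of_injective {k : ℕ}
    {a : EuclideanSpace ℂ (Fin k) →L[ℂ] EuclideanSpace ℂ (Fin k)}
    (ha : ∀ x, a x = 0 → x = 0) : IsUnit a := by
  have hinj : Function.Injective a.toLinearMap := (injective_iff_map_eq_zero _).2 ha
  exact ContinuousLinearMap.isUnit_iff_bijective.2
    ⟨hinj, LinearMap.injective_iff_surjective.1 hinj⟩

section

variable {k : ℕ} {F : Type} [NormedAddCommGroup F] [InnerProductSpace ℂ F] [CompleteSpace F]
  (Φ : Splitting k F)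

theorem continuous_proj_taut : Continuous fun q => proj (taut Φ q) := by
  have h : Continuous fun u : unitary (F →L[ℂ] F) =>
      (u : F →L[ℂ] F) * proj (graph Φ 0) * star (u : F →L[ℂ] F) := by fun_prop
  refine (QuotientGroup.isQuotientMap_mk (N := blockUnitary Φ)).continuous_iff.2 ?_
  convert h using 2 with u
  exact proj_unitaryMap u _

/-- The topology of the Grassmannian is the norm topology of the orthogonal projections. -/
theorem isInducing_proj_taut : Topology.IsInducing fun q => proj (taut Φ q) := by
  refine Topology.isInducing_iff_nhds.2 fun q =>
    le_antisymm ((continuous_proj_taut Φ).tendsto q).le_comap fun N hN => ?_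
  induction q using QuotientGroup.induction_on with | H u => ?_
  have hc : Continuous fun w : unitary (F →L[ℂ] F) => (QuotientGroup.mk (w * u) : Gr Φ) :=
    QuotientGroup.continuous_mk.comp (continuous_id.mul continuous_const)
  have hN' : (fun w : unitary (F →L[ℂ] F) => (QuotientGroup.mk (w * u) : Gr Φ)) ⁻¹' N ∈ 𝓝 1 :=
    hc.continuousAt.preimage_mem_nhds (by rwa [one_mul])
  -- A point whose projection is close to that of [u] has the form [wu] with `w` in a prescribed
  -- neighbourhood of 1, and so lies in the given neighbourhood `N`.
  refine mem_comap.2 ⟨_, eventually_exists_unitary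
    (isStarProjection_proj (taut Φ (QuotientGroup.mk u))) hN', fun q hq => ?_⟩
  obtain ⟨w, hw, hwP⟩ := hq (isStarProjection_proj _)
  suffices h : (QuotientGroup.mk (w * u) : Gr Φ) = q by rw [← h]; exact hw
  refine taut_injective Φ (proj_injective ?_)
  rw [taut_mk, unitaryMap_mul, proj_unitaryMap, ← taut_mk, hwP, mul_assoc,
    Unitary.mul_star_self_of_mem w.2, mul_one]

/-- The point of the Grassmannian corresponding to a `k`-dimensional subspace. -/
noncomputable def point (W : FinSubspaces k F) : Gr Φ :=
  (Equiv.ofBijective _ (taut_bijective Φ)).symm W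

theorem taut_point (W : FinSubspaces k F) : taut Φ (point Φ W) = W :=
  (Equiv.ofBijective _ (taut_bijective Φ)).apply_symm_apply W

theorem point_taut (q : Gr Φ) : point Φ (taut Φ q) = q :=
  (Equiv.ofBijective _ (taut_bijective Φ)).symm_apply_apply q

theorem continuous_iff_proj_taut {X : Type*} [TopologicalSpace X] {f : X → Gr Φ} :
    Continuous f ↔ Continuous fun x => proj (taut Φ (f x)) :=
  (isInducing_proj_taut Φ).continuous_iff

end

end Grass

/-! ### Graph coordinates as charts -/

namespace Grass

open Filter

section

variable {k : ℕ} {F : Type} [NormedAddCommGroup F] [InnerProductSpace ℂ F]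

/-- The compression of an operator to the summand `ℂᵏ`. -/
noncomputable def corner (Ψ : Splitting k F) (P : F →L[ℂ] F) :
    EuclideanSpace ℂ (Fin k) →L[ℂ] EuclideanSpace ℂ (Fin k) :=
  fst Ψ ∘L P ∘L inl Ψ

theorem continuous_corner (Ψ : Splitting k F) : Continuous (corner Ψ) :=
  continuous_const.clm_comp (continuous_id.clm_comp continuous_const)

/-- The graph coordinate of a subspace that is a graph with respect to the splitting `Ψ`. -/
noncomputable def coordOf (Ψ : Splitting k F) (P : F →L[ℂ] F) : Model k F :=
  (snd Ψ ∘L P ∘L inl Ψ) ∘L Ring.inverse (corner Ψ P)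

/-- Projecting the vector of ℂᵏ obtained from x by the inverse corner gives an element of `W` with
first component x and second component the coordinate applied to x. So the graph lies in `W`, and
the dimensions agree. -/
theorem graph_coordOf (Ψ : Splitting k F) (W : FinSubspaces k F)
    (hW : IsUnit (corner Ψ (proj W))) : graph Ψ (coordOf Ψ (proj W)) = W := by
  refine FinSubspaces.eq_of_le ?_
  rintro _ ⟨x, rfl⟩
  obtain ⟨c, hc⟩ := hW
  have h1 : fst Ψ (proj W (inl Ψ ((↑c⁻¹ : Model k (EuclideanSpace ℂ (Fin k))) x))) = x := by
    change corner Ψ (proj W) _ = x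
    rw [← hc]
    exact congrArg (fun A : Model k (EuclideanSpace ℂ (Fin k)) => A x) c.mul_inv
  suffices h : graphMap Ψ (coordOf Ψ (proj W)) x =
      proj W (inl Ψ ((↑c⁻¹ : Model k (EuclideanSpace ℂ (Fin k))) x)) by
    rw [h]; exact proj_apply_mem _ _
  conv_rhs => rw [← inl_fst_add_inr_snd Ψ (proj W _), inl_add_inr, h1]
  rw [coordOf, ← hc, Ring.inverse_unit]
  rfl

variable [CompleteSpace F] (Φ : Splitting k F)

theorem isUnit_adjoint_comp_graphCLM (Ψ : Splitting k F) (T : Model k F) :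
    IsUnit (ContinuousLinearMap.adjoint (graphCLM Ψ T) ∘L graphCLM Ψ T) := by
  refine isUnit_of_injective fun x hx => graphMap_injective Ψ T ?_
  rw [map_zero, ← graphCLM_apply, ← inner_self_eq_zero (𝕜 := ℂ),
    ← ContinuousLinearMap.adjoint_inner_left]
  change ⟪(ContinuousLinearMap.adjoint (graphCLM Ψ T) ∘L graphCLM Ψ T) x, x⟫_ℂ = 0
  rw [hx, inner_zero_left]

/-- The Gram operator G*G of an injective parametrization G is invertible, and G (G*G)⁻¹ G* is
self-adjoint, idempotent and has the range of G. The formula makes norm continuity in `T` visible.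
-/
theorem proj_graph (Ψ : Splitting k F) (T : Model k F) : proj (graph Ψ T) =
    graphCLM Ψ T ∘L Ring.inverse (ContinuousLinearMap.adjoint (graphCLM Ψ T) ∘L graphCLM Ψ T) ∘L
      ContinuousLinearMap.adjoint (graphCLM Ψ T) := by
  obtain ⟨c, hc⟩ := isUnit_adjoint_comp_graphCLM Ψ T
  set G := graphCLM Ψ T with hG
  rw [← hc, Ring.inverse_unit]
  have hcs : ContinuousLinearMap.adjoint (c : Model k (EuclideanSpace ℂ (Fin k))) = c := by
    rw [hc, ContinuousLinearMap.adjoint_comp, ContinuousLinearMap.adjoint_adjoint]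
  have hcs' : ContinuousLinearMap.adjoint (↑c⁻¹ : Model k (EuclideanSpace ℂ (Fin k))) = ↑c⁻¹ := by
    refine left_inv_eq_right_inv (a := (c : Model k (EuclideanSpace ℂ (Fin k)))) ?_ c.mul_inv
    conv_lhs => rw [← hcs]
    change _ ∘L _ = _
    rw [← ContinuousLinearMap.adjoint_comp]
    change star ((c : Model k (EuclideanSpace ℂ (Fin k))) * ↑c⁻¹) = 1
    rw [c.mul_inv, star_one]
  have hGG : ∀ x, ContinuousLinearMap.adjoint G (G x) = (c : Model k (EuclideanSpace ℂ (Fin k))) x :=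
    fun x => congrArg (fun A : Model k (EuclideanSpace ℂ (Fin k)) => A x) hc.symm
  have hinv : ∀ x, (↑c⁻¹ : Model k (EuclideanSpace ℂ (Fin k)))
      ((c : Model k (EuclideanSpace ℂ (Fin k))) x) = x := fun x =>
    congrArg (fun A : Model k (EuclideanSpace ℂ (Fin k)) => A x) c.inv_mul
  refine (eq_proj_of_isStarProjection ⟨?_, ?_⟩ _ ?_).symm
  · ext x
    change G ((↑c⁻¹ : Model k (EuclideanSpace ℂ (Fin k))) (ContinuousLinearMap.adjoint G (G _))) = _
    rw [hGG, hinv]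
    rfl
  · rw [ContinuousLinearMap.isSelfAdjoint_iff', ContinuousLinearMap.adjoint_comp,
      ContinuousLinearMap.adjoint_comp, ContinuousLinearMap.adjoint_adjoint, hcs']
    rfl
  · ext z
    constructor
    · rintro ⟨y, rfl⟩
      exact ⟨_, (graphCLM_apply Ψ T _).symm⟩
    · rintro ⟨x, rfl⟩
      refine ⟨G x, ?_⟩
      change G ((↑c⁻¹ : Model k (EuclideanSpace ℂ (Fin k))) (ContinuousLinearMap.adjoint G (G x))) = _
      rw [hGG, hinv, hG, graphCLM_apply]

theorem continuous_proj_graph (Ψ : Splitting k F) : Continuous fun T => proj (graph Ψ T) := by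
  have hG : Continuous (graphCLM Ψ) :=
    continuous_const.add (continuous_const.clm_comp continuous_id)
  have hA : Continuous fun T => ContinuousLinearMap.adjoint (graphCLM Ψ T) :=
    ContinuousLinearMap.adjoint.continuous.comp hG
  have hC : Continuous fun T => ContinuousLinearMap.adjoint (graphCLM Ψ T) ∘L graphCLM Ψ T :=
    hA.clm_comp hG
  have hI : Continuous fun T =>
      Ring.inverse (ContinuousLinearMap.adjoint (graphCLM Ψ T) ∘L graphCLM Ψ T) := by
    refine continuous_iff_continuousAt.2 fun T => ?_
    obtain ⟨c, hc⟩ := isUnit_adjoint_comp_graphCLM Ψ T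
    refine ContinuousAt.comp (g := Ring.inverse) ?_ hC.continuousAt
    rw [← hc]
    exact NormedRing.inverse_continuousAt c
  simp only [proj_graph]
  exact hG.clm_comp (hI.clm_comp hA)

theorem proj_apply_inner (W : FinSubspaces k F) (x y : F) :
    ⟪proj W x, y⟫_ℂ = ⟪x, proj W y⟫_ℂ := by
  rw [← ContinuousLinearMap.adjoint_inner_left]
  congr 2
  exact (isStarProjection_proj W).isSelfAdjoint.symm

/-- A graph vector with zero first component is zero, so x in the kernel of the corner gives P(x, 0)
= 0. Pairing (x, 0) with the graph vector (x, Tx), which P fixes, then yields ‖x‖² = 0. -/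
theorem isUnit_corner_graph (Ψ : Splitting k F) (T : Model k F) :
    IsUnit (corner Ψ (proj (graph Ψ T))) := by
  refine isUnit_of_injective fun x hx => ?_
  have h1 : proj (graph Ψ T) (inl Ψ x) = 0 := by
    obtain ⟨y, hy⟩ := proj_apply_mem (graph Ψ T) (inl Ψ x)
    have h2 : fst Ψ (proj (graph Ψ T) (inl Ψ x)) = 0 := hx
    rw [← hy, fst_graphMap] at h2
    rw [← hy, h2, map_zero]
  have h2 : proj (graph Ψ T) (graphMap Ψ T x) = graphMap Ψ T x :=
    (proj_eq_self_iff _ _).2 ⟨x, rfl⟩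
  have h3 := proj_apply_inner (graph Ψ T) (inl Ψ x) (graphMap Ψ T x)
  rw [h1, h2, inner_zero_left, inner_inl, fst_graphMap] at h3
  exact inner_self_eq_zero.1 h3.symm

/-- The standard graph coordinates on the Grassmannian. -/
noncomputable def graphChart (Ψ : Splitting k F) : OpenPartialHomeomorph (Gr Φ) (Model k F) where
  toFun q := coordOf Ψ (proj (taut Φ q))
  invFun T := point Φ (graph Ψ T)
  source := {q | IsUnit (corner Ψ (proj (taut Φ q)))}
  target := Set.univ
  map_source' _ _ := Set.mem_univ _
  map_target' T _ := by
    rw [Set.mem_ofPred_eq, taut_point]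
    exact isUnit_corner_graph Ψ T
  left_inv' q hq := by rw [graph_coordOf Ψ _ hq, point_taut]
  right_inv' T _ := by
    rw [taut_point]
    exact graph_injective Ψ (graph_coordOf Ψ _ (isUnit_corner_graph Ψ T))
  open_source :=
    Units.isOpen.preimage ((continuous_corner Ψ).comp (continuous_proj_taut Φ))
  open_target := isOpen_univ
  continuousOn_toFun := by
    intro q hq
    have hc : ContinuousAt (fun q => corner Ψ (proj (taut Φ q))) q :=
      ((continuous_corner Ψ).comp (continuous_proj_taut Φ)).continuousAt
    obtain ⟨c, hc'⟩ := hq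
    have hI : ContinuousAt (fun q => Ring.inverse (corner Ψ (proj (taut Φ q)))) q := by
      refine ContinuousAt.comp (g := Ring.inverse) ?_ hc
      rw [← hc']
      exact NormedRing.inverse_continuousAt c
    have hB : Continuous fun q => snd Ψ ∘L proj (taut Φ q) ∘L inl Ψ :=
      continuous_const.clm_comp ((continuous_proj_taut Φ).clm_comp continuous_const)
    exact (hB.continuousAt.clm_comp hI).continuousWithinAt
  continuousOn_invFun := by
    refine Continuous.continuousOn ((continuous_iff_proj_taut Φ).2 ?_)
    simp only [taut_point]
    exact continuous_proj_graph Ψ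

theorem graph_graphChart (Ψ : Splitting k F) {q : Gr Φ} (hq : q ∈ (graphChart Φ Ψ).source) :
    graph Ψ (graphChart Φ Ψ q) = taut Φ q := graph_coordOf Ψ _ hq

/-- The splitting whose summand `ℂᵏ` is the subspace `u (ℂᵏ ⊕ 0)`. -/
noncomputable def moveSplitting (u : unitary (F →L[ℂ] F)) : Splitting k F :=
  Φ.trans (Unitary.linearIsometryEquiv u)

theorem graph_moveSplitting_zero (u : unitary (F →L[ℂ] F)) :
    graph (moveSplitting Φ u) 0 = unitaryMap u (graph Φ 0) := by
  refine FinSubspaces.eq_of_le ?_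
  rintro _ ⟨x, rfl⟩
  exact ⟨graphMap Φ 0 x, ⟨x, rfl⟩, rfl⟩

/-- A splitting centered at a given point of the Grassmannian. -/
noncomputable def centered (q : Gr Φ) : Splitting k F :=
  moveSplitting Φ q.out

theorem graph_centered_zero (q : Gr Φ) : graph (centered Φ q) 0 = taut Φ q := by
  rw [centered, graph_moveSplitting_zero, ← taut_mk, QuotientGroup.out_eq']

theorem mem_source_graphChart {Ψ : Splitting k F} {q : Gr Φ} {T : Model k F}
    (h : taut Φ q = graph Ψ T) : q ∈ (graphChart Φ Ψ).source := by
  change IsUnit _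
  rw [h]
  exact isUnit_corner_graph Ψ T

/-- The charted space structure of the Grassmannian given by all graph coordinates. -/
noncomputable instance grassCharted : ChartedSpace (Model k F) (Gr Φ) where
  atlas := {e | ∃ Ψ : Splitting k F, e.target = Set.univ ∧ ∀ T, taut Φ (e.symm T) = graph Ψ T}
  chartAt q := graphChart Φ (centered Φ q)
  mem_chart_source q := mem_source_graphChart Φ (graph_centered_zero Φ q).symm
  chart_mem_atlas q := ⟨centered Φ q, rfl, fun _ => taut_point Φ _⟩

theorem isGraphAtlas_grassCharted : IsGraphAtlas Φ (grassCharted Φ) := fun _ => Iff.rfl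

/-- The preferred chart at a point uses a splitting whose summand ℂᵏ is that very subspace.
Curvature computations at an arbitrary point thereby become computations at the origin. -/
theorem chartAt_self (q : Gr Φ) : (grassCharted Φ).chartAt q q = 0 := by
  refine graph_injective (centered Φ q) ?_
  rw [graph_centered_zero]
  exact graph_graphChart Φ _ ((grassCharted Φ).mem_chart_source q)

end

end Grass

/-! ### Analyticity of the coordinate changes -/

namespace Grass

open Filter

section

variable {k : ℕ} {F : Type} [NormedAddCommGroup F] [InnerProductSpace ℂ F]

theorem contDiff_graphCLM (Ψ : Splitting k F) {n : WithTop ℕ∞} : ContDiff ℂ n (graphCLM Ψ) :=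
  contDiff_const.add (contDiff_const.clm_comp contDiff_id)

theorem isUnit_fst_graphCLM {Ψ Ψ' : Splitting k F} {T T' : Model k F}
    (h : graph Ψ' T' = graph Ψ T) : IsUnit (fst Ψ' ∘L graphCLM Ψ T) := by
  refine isUnit_of_injective fun x hx => graphMap_injective Ψ T ?_
  have h1 : graphMap Ψ T x ∈ (graph Ψ' T').1 := h ▸ ⟨x, rfl⟩
  have h2 : fst Ψ' (graphMap Ψ T x) = 0 := by rw [← graphCLM_apply]; exact hx
  rw [mem_graph_iff, h2, map_zero] at h1
  rw [← inl_fst_add_inr_snd Ψ' (graphMap Ψ T x), h1, h2, map_zero, map_zero, map_zero, add_zero]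

/-- Both graphs are the same subspace, so on the vectors parametrized by `T` the second
`Ψ'`-component is `T'` of the first. The first component is an invertible function of the parameter,
which gives a fractional linear formula. -/
theorem eq_transition {Ψ Ψ' : Splitting k F} {T T' : Model k F}
    (h : graph Ψ' T' = graph Ψ T) :
    T' = (snd Ψ' ∘L graphCLM Ψ T) ∘L Ring.inverse (fst Ψ' ∘L graphCLM Ψ T) := by
  obtain ⟨c, hc⟩ := isUnit_fst_graphCLM h
  have h1 : snd Ψ' ∘L graphCLM Ψ T = T' ∘L (c : Model k (EuclideanSpace ℂ (Fin k))) := by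
    ext1 x
    have : graphMap Ψ T x ∈ (graph Ψ' T').1 := h ▸ ⟨x, rfl⟩
    rw [mem_graph_iff, ← graphCLM_apply] at this
    rw [hc]
    exact this
  rw [h1, ← hc, Ring.inverse_unit]
  ext1 x
  exact congrArg (fun A : Model k (EuclideanSpace ℂ (Fin k)) => T' (A x)) c.mul_inv.symm

variable [CompleteSpace F] (Φ : Splitting k F)

theorem graph_chart {Ψ : Splitting k F} {e : OpenPartialHomeomorph (Gr Φ) (Model k F)}
    (he : ∀ T, taut Φ (e.symm T) = graph Ψ T) {q : Gr Φ} (hq : q ∈ e.source) :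
    graph Ψ (e q) = taut Φ q := by
  rw [← he, e.left_inv hq]

/-- Changes of graph coordinates are analytic. -/
theorem contDiffAt_transition {e e' : OpenPartialHomeomorph (Gr Φ) (Model k F)}
    (he : e ∈ (grassCharted Φ).atlas) (he' : e' ∈ (grassCharted Φ).atlas) {z : Model k F}
    (hz : e.symm z ∈ e'.source) {n : WithTop ℕ∞} :
    ContDiffAt ℂ n (fun z => e' (e.symm z)) z := by
  obtain ⟨Ψ, ht, he⟩ := he
  obtain ⟨Ψ', -, he'⟩ := he'
  have hopen : IsOpen {z | e.symm z ∈ e'.source} := by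
    have := (e.symm.trans e').open_source
    rwa [OpenPartialHomeomorph.trans_source, OpenPartialHomeomorph.symm_source, ht,
      Set.univ_inter] at this
  have hgraph : ∀ z, e.symm z ∈ e'.source → graph Ψ' (e' (e.symm z)) = graph Ψ z := fun z hz => by
    rw [graph_chart Φ he' hz, he]
  have hev : (fun z => e' (e.symm z)) =ᶠ[𝓝 z] fun z =>
      (snd Ψ' ∘L graphCLM Ψ z) ∘L Ring.inverse (fst Ψ' ∘L graphCLM Ψ z) := by
    filter_upwards [hopen.mem_nhds hz] with z hz using eq_transition (hgraph z hz)
  refine ContDiffAt.congr_of_eventuallyEq ?_ hev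
  obtain ⟨c, hc⟩ := isUnit_fst_graphCLM (hgraph z hz)
  have hI : ContDiffAt ℂ n (fun z => Ring.inverse (fst Ψ' ∘L graphCLM Ψ z)) z := by
    refine ContDiffAt.comp (g := Ring.inverse) z ?_
      (contDiff_const.clm_comp (contDiff_graphCLM Ψ)).contDiffAt
    rw [← hc]
    exact contDiffAt_ringInverse ℂ c
  exact (contDiff_const.clm_comp (contDiff_graphCLM Ψ)).contDiffAt.clm_comp hI

instance isManifold_gr : IsManifold 𝓘(ℂ, Model k F) ω (Gr Φ) := by
  refine isManifold_of_contDiffOn _ _ _ fun e e' he he' z hz => ?_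
  simp only [modelWithCornersSelf_coe, modelWithCornersSelf_coe_symm, Set.preimage_id,
    Set.range_id, Set.inter_univ, OpenPartialHomeomorph.trans_source] at hz
  exact (contDiffAt_transition Φ he he' hz.2).contDiffWithinAt

end

end Grass

/-! ### The metric of the determinant line in graph coordinates -/

namespace Kahler

open Filter Grass

section

variable {k : ℕ} {F : Type} [NormedAddCommGroup F] [InnerProductSpace ℂ F]

/-- The evaluation of `T : ℂᵏ → F` at the `i`-th standard basis vector. -/
noncomputable def evalBasis (k : ℕ) (F : Type) [NormedAddCommGroup F] [InnerProductSpace ℂ F]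
    (i : Fin k) : Model k F →L[ℂ] F :=
  ContinuousLinearMap.apply ℂ F (EuclideanSpace.single i (1 : ℂ))

theorem evalBasis_apply (i : Fin k) (T : Model k F) :
    evalBasis k F i T = T (EuclideanSpace.single i 1) := rfl

theorem eq_sum_single (x : EuclideanSpace ℂ (Fin k)) :
    x = ∑ i, x i • EuclideanSpace.single i (1 : ℂ) := by
  ext j
  simp [Finset.sum_apply, Pi.single_apply]

theorem apply_eq_sum_evalBasis (T : Model k F) (x : EuclideanSpace ℂ (Fin k)) :
    T x = ∑ i, x i • evalBasis k F i T := by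
  conv_lhs => rw [eq_sum_single x, map_sum]
  simp [evalBasis_apply]

theorem exp_potential (T : Model k F) : Real.exp (potential (evalBasis k F) T) =
    (1 + Matrix.gram ℂ fun i => evalBasis k F i T).det.re :=
  Real.exp_log (det_one_add_gram_re_pos _)

/-- The norm of a multivector in the determinant line of a graph. -/
theorem detNormSq_graph {W : FinSubspaces k F} {Ψ : Splitting k F} {T : Model k F}
    (h : graph Ψ T = W) (w : Fin k → W.1) (c : ℂ) :
    detNormSq W (c • exteriorPower.ιMulti ℂ k w) =
      ‖c * (Matrix.of fun l j => Grass.fst Ψ (w j : F) l : Matrix (Fin k) (Fin k) ℂ).det‖ ^ 2 *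
        Real.exp (potential (evalBasis k F) T) := by
  set A : Matrix (Fin k) (Fin k) ℂ := Matrix.of fun l j => Grass.fst Ψ (w j : F) l with hA
  -- The columns of `A` are the coordinates of the vectors `w j` in the graph frame (eᵢ, Teᵢ), whose
  -- own Gram matrix is 1 + ⟨Teᵢ, Teⱼ⟩.
  have hgram : Matrix.gram ℂ w =
      A.conjTranspose * (1 + Matrix.gram ℂ fun i => evalBasis k F i T) * A := by
    ext i j
    have hw : ∀ j, (w j : F) = graphMap Ψ T (Grass.fst Ψ (w j)) := fun j => by
      have : (w j : F) ∈ (graph Ψ T).1 := h ▸ (w j).2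
      obtain ⟨x, hx⟩ := this
      rw [← hx, fst_graphMap]
    have h1 : Matrix.gram ℂ w i j = ⟪Grass.fst Ψ (w i : F), Grass.fst Ψ (w j : F)⟫_ℂ +
        ⟪T (Grass.fst Ψ (w i : F)), T (Grass.fst Ψ (w j : F))⟫_ℂ := by
      rw [← inner_graphMap, ← hw, ← hw]; rfl
    rw [h1, mul_add, add_mul, Matrix.add_apply, mul_one]
    congr 1
    · simp [Matrix.mul_apply, PiLp.inner_apply, hA, mul_comm]
    · rw [apply_eq_sum_evalBasis T, apply_eq_sum_evalBasis T]
      simp only [sum_inner, inner_sum, inner_smul_left, inner_smul_right, Matrix.mul_apply,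
        Finset.sum_mul, Finset.mul_sum, Matrix.gram_apply, hA, Matrix.conjTranspose_apply, Matrix.of_apply]
      refine Finset.sum_congr rfl fun l _ => Finset.sum_congr rfl fun m _ => ?_
      simp only [RCLike.star_def]
      ring
  have h2 := detNormSq_ιMulti W w
  rw [hgram, Matrix.det_mul, Matrix.det_mul, Matrix.det_conjTranspose, mul_right_comm] at h2
  have h3 : star A.det * A.det = ((‖A.det‖ ^ 2 : ℝ) : ℂ) := by
    push_cast
    exact Complex.conj_mul' _
  rw [h3] at h2
  have h4 := congrArg Complex.re h2
  rw [Complex.ofReal_re, Complex.re_ofReal_mul, ← exp_potential] at h4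
  have h5 : ∀ ξ, detNormSq W (c • ξ) = ‖c‖ ^ 2 * detNormSq W ξ := fun ξ => by
    rw [detNormSq, detNormSq, map_smul, norm_smul, mul_pow]
  rw [h5, h4, norm_mul, mul_pow, mul_assoc]

end

end Kahler

/-! ### The curvature form and its independence of the section -/

namespace Kahler

open Filter Grass

section

variable {E : Type} [NormedAddCommGroup E] [NormedSpace ℂ E]
  {X : Type} [TopologicalSpace X] [ChartedSpace E X]

/-- The tangent space at a point is the model space read in the preferred chart there, so the
derivative of an inverse chart is the derivative of a coordinate change. -/
theorem mfderiv_chart_symm {e : OpenPartialHomeomorph X E} {y : E}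
    (h : MDifferentiableAt 𝓘(ℂ, E) 𝓘(ℂ, E) e.symm y) :
    (mfderiv 𝓘(ℂ, E) 𝓘(ℂ, E) e.symm y : E →L[ℂ] E) =
      fderiv ℂ (fun z => chartAt E (e.symm y) (e.symm z)) y := by
  refine h.mfderiv.trans ?_
  simp only [mfld_simps, fderivWithin_univ]
  rfl

/-- The imaginary part of a complex two-form. -/
noncomputable def imPart (Θ : TwoForm E X ℂ) : TwoForm E X ℝ := fun p =>
  Complex.imCLM.compContinuousAlternatingMap (Θ p)

theorem inChart_imPart (Θ : TwoForm E X ℂ) (e : OpenPartialHomeomorph X E) :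
    inChart (imPart Θ) e =
      fun y => Complex.imCLM.compContinuousAlternatingMap (inChart Θ e y) := rfl

theorem extDeriv_im {E : Type} [NormedAddCommGroup E] [NormedSpace ℝ E] {n : ℕ}
    {Ω : E → E [⋀^Fin n]→L[ℝ] ℂ} {y : E} (h : DifferentiableAt ℝ Ω y) :
    extDeriv (fun y => Complex.imCLM.compContinuousAlternatingMap (Ω y)) y =
      Complex.imCLM.compContinuousAlternatingMap (extDeriv Ω y) := by
  have h1 : HasFDerivAt (fun y => Complex.imCLM.compContinuousAlternatingMap (Ω y))
      (ContinuousLinearMap.compContinuousAlternatingMapCLM ℝ E ℂ ℝ (Fin n) Complex.imCLM ∘L fderiv ℝ Ω y)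
      y :=
    (ContinuousLinearMap.compContinuousAlternatingMapCLM ℝ E ℂ ℝ (Fin n)
      Complex.imCLM).hasFDerivAt.comp y h.hasFDerivAt
  ext v
  rw [extDeriv, h1.fderiv, ContinuousAlternatingMap.alternatizeUncurryFin_apply]
  change _ = Complex.imCLM (extDeriv Ω y v)
  rw [extDeriv, ContinuousAlternatingMap.alternatizeUncurryFin_apply, map_sum]
  refine Finset.sum_congr rfl fun i _ => ?_
  rw [map_zsmul]
  rfl

end

section

variable {k : ℕ} {F : Type} [NormedAddCommGroup F] [InnerProductSpace ℂ F] [CompleteSpace F]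
  (Φ : Splitting k F)

/-- The curvature of the determinant line bundle of the tautological bundle. -/
noncomputable def grassCurvature : TwoForm (Model k F) (Gr Φ) ℂ := fun _ =>
  extDeriv (del (potential (evalBasis k F))) (0 : Model k F)

/-- Tangent vectors at `p` are read in the chart centred at `p`; this is why one constant
alternating form, the Levi form of the potential at the origin, describes the curvature at every
point. -/
theorem grassCurvature_apply (p : Gr Φ) (u v : Model k F) :
    grassCurvature Φ p ![u, v] =
      Complex.I * ((2 * ∑ i, (⟪evalBasis k F i u, evalBasis k F i v⟫_ℂ).im : ℝ) : ℂ) :=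
  extDeriv_del_potential_zero _ u v

theorem inChart_grassCurvature {e : OpenPartialHomeomorph (Gr Φ) (Model k F)}
    (he : e ∈ atlas (Model k F) (Gr Φ)) {y : Model k F} (hy : y ∈ e.target) :
    inChart (grassCurvature Φ) e y =
      (extDeriv (del (potential (evalBasis k F))) (0 : Model k F)).compContinuousLinearMap
        ((fderiv ℂ (fun z => chartAt (Model k F) (e.symm y) (e.symm z)) y).restrictScalars ℝ) := by
  rw [← mfderiv_chart_symm (mdifferentiableAt_atlas_symm he hy)]
  rfl

/-- A holomorphic function on the Grassmannian is holomorphic in graph coordinates. -/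
theorem differentiableAt_comp_symm {G : Type} [NormedAddCommGroup G] [NormedSpace ℂ G]
    {f : Gr Φ → G} {U : Set (Gr Φ)} (hU : IsOpen U)
    (hf : MDifferentiableOn 𝓘(ℂ, Model k F) 𝓘(ℂ, G) f U)
    {e : OpenPartialHomeomorph (Gr Φ) (Model k F)} (he : e ∈ atlas (Model k F) (Gr Φ))
    {z : Model k F} (hz : z ∈ e.target) (hzU : e.symm z ∈ U) :
    DifferentiableAt ℂ (fun z => f (e.symm z)) z :=
  mdifferentiableAt_iff_differentiableAt.1
    (((hf _ hzU).mdifferentiableAt (hU.mem_nhds hzU)).comp z (mdifferentiableAt_atlas_symm he hz))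

theorem detNormSq_smul_ιMulti_ne_zero {k : ℕ} {F : Type} [NormedAddCommGroup F]
    [InnerProductSpace ℂ F] {W : FinSubspaces k F} {w : Fin k → W.1} {c : ℂ} (hc : c ≠ 0)
    (hw : LinearIndependent ℂ w) : detNormSq W (c • exteriorPower.ιMulti ℂ k w) ≠ 0 := by
  have h1 : detNormSq W (exteriorPower.ιMulti ℂ k w) ≠ 0 := by
    rw [← Complex.ofReal_ne_zero, detNormSq_ιMulti]
    exact Matrix.det_gram_ne_zero_iff_linearIndependent.2 hw
  rw [detNormSq, map_smul, norm_smul, mul_pow]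
  exact mul_ne_zero (by positivity) h1

theorem differentiable_det (k : ℕ) : Differentiable ℂ fun M : Fin k → Fin k → ℂ =>
    (Matrix.of M : Matrix (Fin k) (Fin k) ℂ).det := by
  refine ContDiff.differentiable (n := 1) ?_ one_ne_zero
  simp only [Matrix.det_apply, Matrix.of_apply]
  exact ContDiff.sum fun σ _ => ContDiff.const_smul _
    (contDiff_prod fun i _ => contDiff_apply_apply _ _ _ _)

/-- The curvature formula for an arbitrary nowhere vanishing holomorphic section. -/
theorem curvature_eq {U : Set (Gr Φ)} {s : ∀ p, DetLine (taut Φ p)}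
    (hs : IsHolomorphicDetSection (Model k F) (taut Φ) U s) (hs0 : ∀ q ∈ U, s q ≠ 0)
    {e : OpenPartialHomeomorph (Gr Φ) (Model k F)} (he : e ∈ atlas (Model k F) (Gr Φ))
    {y : Model k F} (hy : y ∈ e.target) (hyU : e.symm y ∈ U) :
    inChart (grassCurvature Φ) e y =
      extDeriv (del fun z => Real.log (detNormSq _ (s (e.symm z)))) y := by
  obtain ⟨U', hU', hyU', hsub, w, φ, hw, hli, hφ, hsw⟩ := hs _ hyU
  set Ψ := centered Φ (e.symm y) with hΨ
  set c := chartAt (Model k F) (e.symm y) with hc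
  have hcat : c ∈ atlas (Model k F) (Gr Φ) := chart_mem_atlas _ _
  have hcΨ : ∀ q ∈ c.source, graph Ψ (c q) = taut Φ q := fun q hq => graph_graphChart Φ Ψ hq
  have hys : e.symm y ∈ c.source := mem_chart_source _ _
  have hgood : ∀ᶠ z in 𝓝 y, z ∈ e.target ∧ e.symm z ∈ U' ∧ e.symm z ∈ c.source := by
    refine Eventually.and (e.open_target.mem_nhds hy) (Eventually.and ?_ ?_)
    · exact (e.symm.continuousAt hy).preimage_mem_nhds (hU'.mem_nhds hyU')
    · exact (e.symm.continuousAt hy).preimage_mem_nhds (c.open_source.mem_nhds hys)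
  -- The section is φ · det A times the wedge of the graph frame of the centred chart, so its
  -- squared norm is |h|² times the exponential of the potential in that chart.
  let A : Model k F → Matrix (Fin k) (Fin k) ℂ := fun z =>
    Matrix.of fun l j => Grass.fst Ψ (w (e.symm z) j : F) l
  let h : Model k F → ℂ := fun z => φ (e.symm z) * (A z).det
  have hnorm : ∀ z, e.symm z ∈ U' → e.symm z ∈ c.source →
      detNormSq _ (s (e.symm z)) =
        ‖h z‖ ^ 2 * Real.exp (potential (evalBasis k F) (c (e.symm z))) := fun z hz hz' => by
    rw [hsw _ hz, detNormSq_graph (hcΨ _ hz')]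
  have hd : ∀ᶠ z in 𝓝 y, DifferentiableAt ℂ h z := by
    filter_upwards [hgood] with z hz
    have h1 : DifferentiableAt ℂ (fun z => φ (e.symm z)) z :=
      differentiableAt_comp_symm Φ hU' hφ he hz.1 hz.2.1
    have h2 : ∀ l j, DifferentiableAt ℂ (fun z => A z l j) z := fun l j =>
      (EuclideanSpace.proj l ∘L Grass.fst Ψ).differentiableAt.comp z
        (differentiableAt_comp_symm Φ hU' (hw j) he hz.1 hz.2.1)
    refine h1.mul ?_
    have h3 : DifferentiableAt ℂ (fun z => (fun l j => A z l j : Fin k → Fin k → ℂ)) z :=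
      differentiableAt_pi.2 fun l => differentiableAt_pi.2 fun j => h2 l j
    have h4 := (differentiable_det k (fun l j => A z l j)).comp z h3
    exact h4
  have hnz : ∀ z, e.symm z ∈ U' → e.symm z ∈ c.source → h z ≠ 0 := fun z hz hz' h0 => by
    have h1 := hnorm z hz hz'
    rw [h0, norm_zero, hsw _ hz] at h1
    have hφ0 : φ (e.symm z) ≠ 0 := fun h2 => hs0 _ (hsub hz) (by rw [hsw _ hz, h2, zero_smul])
    exact detNormSq_smul_ιMulti_ne_zero hφ0 (hli _ hz) (by simpa using h1)
  have hy0 : h y ≠ 0 := hnz y hyU' hys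
  -- Normalizing by the value at `y` puts the quotient near 1, where the principal logarithm is
  -- holomorphic; the normalization only adds the constant 2 log ‖h y‖.
  have hlog : ∀ᶠ z in 𝓝 y, h z / h y ∈ Complex.slitPlane := by
    refine ContinuousAt.eventually_mem (hd.self_of_nhds.continuousAt.div_const _) ?_
    rw [div_self hy0]
    exact Complex.isOpen_slitPlane.mem_nhds Complex.one_mem_slitPlane
  rw [inChart_grassCurvature Φ he hy]
  have hcy : c (e.symm y) = 0 := chartAt_self Φ _
  rw [extDeriv_del_comp_add_re (K := potential (evalBasis k F))
    (g := fun z => c (e.symm z)) (H := fun z => 2 * Complex.log (h z / h y))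
    (c := 2 * Real.log ‖h y‖) (contDiff_potential _)
    (contDiffAt_transition Φ he hcat hys), hcy]
  · filter_upwards [hd, hlog] with z hz hz'
    exact (DifferentiableAt.clog (f := fun z => h z / h y) (hz.mul_const (h y)⁻¹) hz').const_mul 2
  · filter_upwards [hgood] with z hz
    have hz0 := hnz z hz.2.1 hz.2.2
    have hpos : 0 < ‖h z‖ := norm_pos_iff.2 hz0
    have hpos' : 0 < ‖h y‖ := norm_pos_iff.2 hy0
    rw [hnorm z hz.2.1 hz.2.2, Real.log_mul (by positivity) (Real.exp_pos _).ne', Real.log_exp,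
      Real.log_pow, Complex.mul_re]
    simp only [Complex.re_ofNat, Complex.im_ofNat, zero_mul, sub_zero, Complex.log_re, norm_div]
    rw [Real.log_div hpos.ne' hpos'.ne']
    push_cast
    ring

end

end Kahler

/-! ### The Kähler form on the Grassmannian -/

namespace Kahler

open Filter Grass

section

variable {E : Type} [NormedAddCommGroup E] [NormedSpace ℂ E]

theorem contDiff_im {Ω : E → E [⋀^Fin 2]→L[ℝ] ℂ} {n : WithTop ℕ∞} (h : ContDiff ℝ n Ω) :
    ContDiff ℝ n fun y => Complex.imCLM.compContinuousAlternatingMap (Ω y) :=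
  (ContinuousLinearMap.compContinuousAlternatingMapCLM ℝ E ℂ ℝ (Fin 2)
    Complex.imCLM).contDiff.comp h

theorem extDeriv_im_extDeriv_del {f : E → ℝ} (hf : ContDiff ℝ ∞ f) (y : E) :
    extDeriv (fun y => Complex.imCLM.compContinuousAlternatingMap (extDeriv (del f) y)) y = 0 := by
  have h1 : ContDiff ℝ 2 (del f) :=
    (delCLM E).contDiff.comp ((hf.fderiv_right (m := ∞) le_rfl).of_le ENat.LEInfty.out)
  rw [extDeriv_im ((contDiff_extDeriv_del hf).contDiffAt.differentiableAt (by simp)),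
    extDeriv_extDeriv h1 (by simp)]
  ext v
  simp

end

section

variable {k : ℕ} {F : Type} [NormedAddCommGroup F] [InnerProductSpace ℂ F]

/-- By Cauchy–Schwarz the operator norm is at most the Hilbert–Schmidt norm. This gives the lower
bound that makes the Kähler metric define the topology of the tangent spaces. -/
theorem norm_sq_le_sum_evalBasis (T : Model k F) : ‖T‖ ^ 2 ≤ ∑ i, ‖evalBasis k F i T‖ ^ 2 := by
  have h0 : 0 ≤ ∑ i, ‖evalBasis k F i T‖ ^ 2 := Finset.sum_nonneg fun i _ => sq_nonneg _
  refine (Real.le_sqrt (norm_nonneg _) h0).1 (T.opNorm_le_bound (Real.sqrt_nonneg _) fun x => ?_)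
  rw [EuclideanSpace.norm_eq, apply_eq_sum_evalBasis, mul_comm]
  refine (norm_sum_le _ _).trans ?_
  simp only [norm_smul]
  exact Real.sum_mul_le_sqrt_mul_sqrt _ _ _

theorem im_inner_I_smul (i : Fin k) (u v : Model k F) :
    (⟪evalBasis k F i (Complex.I • u), evalBasis k F i (Complex.I • v)⟫_ℂ).im =
      (⟪evalBasis k F i u, evalBasis k F i v⟫_ℂ).im := by
  rw [map_smul, map_smul, inner_smul_left, inner_smul_right, ← mul_assoc]
  simp

variable [CompleteSpace F] (Φ : Splitting k F)

theorem imPart_grassCurvature_apply (p : Gr Φ) (u v : Model k F) :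
    imPart (grassCurvature Φ) p ![u, v] =
      2 * ∑ i, (⟪evalBasis k F i u, evalBasis k F i v⟫_ℂ).im := by
  refine (congrArg Complex.im (grassCurvature_apply Φ p u v)).trans ?_
  rw [Complex.I_mul_im, Complex.ofReal_re]

theorem grassCurvature_eq_I_mul (p : Gr Φ) (u v : Model k F) :
    grassCurvature Φ p ![u, v] = Complex.I * (imPart (grassCurvature Φ) p ![u, v] : ℂ) := by
  rw [grassCurvature_apply]
  exact congrArg (fun r : ℝ => Complex.I * (r : ℂ)) (imPart_grassCurvature_apply Φ p u v).symm

end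

section

variable {k : ℕ} {F : Type} [NormedAddCommGroup F] [InnerProductSpace ℂ F] [CompleteSpace F]
  (Φ : Splitting k F)

open Classical in
/-- The frame of the tautological bundle given by graph coordinates. -/
noncomputable def graphFrame (Ψ : Splitting k F) (e : OpenPartialHomeomorph (Gr Φ) (Model k F))
    (he : ∀ T, taut Φ (e.symm T) = graph Ψ T) (q : Gr Φ) (i : Fin k) : (taut Φ q).1 :=
  if h : q ∈ e.source then
    ⟨graphMap Ψ (e q) (EuclideanSpace.single i 1), graph_chart Φ he h ▸ ⟨_, rfl⟩⟩
  else 0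

variable {Φ} {Ψ : Splitting k F} {e : OpenPartialHomeomorph (Gr Φ) (Model k F)}
  (he : ∀ T, taut Φ (e.symm T) = graph Ψ T)

theorem coe_graphFrame {q : Gr Φ} (hq : q ∈ e.source) (i : Fin k) :
    (graphFrame Φ Ψ e he q i : F) = graphMap Ψ (e q) (EuclideanSpace.single i 1) := by
  rw [graphFrame, dif_pos hq]

theorem linearIndependent_graphFrame {q : Gr Φ} (hq : q ∈ e.source) :
    LinearIndependent ℂ (graphFrame Φ Ψ e he q) := by
  refine LinearIndependent.of_comp (taut Φ q).1.subtype ?_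
  have h1 : (taut Φ q).1.subtype ∘ graphFrame Φ Ψ e he q =
      graphMap Ψ (e q) ∘ (EuclideanSpace.basisFun (Fin k) ℂ).toBasis := by
    ext i
    simp [coe_graphFrame he hq]
  rw [h1]
  exact (EuclideanSpace.basisFun (Fin k) ℂ).toBasis.linearIndependent.map' _
    (LinearMap.ker_eq_bot.2 (graphMap_injective Ψ _))

theorem isHolomorphicDetSection_graphFrame (hat : e ∈ atlas (Model k F) (Gr Φ)) :
    IsHolomorphicDetSection (Model k F) (taut Φ) e.source
      fun q => exteriorPower.ιMulti ℂ k (graphFrame Φ Ψ e he q) := by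
  intro p hp
  refine ⟨e.source, e.open_source, hp, subset_rfl, graphFrame Φ Ψ e he, fun _ => 1, fun i => ?_,
    fun q hq => linearIndependent_graphFrame he hq, mdifferentiableOn_const,
    fun q _ => (one_smul _ _).symm⟩
  have h1 : Differentiable ℂ fun T : Model k F => graphCLM Ψ T (EuclideanSpace.single i (1 : ℂ)) :=
    ((contDiff_graphCLM Ψ (n := 1)).clm_apply contDiff_const).differentiable one_ne_zero
  have h2 : MDifferentiableOn 𝓘(ℂ, Model k F) 𝓘(ℂ, F)
      (fun q => graphCLM Ψ (e q) (EuclideanSpace.single i (1 : ℂ))) e.source := fun q hq =>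
    MDifferentiableAt.comp_mdifferentiableWithinAt
      (g := fun T : Model k F => graphCLM Ψ T (EuclideanSpace.single i (1 : ℂ))) q
      (h1 (e q)).mdifferentiableAt (mdifferentiableOn_atlas hat q hq)
  refine h2.congr fun q hq => ?_
  rw [coe_graphFrame he hq, graphCLM_apply]

/-- The coordinate matrix of the graph frame is the identity, so no holomorphic factor appears and
the potential itself is the logarithm of the metric on the whole chart. -/
theorem log_detNormSq_graphFrame (ht : e.target = Set.univ) (z : Model k F) :
    Real.log (detNormSq _ (exteriorPower.ιMulti ℂ k (graphFrame Φ Ψ e he (e.symm z)))) =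
      potential (evalBasis k F) z := by
  have hz : z ∈ e.target := ht ▸ Set.mem_univ z
  have hs := e.map_target hz
  have h1 : (Matrix.of fun l j => Grass.fst Ψ (graphFrame Φ Ψ e he (e.symm z) j : F) l :
      Matrix (Fin k) (Fin k) ℂ) = 1 := by
    ext l j
    rw [Matrix.of_apply, coe_graphFrame he hs, fst_graphMap]
    simp [Matrix.one_apply]
  rw [← one_smul ℂ (exteriorPower.ιMulti ℂ k _), detNormSq_graph (graph_chart Φ he hs), h1,
    Matrix.det_one, e.right_inv hz]
  simp

variable (Φ)

theorem isDetCurvature_grassCurvature : IsDetCurvature (taut Φ) (grassCurvature Φ) where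
  exists_section p := by
    have he : ∀ T, taut Φ ((graphChart Φ (centered Φ p)).symm T) = graph (centered Φ p) T :=
      fun T => taut_point Φ _
    refine ⟨_, _, (graphChart Φ (centered Φ p)).open_source, mem_chart_source (Model k F) p,
      isHolomorphicDetSection_graphFrame he (chart_mem_atlas _ p), fun q hq h0 => ?_⟩
    refine detNormSq_smul_ιMulti_ne_zero one_ne_zero (linearIndependent_graphFrame he hq) ?_
    rw [one_smul, h0]
    simp [detNormSq]
  eq_curvature U s _ hs hs0 e he y hy hyU := curvature_eq Φ hs hs0 he hy hyU

/-- The curvature formula applied to the frame of `e` itself. The form, defined pointwise through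
centred charts, thus has the global expression d∂K in every chart, from which smoothness and
closedness follow. -/
theorem inChart_grassCurvature_eq (hat : e ∈ atlas (Model k F) (Gr Φ)) :
    inChart (grassCurvature Φ) e = extDeriv (del (potential (evalBasis k F))) := by
  obtain ⟨Ψ, ht, he⟩ := id hat
  ext1 y
  have hy : y ∈ e.target := ht ▸ Set.mem_univ y
  rw [curvature_eq Φ (isHolomorphicDetSection_graphFrame he hat) (fun q hq h0 => ?_) hat hy
    (e.map_target hy)]
  · congr 2
    ext1 z
    exact log_detNormSq_graphFrame he ht z
  · refine detNormSq_smul_ιMulti_ne_zero one_ne_zero (linearIndependent_graphFrame he hq) ?_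
    rw [one_smul, h0]
    simp [detNormSq]

theorem isKahlerForm_grass : IsKahlerForm (imPart (grassCurvature Φ)) where
  smooth e he := by
    rw [inChart_imPart, inChart_grassCurvature_eq Φ he]
    exact (contDiff_im (contDiff_extDeriv_del (contDiff_potential _))).contDiffOn
  closed e he y _ := by
    rw [inChart_imPart, inChart_grassCurvature_eq Φ he]
    exact extDeriv_im_extDeriv_del (contDiff_potential _) y
  invariant p u v := by
    refine (imPart_grassCurvature_apply Φ p _ _).trans
      (Eq.trans ?_ (imPart_grassCurvature_apply Φ p u v).symm)
    exact congrArg (2 * ·) (Finset.sum_congr rfl fun i _ => im_inner_I_smul i u v)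
  positive p := by
    -- The form evaluated on (u, iu) is exactly 2 ∑ ‖u eᵢ‖².
    refine ⟨2, two_pos, fun u => ?_⟩
    refine le_of_le_of_eq ?_ (imPart_grassCurvature_apply Φ p u (Complex.I • u)).symm
    refine mul_le_mul_of_nonneg_left ((norm_sq_le_sum_evalBasis u).trans_eq ?_) zero_le_two
    refine Finset.sum_congr rfl fun i _ => ?_
    rw [map_smul, inner_smul_right, inner_self_eq_norm_sq_to_K]
    simp [← Complex.ofReal_pow]

end

end Kahler

/-! ### Transport of complex and Kähler structures along a homeomorphism -/

namespace Kahler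

open Filter

section

variable {E : Type} [NormedAddCommGroup E] [NormedSpace ℂ E]
  {X Y : Type} [TopologicalSpace X] [TopologicalSpace Y] [ChartedSpace E Y] (h : X ≃ₜ Y)

/-- The charts of a manifold `Y` pulled back along a homeomorphism `h : X ≃ₜ Y`. -/
abbrev pullbackCharted : ChartedSpace E X where
  atlas := {e | ∃ e' ∈ atlas E Y, h.transOpenPartialHomeomorph e' = e}
  chartAt x := h.transOpenPartialHomeomorph (chartAt E (h x))
  mem_chart_source x := mem_chart_source E (h x)
  chart_mem_atlas x := ⟨_, chart_mem_atlas E (h x), rfl⟩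

/-- The pullback of a two-form along a homeomorphism `h`, with respect to the pulled back charts. -/
noncomputable def pullbackForm {G : Type} [NormedAddCommGroup G] [NormedSpace ℝ G]
    (κ : TwoForm E Y G) : letI := pullbackCharted (E := E) h; TwoForm E X G :=
  fun x => κ (h x)

/-- Read in the charts at x and at h(x), the homeomorphism is the identity near the base point. The
same observation gives holomorphy of the inverse and the derivative. -/
theorem contMDiff_pullback :
    letI := pullbackCharted (E := E) h; ContMDiff 𝓘(ℂ, E) 𝓘(ℂ, E) ω h := by
  let := pullbackCharted (E := E) h
  intro x
  refine contMDiffAt_iff.2 ⟨h.continuous.continuousAt, ?_⟩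
  refine (contDiffAt_id.congr_of_eventuallyEq ?_).contDiffWithinAt
  filter_upwards [(chartAt E (h x)).open_target.mem_nhds (mem_chart_target E (h x))] with z hz
  change chartAt E (h x) (h (h.symm ((chartAt E (h x)).symm z))) = z
  rw [h.apply_symm_apply, (chartAt E (h x)).right_inv hz]

theorem contMDiff_pullback_symm :
    letI := pullbackCharted (E := E) h; ContMDiff 𝓘(ℂ, E) 𝓘(ℂ, E) ω h.symm := by
  let := pullbackCharted (E := E) h
  intro y
  refine contMDiffAt_iff.2 ⟨h.symm.continuous.continuousAt, ?_⟩
  refine (contDiffAt_id.congr_of_eventuallyEq ?_).contDiffWithinAt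
  filter_upwards [(chartAt E y).open_target.mem_nhds (mem_chart_target E y)] with z hz
  change chartAt E (h (h.symm y)) (h (h.symm ((chartAt E y).symm z))) = z
  rw [h.apply_symm_apply, h.apply_symm_apply, (chartAt E y).right_inv hz]

/-- A homeomorphism is biholomorphic for the pulled back charts. -/
noncomputable def pullbackDiffeomorph :
    letI := pullbackCharted (E := E) h; Diffeomorph 𝓘(ℂ, E) 𝓘(ℂ, E) X Y ω :=
  let := pullbackCharted (E := E) h
  { toEquiv := h.toEquiv
    contMDiff_toFun := contMDiff_pullback h
    contMDiff_invFun := contMDiff_pullback_symm h }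

theorem mfderiv_pullback (x : X) : letI := pullbackCharted (E := E) h
    (mfderiv 𝓘(ℂ, E) 𝓘(ℂ, E) h x : E →L[ℂ] E) = ContinuousLinearMap.id ℂ E := by
  let := pullbackCharted (E := E) h
  refine ((contMDiff_pullback h).mdifferentiable (by simp) x).mfderiv.trans ?_
  rw [modelWithCornersSelf_coe, Set.range_id, fderivWithin_univ]
  refine (EventuallyEq.fderiv_eq ?_).trans (fderiv_id (𝕜 := ℂ))
  filter_upwards [(chartAt E (h x)).open_target.mem_nhds (mem_chart_target E (h x))] with z hz
  change chartAt E (h x) (h (h.symm ((chartAt E (h x)).symm z))) = z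
  rw [h.apply_symm_apply, (chartAt E (h x)).right_inv hz]

variable [IsManifold 𝓘(ℂ, E) ω Y]

theorem isManifold_pullbackCharted :
    letI := pullbackCharted (E := E) h; IsManifold 𝓘(ℂ, E) ω X := by
  let := pullbackCharted (E := E) h
  refine isManifold_of_contDiffOn _ _ _ ?_
  rintro _ _ ⟨e, he, rfl⟩ ⟨e', he', rfl⟩
  have h1 := ((contDiffGroupoid ω 𝓘(ℂ, E)).compatible he he')
  rw [contDiffGroupoid, mem_groupoid_of_pregroupoid] at h1
  have h2 : (h.transOpenPartialHomeomorph e).symm.trans (h.transOpenPartialHomeomorph e') =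
      e.symm.trans e' := by
    ext z <;> simp
  rw [h2]
  exact h1.1

/-- Pulled back charts have the same coordinate changes as the original ones, so the two inverse
charts have the same derivative and the forms the same local expression. -/
theorem inChart_pullbackForm {G : Type} [NormedAddCommGroup G] [NormedSpace ℝ G]
    (κ : TwoForm E Y G) {e : OpenPartialHomeomorph Y E} (he : e ∈ atlas E Y) {y : E}
    (hy : y ∈ e.target) : letI := pullbackCharted (E := E) h
    inChart (pullbackForm h κ) (h.transOpenPartialHomeomorph e) y = inChart κ e y := by
  let := pullbackCharted (E := E) h
  have := isManifold_pullbackCharted (E := E) h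
  let K : Y → E [⋀^Fin 2]→L[ℝ] G := κ
  have h1 := mfderiv_chart_symm (mdifferentiableAt_atlas_symm he hy)
  have he' : h.transOpenPartialHomeomorph e ∈ atlas E X := ⟨e, he, rfl⟩
  have h2 := mfderiv_chart_symm (mdifferentiableAt_atlas_symm he' hy)
  have h3 : (mfderiv 𝓘(ℂ, E) 𝓘(ℂ, E) (h.transOpenPartialHomeomorph e).symm y : E →L[ℂ] E) =
      mfderiv 𝓘(ℂ, E) 𝓘(ℂ, E) e.symm y := by
    refine h2.trans (Eq.trans ?_ h1.symm)
    change fderiv ℂ (fun z => chartAt E (h (h.symm (e.symm y))) (h (h.symm (e.symm z)))) y = _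
    simp only [h.apply_symm_apply]
  change (K (h (h.symm (e.symm y)))).compContinuousLinearMap
    ((mfderiv 𝓘(ℂ, E) 𝓘(ℂ, E) (h.transOpenPartialHomeomorph e).symm y :
      E →L[ℂ] E).restrictScalars ℝ) = _
  rw [h3, h.apply_symm_apply]
  rfl

theorem isKahlerForm_pullbackForm {κ : TwoForm E Y ℝ} (hκ : IsKahlerForm κ) :
    letI := pullbackCharted (E := E) h; IsKahlerForm (pullbackForm h κ) :=
  let := pullbackCharted (E := E) h
  { smooth := by
      rintro _ ⟨e, he, rfl⟩
      exact (hκ.smooth e he).congr fun y hy => inChart_pullbackForm h κ he hy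
    closed := by
      rintro _ ⟨e, he, rfl⟩ y hy
      refine (EventuallyEq.extDeriv_eq ?_).trans (hκ.closed e he y hy)
      filter_upwards [e.open_target.mem_nhds hy] with z hz using inChart_pullbackForm h κ he hz
    invariant := fun p u v => hκ.invariant (h p) u v
    positive := fun p => hκ.positive (h p) }

end

end Kahler

/-! ### Fock space: Hilbert bases, splittings and Schur's lemma -/

namespace Moyal

/-- The number basis as a Hilbert basis of Fock space. -/
noncomputable def fockBasis (n : ℕ) : HilbertBasis (Fin n → ℕ) ℂ (Fock n) :=
  .ofRepr (LinearIsometryEquiv.refl ℂ _)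

theorem coe_fockBasis (n : ℕ) : ⇑(fockBasis n) = numberBasis :=
  funext fun ν => ((fockBasis n).repr_symm_single ν).symm

theorem orthonormal_numberBasis (n : ℕ) :
    Orthonormal ℂ (numberBasis : (Fin n → ℕ) → Fock n) :=
  coe_fockBasis n ▸ (fockBasis n).orthonormal

theorem eq_zero_of_inner_numberBasis {n : ℕ} {x : Fock n} (h : ∀ ν, ⟪numberBasis ν, x⟫_ℂ = 0) :
    x = 0 := by
  refine (fockBasis n).repr.map_eq_zero_iff.1 (lp.ext (funext fun ν => ?_))
  rw [(fockBasis n).repr_apply_apply, coe_fockBasis, h]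
  rfl

theorem infinite_index {n : ℕ} (hn : 1 ≤ n) : Infinite (Fin n → ℕ) :=
  haveI : Nonempty (Fin n) := ⟨⟨0, hn⟩⟩
  inferInstance

/-! ### Splittings of Fock space -/

/-- The standard orthonormal system of `ℂᵏ ⊕ ℱ`. -/
noncomputable def sumBasis (k n : ℕ) :
    Fin k ⊕ (Fin n → ℕ) → WithLp 2 (EuclideanSpace ℂ (Fin k) × Fock n) :=
  Sum.elim (fun i => WithLp.toLp 2 (EuclideanSpace.single i 1, 0))
    fun ν => WithLp.toLp 2 (0, numberBasis ν)

theorem orthonormal_sumBasis (k n : ℕ) : Orthonormal ℂ (sumBasis k n) := by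
  classical
  have h := orthonormal_iff_ite.1 (orthonormal_numberBasis n)
  rw [orthonormal_iff_ite]
  rintro (i | μ) (j | ν)
  · simp [sumBasis, WithLp.prod_inner_apply, EuclideanSpace.inner_single_left]
  · simp [sumBasis, WithLp.prod_inner_apply]
  · simp [sumBasis, WithLp.prod_inner_apply]
  · simp [sumBasis, WithLp.prod_inner_apply, h]

theorem eq_zero_of_inner_sumBasis {k n : ℕ} {z : WithLp 2 (EuclideanSpace ℂ (Fin k) × Fock n)}
    (h : ∀ i, ⟪sumBasis k n i, z⟫_ℂ = 0) : z = 0 := by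
  have h1 : z.fst = 0 := by
    ext i
    simpa [sumBasis, WithLp.prod_inner_apply, EuclideanSpace.inner_single_left] using h (.inl i)
  have h2 : z.snd = 0 := eq_zero_of_inner_numberBasis fun ν => by
    simpa [sumBasis, WithLp.prod_inner_apply] using h (.inr ν)
  exact (WithLp.ofLp_injective 2) (Prod.ext h1 h2)

/-- For n ≥ 1 both ℂᵏ ⊕ ℱ and ℱ have countably infinite orthonormal bases; a bijection of the index
sets gives the unitary. -/
theorem nonempty_splitting {n : ℕ} (hn : 1 ≤ n) (k : ℕ) :
    Nonempty (Grass.Splitting k (Fock n)) := by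
  have := infinite_index hn
  obtain ⟨σ⟩ := nonempty_equiv_of_countable (α := Fin n → ℕ) (β := Fin k ⊕ (Fin n → ℕ))
  refine ⟨(HilbertBasis.mkOfOrthogonalEqBot ((orthonormal_sumBasis k n).comp σ σ.injective)
    ((Submodule.eq_bot_iff _).2 fun z hz => eq_zero_of_inner_sumBasis fun i => ?_)).repr⟩
  have := (Submodule.mem_orthogonal _ _).1 hz _ (Submodule.subset_span ⟨σ.symm i, rfl⟩)
  simpa using this

/-- As k ≥ 1, the rank one operators sending one fixed coordinate to the vectors of the number basis
form an infinite independent family. -/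
theorem not_finiteDimensional_model {n k : ℕ} (hn : 1 ≤ n) (hk : 1 ≤ k) :
    ¬ FiniteDimensional ℂ (Grass.Model k (Fock n)) := by
  intro hfd
  have := infinite_index hn
  let i : Fin k := ⟨0, hk⟩
  let v : (Fin n → ℕ) → Grass.Model k (Fock n) := fun ν =>
    (EuclideanSpace.proj i).smulRight (numberBasis ν)
  have hv : LinearIndependent ℂ v := by
    refine LinearIndependent.of_comp (Kahler.evalBasis k (Fock n) i).toLinearMap ?_
    have h1 : (Kahler.evalBasis k (Fock n) i).toLinearMap ∘ v = numberBasis := by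
      ext1 ν
      simp [v, Kahler.evalBasis_apply]
    rw [h1]
    exact (orthonormal_numberBasis n).linearIndependent
  exact not_finite_iff_infinite.2 this hv.finite_of_isNoetherian

/-! ### Irreducibility of the Fock module -/

theorem incl_single {n : ℕ} (ν : Fin n → ℕ) (c : ℂ) :
    incl n (Finsupp.single ν c) = c • numberBasis ν :=
  Finsupp.linearCombination_single ..

theorem act_eq {n : ℕ} (θ : Fin n → ℝ) (hθ : ∀ j, 0 < θ j) (i : Fin 2 × Fin n) :
    act θ hθ i = coordOp θ i := by
  ext1 u
  rw [act, fockRep, coord, RingQuot.liftAlgHom_mkAlgHom_apply, FreeAlgebra.lift_ι_apply]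

section

variable {n : ℕ} {θ : Fin n → ℝ} {hθ : ∀ j, 0 < θ j} {B : Fock n →L[ℂ] Fock n}

/-- The relations for the coordinates x^{2j-1} and x^{2j} are those for a + a† and -i(a - a†), up to
a nonzero real factor. Conjugation in the first slot turns -i into i, so half the difference and
half the sum isolate the two ladder relations. -/
theorem inner_annih_creat (hB : B ∈ commutant θ hθ) (j : Fin n) (u v : FinFock n) :
    ⟪incl n (creat j u), B (incl n v)⟫_ℂ = ⟪incl n u, B (incl n (annih j v))⟫_ℂ ∧
      ⟪incl n (annih j u), B (incl n v)⟫_ℂ = ⟪incl n u, B (incl n (creat j v))⟫_ℂ := by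
  have h0 := hB (0, j) u v
  have h1 := hB (1, j) u v
  have hs : ((Real.sqrt (θ j / 2) : ℝ) : ℂ) ≠ 0 :=
    Complex.ofReal_ne_zero.2 (Real.sqrt_pos.2 (half_pos (hθ j))).ne'
  rw [act_eq] at h0 h1
  simp only [coordOp, if_true, one_ne_zero, if_false, LinearMap.smul_apply, LinearMap.add_apply,
    LinearMap.sub_apply, map_smul, map_add, map_sub, inner_smul_left, inner_smul_right,
    inner_add_left, inner_add_right, inner_sub_left, inner_sub_right, map_mul, map_neg,
    Complex.conj_I, Complex.conj_ofReal, neg_neg] at h0 h1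
  have h0' := mul_left_cancel₀ hs h0
  have h1' := mul_left_cancel₀ (mul_ne_zero Complex.I_ne_zero hs)
    (h1.trans (by rw [neg_mul, neg_mul, ← mul_neg]))
  constructor
  · linear_combination (h0' - h1') / 2
  · linear_combination (h0' + h1') / 2

/-- The matrix elements of an operator in the commutant are related by the ladder operators. -/
theorem inner_ladder (hB : B ∈ commutant θ hθ) (j : Fin n) (μ ν : Fin n → ℕ) :
    (Real.sqrt (μ j + 1) : ℂ) * ⟪numberBasis (μ + Pi.single j 1), B (numberBasis ν)⟫_ℂ =
        (Real.sqrt (ν j) : ℂ) * ⟪numberBasis μ, B (numberBasis (ν - Pi.single j 1))⟫_ℂ ∧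
      (Real.sqrt (μ j) : ℂ) * ⟪numberBasis (μ - Pi.single j 1), B (numberBasis ν)⟫_ℂ =
        (Real.sqrt (ν j + 1) : ℂ) * ⟪numberBasis μ, B (numberBasis (ν + Pi.single j 1))⟫_ℂ := by
  have h := inner_annih_creat hB j (Finsupp.single μ 1) (Finsupp.single ν 1)
  simpa only [annih, creat, Finsupp.linearCombination_single, incl_single, one_smul, map_smul,
    inner_smul_left, inner_smul_right, Complex.conj_ofReal] using h

theorem sub_single_add {n : ℕ} {ν : Fin n → ℕ} {j : Fin n} (h : ν j ≠ 0) :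
    ν - Pi.single j 1 + Pi.single j 1 = ν := by
  ext l
  by_cases hl : l = j
  · subst hl; simp; omega
  · simp [hl]

/-- The ladder relations lower `μ j` and `ν j` together and keep them different, until one of them
is 0 and the annihilation operator kills that side. -/
theorem inner_eq_zero_of_ne (hB : B ∈ commutant θ hθ) (j : Fin n) {μ ν : Fin n → ℕ}
    (h : μ j ≠ ν j) : ⟪numberBasis μ, B (numberBasis ν)⟫_ℂ = 0 := by
  have hs : ∀ m : ℕ, ((Real.sqrt ((m : ℝ) + 1) : ℝ) : ℂ) ≠ 0 := fun m =>
    Complex.ofReal_ne_zero.2 (Real.sqrt_pos.2 (by positivity)).ne'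
  induction hm : ν j generalizing μ ν with
  | zero =>
    have hμ : μ j ≠ 0 := fun h0 => h (h0.trans hm.symm)
    have h1 := (inner_ladder hB j (μ - Pi.single j 1) ν).1
    rw [sub_single_add hμ, hm, Nat.cast_zero, Real.sqrt_zero, Complex.ofReal_zero, zero_mul] at h1
    exact (mul_eq_zero.1 h1).resolve_left (hs _)
  | succ m ih =>
    have hν : ν j ≠ 0 := by omega
    have h1 := (inner_ladder hB j μ (ν - Pi.single j 1)).2
    rw [sub_single_add hν] at h1
    refine (mul_eq_zero.1 (h1.symm.trans ?_)).resolve_left (hs _)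
    rcases eq_or_ne (μ j) 0 with hμ | hμ
    · rw [hμ, Nat.cast_zero, Real.sqrt_zero, Complex.ofReal_zero, zero_mul]
    · rw [ih _ (by simp [hm]), mul_zero]
      simp only [Pi.sub_apply, Pi.single_eq_same]
      omega

theorem inner_diag (hB : B ∈ commutant θ hθ) (ν : Fin n → ℕ) :
    ⟪numberBasis ν, B (numberBasis ν)⟫_ℂ = ⟪numberBasis 0, B (numberBasis 0)⟫_ℂ := by
  induction ν using WellFoundedLT.induction with
  | ind ν ih =>
    rcases eq_or_ne ν 0 with rfl | h0
    · rfl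
    obtain ⟨j, hj⟩ := Function.ne_iff.1 h0
    have hlt : ν - Pi.single j 1 < ν := by
      refine Pi.lt_def.2 ⟨tsub_le_self, j, ?_⟩
      simp only [Pi.sub_apply, Pi.single_eq_same]
      exact Nat.sub_lt (Nat.pos_of_ne_zero hj) one_pos
    have h1 := (inner_ladder hB j (ν - Pi.single j 1) ν).1
    have h2 : (((ν - Pi.single j 1 : Fin n → ℕ) j : ℕ) : ℝ) + 1 = ν j := by
      simp only [Pi.sub_apply, Pi.single_eq_same]
      rw [Nat.cast_sub (Nat.pos_of_ne_zero hj)]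
      simp
    rw [sub_single_add hj, h2, ih _ hlt] at h1
    exact mul_left_cancel₀ (Complex.ofReal_ne_zero.2 (Real.sqrt_pos.2
      (Nat.cast_pos.2 (Nat.pos_of_ne_zero hj))).ne') h1

/-- Schur's lemma for the Fock module. -/
theorem eq_smul_one (hB : B ∈ commutant θ hθ) :
    B = (⟪numberBasis 0, B (numberBasis 0)⟫_ℂ : ℂ) • (1 : Fock n →L[ℂ] Fock n) := by
  set c : ℂ := ⟪numberBasis 0, B (numberBasis 0)⟫_ℂ with hc
  have h1 : ∀ ν, B (numberBasis ν) = c • numberBasis ν := fun ν => by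
    rw [← sub_eq_zero]
    refine eq_zero_of_inner_numberBasis fun μ => ?_
    rw [inner_sub_right, inner_smul_right]
    by_cases h : μ = ν
    · subst h
      rw [inner_diag hB, ← hc, inner_self_eq_norm_sq_to_K, (orthonormal_numberBasis n).1]
      simp
    · obtain ⟨j, hj⟩ := Function.ne_iff.1 h
      rw [inner_eq_zero_of_ne hB j hj, (orthonormal_numberBasis n).2 h, mul_zero, sub_zero]
  refine ContinuousLinearMap.ext_on (s := Set.range (numberBasis (n := n))) ?_ ?_
  · rw [← coe_fockBasis]
    exact Submodule.dense_iff_topologicalClosure_eq_top.2 (fockBasis n).dense_span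
  · rintro _ ⟨ν, rfl⟩
    exact h1 ν

end

/-- The Fock module is irreducible: every bounded operator is a field. -/
theorem mem_fieldAlgebra {n : ℕ} (θ : Fin n → ℝ) (hθ : ∀ j, 0 < θ j) (φ : Fock n →L[ℂ] Fock n) :
    φ ∈ fieldAlgebra θ hθ := by
  intro B hB
  rw [eq_smul_one hB, smul_mul_assoc, mul_smul_comm, one_mul, mul_one]

end Moyal

/-! ### Solitons as multiples of finite-rank projections -/

namespace Moyal

open Grass

section

variable {H : Type} [NormedAddCommGroup H] [InnerProductSpace ℂ H] {k : ℕ} (W : FinSubspaces k H)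

theorem eigenspace_smul_proj {lam : ℝ} (hlam : lam ≠ 0) :
    Module.End.eigenspace ((lam : ℂ) • proj W).toLinearMap (lam : ℂ) = W.1 := by
  ext x
  rw [Module.End.mem_eigenspace_iff, ← proj_eq_self_iff]
  exact (smul_right_injective H (Complex.ofReal_ne_zero.2 hlam)).eq_iff

theorem eigenspace_smul_proj_eq_bot {lam μ : ℝ} (hμ0 : μ ≠ 0) (hμ : μ ≠ lam) :
    Module.End.eigenspace ((lam : ℂ) • proj W).toLinearMap (μ : ℂ) = ⊥ := by
  refine (Submodule.eq_bot_iff _).2 fun x hx => ?_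
  have h1 : (lam : ℂ) • proj W x = (μ : ℂ) • x := Module.End.mem_eigenspace_iff.1 hx
  have h2 := congrArg (proj W) h1
  rw [map_smul, map_smul, (proj_eq_self_iff W _).2 (proj_apply_mem W x), ← sub_eq_zero,
    ← sub_smul, ← Complex.ofReal_sub] at h2
  have h3 := (smul_eq_zero.1 h2).resolve_left (Complex.ofReal_ne_zero.2 (sub_ne_zero.2 hμ.symm))
  rw [h3, smul_zero] at h1
  exact (smul_eq_zero.1 h1.symm).resolve_left (Complex.ofReal_ne_zero.2 hμ0)

end

section

variable {H : Type} [NormedAddCommGroup H] [InnerProductSpace ℂ H] [CompleteSpace H]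

/-- Iterating the C*-identity gives ‖S^(2^N)‖ = ‖S‖^(2^N), and the left side vanishes because N ≤
2^N. -/
theorem eq_zero_of_isSelfAdjoint_of_pow_eq_zero {S : H →L[ℂ] H} (hS : IsSelfAdjoint S) {N : ℕ}
    (h : S ^ N = 0) : S = 0 := by
  have h1 := hS.nnnorm_pow_two_pow N
  rw [pow_eq_zero_of_le (Nat.lt_two_pow_self (n := N)).le h, nnnorm_zero] at h1
  exact nnnorm_eq_zero.1 (pow_eq_zero_iff (by positivity) |>.1 h1.symm)

/-- A self-adjoint operator annihilated by a polynomial whose only roots that are eigenvalues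
are `0` and `lam` satisfies `φ (φ - lam) = 0`. -/
theorem mul_sub_eq_zero_of_aeval_eq_zero {φ : H →L[ℂ] H} (hφ : IsSelfAdjoint φ) {lam : ℝ}
    {p : ℂ[X]} (hp : p ≠ 0) (h : aeval φ p = 0)
    (hinj : ∀ μ ∈ p.roots, μ ≠ 0 → μ ≠ lam → ∀ x, φ x = μ • x → x = 0) :
    φ * (φ - (lam : ℂ) • 1) = 0 := by
  set q : ℂ[X] := X * (X - C (lam : ℂ)) with hq
  have hS : aeval φ q = φ * (φ - (lam : ℂ) • 1) := by
    rw [hq, map_mul, map_sub, aeval_X, aeval_C, Algebra.algebraMap_eq_smul_one]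
  -- Linear factors are removed one at a time. A factor at a root of `q` is completed to `q` and
  -- absorbed in the power, raising N; any other factor is injective and is cancelled.
  have key : ∀ s : Multiset ℂ,
      (∀ μ ∈ s, μ ≠ 0 → μ ≠ lam → ∀ x, φ x = μ • x → x = 0) →
      ∀ N, aeval φ ((s.map fun μ => X - C μ).prod * q ^ N) = 0 → ∃ N, aeval φ (q ^ N) = 0 := by
    intro s
    induction s using Multiset.induction_on with
    | empty => exact fun _ N hN => ⟨N, by simpa using hN⟩
    | cons μ s ih =>
      intro hs N hN
      have hs' := fun μ' hμ' => hs μ' (Multiset.mem_cons_of_mem hμ')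
      rw [Multiset.map_cons, Multiset.prod_cons, mul_assoc] at hN
      by_cases hμ : q.IsRoot μ
      · obtain ⟨r, hr⟩ := dvd_iff_isRoot.2 hμ
        refine ih hs' (N + 1) ?_
        have h1 : (s.map fun μ => X - C μ).prod * q ^ (N + 1) =
            r * ((X - C μ) * ((s.map fun μ => X - C μ).prod * q ^ N)) := by
          rw [pow_succ]
          nth_rewrite 2 [hr]
          ring
        rw [h1, map_mul, hN, mul_zero]
      · have h0 : μ ≠ 0 ∧ μ ≠ lam := by
          simpa [hq, IsRoot.def, sub_eq_zero] using hμ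
        refine ih hs' N ?_
        ext1 x
        refine hs μ (Multiset.mem_cons_self _ _) h0.1 h0.2 _ ?_
        rw [map_mul, map_sub, aeval_X, aeval_C, Algebra.algebraMap_eq_smul_one] at hN
        exact sub_eq_zero.1 (congrArg (fun A : H →L[ℂ] H => A x) hN)
  have h1 : aeval φ ((p.roots.map fun μ => X - C μ).prod * q ^ 0) = 0 := by
    rw [(IsAlgClosed.splits p).eq_prod_roots, map_mul, aeval_C,
      Algebra.algebraMap_eq_smul_one, smul_mul_assoc, one_mul] at h
    rw [pow_zero, mul_one]
    exact (smul_eq_zero.1 h).resolve_left (leadingCoeff_ne_zero.2 hp)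
  obtain ⟨N, hN⟩ := key _ hinj 0 h1
  rw [map_pow, hS] at hN
  refine eq_zero_of_isSelfAdjoint_of_pow_eq_zero ?_ hN
  have h2 : φ * (φ - (lam : ℂ) • 1) = φ * φ - (lam : ℂ) • φ := by
    rw [mul_sub, mul_smul_comm, mul_one]
  rw [h2, isSelfAdjoint_iff, star_sub, star_mul, hφ.star_eq, star_smul, hφ.star_eq,
    RCLike.star_def, Complex.conj_ofReal]

theorem aeval_smul_of_isIdempotentElem {A : Type*} [Ring A] [Algebra ℂ A] {P : A}
    (hP : IsIdempotentElem P) (c : ℂ) (p : ℂ[X]) :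
    aeval (c • P) p = p.eval 0 • (1 - P) + p.eval c • P := by
  induction p using Polynomial.induction_on' with
  | add p q hp hq => rw [map_add, hp, hq, eval_add, eval_add]; module
  | monomial m a =>
    rw [aeval_monomial, _root_.smul_pow, Algebra.algebraMap_eq_smul_one, smul_mul_assoc, one_mul]
    cases m with
    | zero => simp [← smul_add]
    | succ m => simp [hP.pow_succ_eq m, smul_smul]

variable {k : ℕ} (W : FinSubspaces k H)

theorem inner_proj_self (x : H) : ⟪x, proj W x⟫_ℂ = ((‖proj W x‖ ^ 2 : ℝ) : ℂ) := by
  rw [← (proj_eq_self_iff W _).2 (proj_apply_mem W x), ← proj_apply_inner,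
    (proj_eq_self_iff W _).2 (proj_apply_mem W x), inner_self_eq_norm_sq_to_K]
  simp

theorem norm_proj_sq (x : H) :
    ‖proj W x‖ ^ 2 = ∑ i, ‖⟪x, (Kahler.onb W i : H)⟫_ℂ‖ ^ 2 := by
  have h := (Kahler.onb W).sum_sq_norm_inner_left ⟨proj W x, proj_apply_mem W x⟩
  rw [Submodule.coe_norm] at h
  rw [← h]
  refine Finset.sum_congr rfl fun i _ => ?_
  rw [Submodule.coe_inner, proj_apply_inner, (proj_eq_self_iff W _).2 (Kahler.onb W i).2]

/-- Expanding in an orthonormal basis of `W` turns the sum into finitely many sums, each bounded by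
Bessel's inequality. -/
theorem summable_norm_proj_sq {ι : Type} {b : ι → H} (hb : Orthonormal ℂ b) :
    Summable fun i => ‖proj W (b i)‖ ^ 2 := by
  simp only [norm_proj_sq]
  exact summable_sum fun j _ => hb.inner_products_summable _

theorem isTraceClass_smul_proj {ι : Type} {b : ι → H} (hb : Orthonormal ℂ b) (c : ℂ) :
    IsTraceClass b (c • proj W) := by
  have h1 : CFC.abs (c • proj W) = ‖c‖ • proj W := by
    rw [CFC.abs_smul, CFC.abs_of_nonneg _ (isStarProjection_proj W).nonneg]
  have h2 : ∀ i, (⟪b i, (‖c‖ • proj W) (b i)⟫_ℂ).re = ‖c‖ * ‖proj W (b i)‖ ^ 2 := fun i => by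
    rw [smul_apply, ← Complex.coe_smul, inner_smul_right, inner_proj_self, Complex.re_ofReal_mul,
      Complex.ofReal_re]
  simp only [IsTraceClass, h1, h2]
  exact (summable_norm_proj_sq W hb).mul_left _

theorem trace_smul_proj {ι : Type} (b : ι → H) (c : ℝ) :
    trace b ((c : ℂ) • proj W) = ((∑' i, c * ‖proj W (b i)‖ ^ 2 : ℝ) : ℂ) := by
  rw [trace, Complex.ofReal_tsum]
  refine tsum_congr fun i => ?_
  rw [smul_apply, inner_smul_right, inner_proj_self, Complex.ofReal_mul]

end

section

variable {n : ℕ} {θ : Fin n → ℝ} {hθ : ∀ j, 0 < θ j} {V : ℝ[X]} {lam : ℝ} {k : ℕ}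

theorem polyOp_smul_proj (W : FinSubspaces k (Fock n)) (p : ℝ[X]) (hp : p.eval 0 = 0) :
    polyOp p ((lam : ℂ) • proj W) = ((p.eval lam : ℝ) : ℂ) • proj W := by
  have h := aeval_smul_of_isIdempotentElem (isStarProjection_proj W).isIdempotentElem (lam : ℂ)
    (p.map (algebraMap ℝ ℂ))
  have h1 : ∀ r : ℝ, (p.map (algebraMap ℝ ℂ)).eval (r : ℂ) = ((p.eval r : ℝ) : ℂ) := fun r =>
    eval_map_apply (algebraMap ℝ ℂ) r
  have h0 := h1 0
  rw [Complex.ofReal_zero, hp, Complex.ofReal_zero] at h0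
  rw [polyOp, h, h1, h0, zero_smul, zero_add]

theorem isStaticKSoliton_smul_proj (hV : V.eval 0 = 0) (hV' : V.derivative.eval 0 = 0)
    (hlam : lam ≠ 0) (hcrit : V.derivative.IsRoot lam) (W : FinSubspaces k (Fock n)) :
    IsStaticKSoliton θ hθ V lam k ((lam : ℂ) • proj W) where
  field := mem_fieldAlgebra θ hθ _
  hermitian := by
    rw [isSelfAdjoint_iff, star_smul, (isStarProjection_proj W).isSelfAdjoint.star_eq,
      RCLike.star_def, Complex.conj_ofReal]
  eom := by
    rw [polyOp_smul_proj W _ hV', hcrit, Complex.ofReal_zero, zero_smul]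
  finite_action := by
    refine ⟨(Real.sqrt ((2 * Real.pi) • thetaMatrix θ).det)⁻¹ *
      ∑' ν, V.eval lam * ‖proj W (numberBasis ν)‖ ^ 2, ?_⟩
    rw [HasStaticAction, polyOp_smul_proj W _ hV]
    refine ⟨isTraceClass_smul_proj W (orthonormal_numberBasis n) _, ?_⟩
    rw [trace_smul_proj, Complex.ofReal_mul]
  finiteDimensional := by
    rw [eigenspace_smul_proj W hlam]
    exact W.2.1
  rank := by
    rw [eigenspace_smul_proj W hlam]
    exact W.2.2
  others μ _ hμ0 hμ := eigenspace_smul_proj_eq_bot W hμ0 hμ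

/-- The eigenspace of a `k`-soliton. -/
noncomputable def solitonSpace (φ : StaticModuli θ hθ V lam k) : FinSubspaces k (Fock n) :=
  ⟨Module.End.eigenspace φ.1.toLinearMap (lam : ℂ), φ.2.finiteDimensional, φ.2.rank⟩

/-- A `k`-soliton is a multiple of the projection onto its eigenspace. -/
theorem eq_smul_proj (hV : V.eval 0 = 0) (hV0 : V ≠ 0) (hlam : lam ≠ 0)
    (φ : StaticModuli θ hθ V lam k) : φ.1 = (lam : ℂ) • proj (solitonSpace φ) := by
  obtain ⟨φ, hφ⟩ := φ
  -- If V' were zero, V would be the constant V(0) = 0.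
  have hd : V.derivative ≠ 0 := fun h => by
    have h1 := eq_C_of_natDegree_eq_zero (derivative_eq_zero.1 h)
    rw [h1, eval_C] at hV
    exact hV0 (by rw [h1, hV, C_0])
  have hlam' : (lam : ℂ) ≠ 0 := Complex.ofReal_ne_zero.2 hlam
  have hS := mul_sub_eq_zero_of_aeval_eq_zero hφ.hermitian (lam := lam)
    ((Polynomial.map_ne_zero_iff (algebraMap ℝ ℂ).injective).2 hd) hφ.eom
    fun μ hμ h0 hμl x hx => by
      by_contra hx0
      -- Eigenvalues of a self-adjoint operator are real, which disposes of the nonreal roots of V';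
      -- the remaining real ones are excluded by the definition of a `k`-soliton.
      have hconj := hφ.hermitian.isSymmetric.conj_eigenvalue_eq_self
        (Module.End.hasEigenvalue_of_hasEigenvector (μ := μ)
          ⟨Module.End.mem_eigenspace_iff.2 hx, hx0⟩)
      obtain ⟨r, rfl⟩ := Complex.conj_eq_iff_real.1 hconj
      have hr : V.derivative.IsRoot r := by
        have h1 := (mem_roots'.1 hμ).2
        rw [IsRoot.def] at h1
        have h2 : (V.derivative.map (algebraMap ℝ ℂ)).eval (r : ℂ) =
          ((V.derivative.eval r : ℝ) : ℂ) := eval_map_apply (algebraMap ℝ ℂ) r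
        exact Complex.ofReal_eq_zero.1 (h2.symm.trans h1)
      have h3 := hφ.others r hr (fun h => h0 (by rw [h, Complex.ofReal_zero]))
        (fun h => hμl (by rw [h]))
      exact hx0 ((Submodule.eq_bot_iff _).1 h3 x (Module.End.mem_eigenspace_iff.2 hx))
  have hφφ : φ * φ = (lam : ℂ) • φ := by
    rw [mul_sub, mul_smul_comm, mul_one] at hS
    exact sub_eq_zero.1 hS
  have hP : IsStarProjection ((lam : ℂ)⁻¹ • φ) := by
    refine ⟨?_, ?_⟩
    · change _ * _ = _
      rw [smul_mul_smul_comm, hφφ, smul_smul, mul_assoc, inv_mul_cancel₀ hlam', mul_one]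
    · rw [isSelfAdjoint_iff, star_smul, hφ.hermitian.star_eq, RCLike.star_def, map_inv₀,
        Complex.conj_ofReal]
  rw [← eq_proj_of_isStarProjection hP (solitonSpace ⟨φ, hφ⟩) ?_, smul_inv_smul₀ hlam']
  ext x
  refine Iff.trans ?_ (Module.End.mem_eigenspace_iff (f := φ.toLinearMap)).symm
  constructor
  · rintro ⟨y, rfl⟩
    change φ ((lam : ℂ)⁻¹ • φ y) = (lam : ℂ) • (lam : ℂ)⁻¹ • φ y
    rw [map_smul, smul_comm]
    exact congrArg _ (congrArg (fun A : Fock n →L[ℂ] Fock n => A y) hφφ)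
  · intro hx
    refine ⟨x, ?_⟩
    change (lam : ℂ)⁻¹ • φ x = x
    rw [inv_smul_eq_iff₀ hlam']
    exact hx

theorem range_soliton (hV : V.eval 0 = 0) (hV0 : V ≠ 0) (hlam : lam ≠ 0)
    (φ : StaticModuli θ hθ V lam k) :
    (solitonSpace φ).1 = LinearMap.range φ.1.toLinearMap := by
  rw [eq_smul_proj hV hV0 hlam φ, ← range_proj]
  exact (LinearMap.range_smul (proj (solitonSpace φ)).toLinearMap (lam : ℂ)
    (Complex.ofReal_ne_zero.2 hlam)).symm

variable (θ hθ)

/-- The moduli space of `k`-solitons is homeomorphic to the Grassmannian. -/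
noncomputable def moduliHomeomorph (hV : V.eval 0 = 0) (hV' : V.derivative.eval 0 = 0)
    (hV0 : V ≠ 0) (hlam : lam ≠ 0) (hcrit : V.derivative.IsRoot lam)
    (Φ : Splitting k (Fock n)) : StaticModuli θ hθ V lam k ≃ₜ Gr Φ where
  toFun φ := point Φ (solitonSpace φ)
  invFun q := ⟨(lam : ℂ) • proj (taut Φ q), isStaticKSoliton_smul_proj hV hV' hlam hcrit _⟩
  left_inv φ := Subtype.ext
    ((congrArg (fun W => (lam : ℂ) • proj W) (taut_point Φ _)).trans
      (eq_smul_proj hV hV0 hlam φ).symm)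
  right_inv q := by
    refine (congrArg (point Φ) (Subtype.ext ?_)).trans (point_taut Φ q)
    exact eigenspace_smul_proj _ hlam
  continuous_toFun := by
    rw [continuous_iff_proj_taut]
    -- The topology of the target is detected by projections, and the projection attached to φ is φ
    -- divided by λ.
    have h1 : (fun φ : StaticModuli θ hθ V lam k => proj (taut Φ (point Φ (solitonSpace φ)))) =
        fun φ => (lam : ℂ)⁻¹ • φ.1 := funext fun φ => by
      rw [taut_point, eq_smul_proj hV hV0 hlam φ,
        inv_smul_smul₀ (Complex.ofReal_ne_zero.2 hlam)]
    rw [h1]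
    exact (continuous_const_smul (lam : ℂ)⁻¹).comp continuous_subtype_val
  continuous_invFun := ((continuous_const_smul (lam : ℂ)).comp
    (continuous_proj_taut Φ)).subtype_mk _

end

end Moyal

theorem mainTheorem10 (n : ℕ) (hn : 1 ≤ n) (θ : Fin n → ℝ) (hθ : ∀ j, 0 < θ j)
    (V : ℝ[X]) (hV : V.eval 0 = 0) (hV' : V.derivative.eval 0 = 0) (hV0 : V ≠ 0)
    (lam : ℝ) (hlam : lam ≠ 0) (hcrit : V.derivative.IsRoot lam) (k : ℕ) (hk : 1 ≤ k) :
    Nonempty (Grass.Splitting k (Moyal.Fock n)) ∧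
    ¬ FiniteDimensional ℂ (Grass.Model k (Moyal.Fock n)) ∧
    ∀ Φ : Grass.Splitting k (Moyal.Fock n),
      Function.Bijective (Grass.taut Φ) ∧
      ∃ (cG : ChartedSpace (Grass.Model k (Moyal.Fock n)) (Grass.Gr Φ))
        (cM : ChartedSpace (Grass.Model k (Moyal.Fock n)) (Moyal.StaticModuli θ hθ V lam k)),
        Grass.IsGraphAtlas Φ cG ∧
        IsManifold 𝓘(ℂ, Grass.Model k (Moyal.Fock n)) ω (Grass.Gr Φ) ∧
        IsManifold 𝓘(ℂ, Grass.Model k (Moyal.Fock n)) ω (Moyal.StaticModuli θ hθ V lam k) ∧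
        ∃ (Ψ : Diffeomorph 𝓘(ℂ, Grass.Model k (Moyal.Fock n))
              𝓘(ℂ, Grass.Model k (Moyal.Fock n))
              (Moyal.StaticModuli θ hθ V lam k) (Grass.Gr Φ) ω)
          (Θ : Kahler.TwoForm (Grass.Model k (Moyal.Fock n)) (Grass.Gr Φ) ℂ)
          (ωG : Kahler.TwoForm (Grass.Model k (Moyal.Fock n)) (Grass.Gr Φ) ℝ)
          (ωM : Kahler.TwoForm (Grass.Model k (Moyal.Fock n))
              (Moyal.StaticModuli θ hθ V lam k) ℝ),
          (∀ φ, (Grass.taut Φ (Ψ φ)).1 = LinearMap.range φ.1.toLinearMap) ∧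
          Kahler.IsDetCurvature (Grass.taut Φ) Θ ∧
          (∀ p u v, Θ p ![u, v] = Complex.I * (ωG p ![u, v] : ℂ)) ∧
          Kahler.IsKahlerForm ωG ∧
          Kahler.IsKahlerForm ωM ∧
          ∀ φ u v, ωM φ ![u, v] = ωG (Ψ φ)
            ![mfderiv 𝓘(ℂ, Grass.Model k (Moyal.Fock n))
                𝓘(ℂ, Grass.Model k (Moyal.Fock n)) Ψ φ u,
              mfderiv 𝓘(ℂ, Grass.Model k (Moyal.Fock n))
                𝓘(ℂ, Grass.Model k (Moyal.Fock n)) Ψ φ v] := by 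
  refine ⟨Moyal.nonempty_splitting hn k, Moyal.not_finiteDimensional_model hn hk, fun Φ => ?_⟩
  let h := Moyal.moduliHomeomorph θ hθ hV hV' hV0 hlam hcrit Φ
  refine ⟨Grass.taut_bijective Φ, Grass.grassCharted Φ, Kahler.pullbackCharted h,
    Grass.isGraphAtlas_grassCharted Φ, Grass.isManifold_gr Φ,
    Kahler.isManifold_pullbackCharted h, Kahler.pullbackDiffeomorph h, Kahler.grassCurvature Φ,
    Kahler.imPart (Kahler.grassCurvature Φ),
    Kahler.pullbackForm h (Kahler.imPart (Kahler.grassCurvature Φ)), fun φ => ?_,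
    Kahler.isDetCurvature_grassCurvature Φ, Kahler.grassCurvature_eq_I_mul Φ,
    Kahler.isKahlerForm_grass Φ, Kahler.isKahlerForm_pullbackForm h (Kahler.isKahlerForm_grass Φ),
    fun φ u v => ?_⟩
  · exact (congrArg Subtype.val (Grass.taut_point Φ _)).trans
      (Moyal.range_soliton hV hV0 hlam φ)
  -- In the transported charts the derivative of the biholomorphism is the identity of the model
  -- space, so compatibility of the two Kähler forms holds by construction.
  · have h1 := fun w => congrArg (fun A : Grass.Model k (Moyal.Fock n) →L[ℂ]
      Grass.Model k (Moyal.Fock n) => A w) (Kahler.mfderiv_pullback h φ)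
    exact congrArg (Kahler.imPart (Kahler.grassCurvature Φ) (h φ))
      (congrArg₂ (fun a b => ![a, b]) (h1 u).symm (h1 v).symm)
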